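/- Let $A,Q,P\in\mathbb R^{n\times n}$, $B\in\mathbb R^{n\times m}$, $R\in\mathbb R^{m\times m}$, $K\in\mathbb R^{m\times n}$ with $Q\succ0$, $R\succeq0$, $P\succeq0$ symmetric, $R+B^\top PB$ invertible, $$P=A^\top PA-A^\top PB(R+B^\top PB)^{-1}B^\top PA+Q,\qquad K=-(R+B^\top PB)^{-1}B^\top PA .$$ Let $\underline x<0<\overline x$, $\underline u<0<\overline u$ (componentwise, infinite bounds allowed) and $k_u,k_x>0$. For $N\ge1$ and $x\in\mathbb R^n$ the pre-stabilised, soft-constrained MPC problem is to minimise, over $\delta\hat u_k,r_k$ ($0\le k<N$) and $s_k$ ($1\le k\le N$), $$J_N=\tfrac12\sum_{k=0}^{N-1}\hat u_k^\top R\hat u_k+\tfrac12\sum_{k=1}^{N-1}\hat x_k^\top Q\hat x_k+\tfrac12\hat x_N^\top P\hat x_N+k_u\sum_{k=0}^{N-1}\mathbf 1^\top r_k+k_x\sum_{k=1}^{N}\mathbf 1^\top s_k$$ subject to $\hat x_0=x$, $\hat u_k=K\hat x_k+\delta\hat u_k$, $\hat x_{k+1}=(A+BK)\hat x_k+B\delta\hat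 u_k$, $r_k,s_k\ge0$, $\underline u-r_k\le\hat u_k\le\overline u+r_k$, $\underline x-s_k\le\hat x_k\le\overline x+s_k$. The problem is feasible and has exactly one solution for every $x$ and every $N\ge1$. Let $\hat u_0^\star(x)$ be the first optimal input, $\ell(x,u)=x^\top Qx+u^\top Ru$, and $V_N^\star(x)=x^\top Qx+2\min J_N$ (the optimal cost in the normalisation of $\ell$). The closed loop is $x_{t+1}=Ax_t+B\hat u_0^\star(x_t)-\hat w_t$ with model error $\hat w_t$. For scalars $d,\alpha$ put $$\Gamma_N=\{x:\ V_N^\star(x)\le\ell(x,\hat u_0^\star(x))+(N-1)d+\alpha\}.$$ Then: (1) There are compact neighbourhoods $\Omega_{\bar N}$ ($\bar N\ge1$) of the origin, such that each compact subset of $\mathbb R^n$ lies in some $\Omega_{\bar N}$, and such that for $x_0\in\Omega_{\bar N}$ and $\hat w\equiv0$ the MPC is infinite-horizon optimal for every $N\ge\bar N$. That is, the infinite-horizon problem (minimise $\sum_{k\ge0}[\ell(\hat x_k,\hat u_k)+2k_u\mathbf 1^\top r_k+2k_x\mathbf 1^\top s_{k+1}]$ subject to the same constraints for all $k$) has a solution,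 the same for all $N\ge\bar N$, with finite cost $V_N^\star(x_0)$, whose first part is the MPC solution at $x_0$, and whose states and inputs are those of the closed loop. There are $d,\alpha>0$, depending on neither $N$, $k_u$ nor $k_x$, such that (2) and (3) hold. (2) Let $\hat w\equiv0$ and $N\ge1$. The set $\Gamma_N$ is a neighbourhood of the origin and positively invariant, and the origin is asymptotically stable on $\Gamma_N$: it is Lyapunov stable, and $x_t\to0$ for all $x_0\in\Gamma_N$. Moreover, for each bounded set of initial states there is a $\kappa>0$ (which may depend on $N$) such that, if $k_u,k_x\ge\kappa$, then for every $x_0\in\Gamma_N$ in this set for which the problem is feasible with zero slacks, the optimal slacks at $x_t$ are zero, $\underline u\le u_t\le\overline u$ and $\underline x\le x_{t+1}\le\overline x$ for all $t\ge0$, where $u_t=\hat u_0^\star(x_t)$. (3) For all $k_u,k_x>0$ there is a $\mu>0$ such that for every $N\ge1$ the following hold for model errors with $\|\hat w_t\|\le\mu$ for all $t$. The set $\Gamma_N$ is robustly positively invariant, and the closed loop is input-to-state stable on it: there are $\beta\in\mathcal{KL}$, $\gamma\in\mathcal K$ with $\|x_t\|\le\beta(\|x_0\|,t)+\gamma(\sup_{\tau<t}\|\hat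 w_\tau\|)$ for all $x_0\in\Gamma_N$. There is a continuous, strictly increasing, bounded $\sigma$ on $[0,\infty)$ with $\sigma(0)=0$ such that, for $x_t\in\Gamma_N$, $$V_N^\star(x_{t+1})\le V_N^\star(x_t)-\ell(x_t,\hat u_0^\star(x_t))+\sigma(\|\hat w_t\|).$$ The MPC constraints are robustly satisfied with zero optimal slacks, $\underline u\le u_t\le\overline u$ and $\underline x\le x_t\le\overline x$, for all $t\ge T_N$ with some $T_N$ common to all $x_0\in\Gamma_N$, and for all $t\ge0$ if $x_0^\top Px_0\le\alpha$. (4) Write the MPC problem as the QP $\min_z\frac12z^\top Hz+q^\top z$ s.t. $l_b\le Mz\le u_b$ in $z=(\delta\hat u,r,s)$, with predicted states and inputs eliminated. Then there is a constant $C$ such that for every $N\ge1$ the norms induced by the sup norm satisfy $\|H\|_\infty\le C$, $\|M\|_\infty\le C$, $\|M^\top\|_\infty\le C$, and $\|q\|_\infty\le C(1+\|x\|)$ for every current state $x$. -/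

import Mathlib

open Matrix Filter Topology

noncomputable section

/-- The Euclidean norm of a real vector. -/
def vnorm {ι : Type*} [Fintype ι] (x : ι → ℝ) : ℝ := ‖(WithLp.toLp 2 x : EuclideanSpace ℝ ι)‖

/-- Class `𝒦`: continuous and strictly increasing on `[0, ∞)`, zero at zero. -/
def ClassK (σ : ℝ → ℝ) : Prop :=
  ContinuousOn σ (Set.Ici 0) ∧ StrictMonoOn σ (Set.Ici 0) ∧ σ 0 = 0

/-- Class `𝒦ℒ` in discrete time. -/
def ClassKL (β : ℝ → ℕ → ℝ) : Prop :=
  (∀ t, ClassK fun s => β s t) ∧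
    ∀ s, 0 ≤ s → Antitone (β s) ∧ Tendsto (β s) atTop (𝓝 0)

/-- `lo - slack ≤ v ≤ hi + slack`, componentwise; the bounds may be infinite. -/
def InBox {p : ℕ} (lo hi : Fin p → EReal) (slack v : Fin p → ℝ) : Prop :=
  ∀ i, lo i ≤ ((v i + slack i : ℝ) : EReal) ∧ ((v i - slack i : ℝ) : EReal) ≤ hi i

/-- System matrices, cost matrices (with terminal cost `P`), feedback gain, box bounds. -/
structure MPCData (n m : ℕ) where
  A : Matrix (Fin n) (Fin n) ℝ
  B : Matrix (Fin n) (Fin m) ℝ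
  Q : Matrix (Fin n) (Fin n) ℝ
  R : Matrix (Fin m) (Fin m) ℝ
  P : Matrix (Fin n) (Fin n) ℝ
  K : Matrix (Fin m) (Fin n) ℝ
  xlo : Fin n → EReal
  xhi : Fin n → EReal
  ulo : Fin m → EReal
  uhi : Fin m → EReal

/-- Decision variables of the horizon-`N` problem: input perturbations `δu_k`, input slacks `r_k`
(`k = 0, …, N-1`), and state slacks, where `s k` belongs to the predicted state `x_{k+1}`. -/
@[ext] structure MPCDecision (n m N : ℕ) where
  du : Fin N → Fin m → ℝ
  r : Fin N → Fin m → ℝ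
  s : Fin N → Fin n → ℝ

instance (n m N : ℕ) : Nonempty (MPCDecision n m N) := ⟨⟨0, 0, 0⟩⟩

/-- A finite sequence of vectors, continued by zero. -/
def extendZero {N p : ℕ} (v : Fin N → Fin p → ℝ) (k : ℕ) : Fin p → ℝ :=
  if h : k < N then v ⟨k, h⟩ else 0

namespace MPCData

variable {n m : ℕ} (S : MPCData n m)

/-- The pre-stabilised state matrix `A + B K`. -/
def AK : Matrix (Fin n) (Fin n) ℝ := S.A + S.B * S.K

/-- Predicted states `x_0 = x`, `x_{k+1} = (A + B K) x_k + B δu_k`. -/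
def predState (x : Fin n → ℝ) (v : ℕ → Fin m → ℝ) : ℕ → Fin n → ℝ
  | 0 => x
  | k + 1 => S.AK *ᵥ predState x v k + S.B *ᵥ v k

/-- Predicted inputs `u_k = K x_k + δu_k`. -/
def predInput (x : Fin n → ℝ) (v : ℕ → Fin m → ℝ) (k : ℕ) : Fin m → ℝ :=
  S.K *ᵥ S.predState x v k + v k

/-- The stage cost `ℓ(x, u) = xᵀ Q x + uᵀ R u`. -/
def stageCost (x : Fin n → ℝ) (u : Fin m → ℝ) : ℝ := x ⬝ᵥ S.Q *ᵥ x + u ⬝ᵥ S.R *ᵥ u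

/-! ### The soft-constrained finite-horizon problem -/

/-- The constraints of the pre-stabilised MPC problem at the state `x`. -/
def IsFeasible (N : ℕ) (x : Fin n → ℝ) (z : MPCDecision n m N) : Prop :=
  (∀ k : Fin N, 0 ≤ z.r k ∧ InBox S.ulo S.uhi (z.r k) (S.predInput x (extendZero z.du) k)) ∧
  ∀ k : Fin N, 0 ≤ z.s k ∧ InBox S.xlo S.xhi (z.s k) (S.predState x (extendZero z.du) (k + 1))

/-- The objective of the pre-stabilised MPC problem. -/
def objective (ku kx : ℝ) (N : ℕ) (x : Fin n → ℝ) (z : MPCDecision n m N) : ℝ :=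
  1 / 2 * (∑ k ∈ Finset.range N,
      S.predInput x (extendZero z.du) k ⬝ᵥ S.R *ᵥ S.predInput x (extendZero z.du) k)
    + 1 / 2 * (∑ k ∈ Finset.Ico 1 N,
      S.predState x (extendZero z.du) k ⬝ᵥ S.Q *ᵥ S.predState x (extendZero z.du) k)
    + 1 / 2 * (S.predState x (extendZero z.du) N ⬝ᵥ S.P *ᵥ S.predState x (extendZero z.du) N)
    + ku * (∑ k, ∑ i, z.r k i) + kx * (∑ k, ∑ i, z.s k i)

/-- `z` solves the MPC problem at the state `x`. -/
def IsSolution (ku kx : ℝ) (N : ℕ) (x : Fin n → ℝ) (z : MPCDecision n m N) : Prop :=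
  S.IsFeasible N x z ∧
    ∀ z', S.IsFeasible N x z' → S.objective ku kx N x z ≤ S.objective ku kx N x z'

/-- The solution of the MPC problem at `x`. -/
def solution (ku kx : ℝ) (N : ℕ) (x : Fin n → ℝ) : MPCDecision n m N :=
  Classical.epsilon (S.IsSolution ku kx N x)

/-- The MPC feedback law: the first optimal input `K x + δu_0`. -/
def control (ku kx : ℝ) (N : ℕ) (x : Fin n → ℝ) : Fin m → ℝ :=
  S.predInput x (extendZero (S.solution ku kx N x).du) 0

/-- The optimal value `V_N(x)`, in the normalisation of the stage cost: twice the optimal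
objective (which has factors `1/2`), plus the term `xᵀ Q x` of the current state (a constant that
the objective leaves out). -/
def value (ku kx : ℝ) (N : ℕ) (x : Fin n → ℝ) : ℝ :=
  x ⬝ᵥ S.Q *ᵥ x + 2 * sInf (S.objective ku kx N x '' {z | S.IsFeasible N x z})

/-- The horizon-`N` problem at `x` is feasible with hard constraints, i.e. with zero slacks. -/
def HardFeasible (N : ℕ) (x : Fin n → ℝ) : Prop :=
  ∃ v : Fin N → Fin m → ℝ, S.IsFeasible N x ⟨v, 0, 0⟩

/-- The set `Γ_N`. -/
def Gam (ku kx d α : ℝ) (N : ℕ) : Set (Fin n → ℝ) :=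
  {x | S.value ku kx N x ≤ S.stageCost x (S.control ku kx N x) + ((N : ℝ) - 1) * d + α}

/-- One step of the closed loop with model error `w = A x + B u - x⁺`. -/
def step (ku kx : ℝ) (N : ℕ) (x w : Fin n → ℝ) : Fin n → ℝ :=
  S.A *ᵥ x + S.B *ᵥ S.control ku kx N x - w

/-- The closed-loop trajectory from `x₀` with model errors `w_t`. -/
def closedLoop (ku kx : ℝ) (N : ℕ) (x₀ : Fin n → ℝ) (w : ℕ → Fin n → ℝ) : ℕ → Fin n → ℝ
  | 0 => x₀
  | t + 1 => S.step ku kx N (closedLoop ku kx N x₀ w t) (w t)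

/-! ### The infinite-horizon problem -/

/-- The constraints of the infinite-horizon problem; `s k` is the slack of `x_{k+1}`. -/
def InfFeasible (x : Fin n → ℝ) (v r : ℕ → Fin m → ℝ) (s : ℕ → Fin n → ℝ) : Prop :=
  ∀ k, (0 ≤ r k ∧ InBox S.ulo S.uhi (r k) (S.predInput x v k)) ∧
    (0 ≤ s k ∧ InBox S.xlo S.xhi (s k) (S.predState x v (k + 1)))

/-- The infinite-horizon cost, in the normalisation of the stage cost. -/
def infCost (ku kx : ℝ) (x : Fin n → ℝ) (v r : ℕ → Fin m → ℝ) (s : ℕ → Fin n → ℝ) : ENNReal :=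
  ∑' k, ENNReal.ofReal (S.stageCost (S.predState x v k) (S.predInput x v k)
    + 2 * ku * (∑ i, r k i) + 2 * kx * (∑ i, s k i))

/-- `(v, r, s)` solves the infinite-horizon problem, with finite cost. -/
def InfOptimal (ku kx : ℝ) (x : Fin n → ℝ) (v r : ℕ → Fin m → ℝ) (s : ℕ → Fin n → ℝ) : Prop :=
  S.InfFeasible x v r s ∧ S.infCost ku kx x v r s ≠ ⊤ ∧
    ∀ v' r' s', S.InfFeasible x v' r' s' →
      S.infCost ku kx x v r s ≤ S.infCost ku kx x v' r' s'

/-! ### The quadratic program in `z = (δu, r, s)` -/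

/-- Block column `(I, A_K, …, A_K^N)`, with `A_K = A + B K`. -/
def PhiHat (N : ℕ) : Matrix (Fin (N + 1) × Fin n) (Fin n) ℝ :=
  Matrix.of fun p j => (S.AK ^ (p.1 : ℕ)) p.2 j

/-- Block Toeplitz matrix, zero first block row; block `(k, j)` is `A_K^(k-1-j) B` for `j < k`. -/
def PsiHat (N : ℕ) : Matrix (Fin (N + 1) × Fin n) (Fin N × Fin m) ℝ :=
  Matrix.of fun p q =>
    if (q.1 : ℕ) < (p.1 : ℕ) then (S.AK ^ ((p.1 : ℕ) - 1 - (q.1 : ℕ)) * S.B) p.2 q.2 else 0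

/-- `PsiHat` without its zero block row. -/
def Psi (N : ℕ) : Matrix (Fin N × Fin n) (Fin N × Fin m) ℝ :=
  (S.PsiHat N).submatrix (fun p => (p.1.succ, p.2)) id

/-- `diag(R, …, R)`. -/
def bigR (N : ℕ) : Matrix (Fin N × Fin m) (Fin N × Fin m) ℝ :=
  Matrix.of fun p q => if p.1 = q.1 then S.R p.2 q.2 else 0

/-- `diag(0, Q, …, Q, P)`. -/
def bigQHat (N : ℕ) : Matrix (Fin (N + 1) × Fin n) (Fin (N + 1) × Fin n) ℝ :=
  Matrix.of fun p q =>
    if p.1 = q.1 then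
      if (p.1 : ℕ) = 0 then 0 else if (p.1 : ℕ) = N then S.P p.2 q.2 else S.Q p.2 q.2
    else 0

/-- `[diag(K, …, K) 0]`. -/
def bigK (N : ℕ) : Matrix (Fin N × Fin m) (Fin (N + 1) × Fin n) ℝ :=
  Matrix.of fun p q => if p.1.castSucc = q.1 then S.K p.2 q.2 else 0

/-- `𝐊 Ψ̂ + I`, which maps `δu` to its contribution to the predicted inputs. -/
def inputMap (N : ℕ) : Matrix (Fin N × Fin m) (Fin N × Fin m) ℝ := S.bigK N * S.PsiHat N + 1

/-- The Hessian of the quadratic program. -/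
def qpH (N : ℕ) :
    Matrix ((Fin N × Fin m) ⊕ ((Fin N × Fin m) ⊕ (Fin N × Fin n)))
      ((Fin N × Fin m) ⊕ ((Fin N × Fin m) ⊕ (Fin N × Fin n))) ℝ :=
  Matrix.fromBlocks
    ((S.inputMap N)ᵀ * S.bigR N * S.inputMap N + (S.PsiHat N)ᵀ * S.bigQHat N * S.PsiHat N) 0 0 0

/-- The linear term of the quadratic program at the state `x`. -/
def qpq (ku kx : ℝ) (N : ℕ) (x : Fin n → ℝ) :
    (Fin N × Fin m) ⊕ ((Fin N × Fin m) ⊕ (Fin N × Fin n)) → ℝ :=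
  Sum.elim
    (((S.bigK N)ᵀ * S.bigR N * S.inputMap N + S.bigQHat N * S.PsiHat N)ᵀ *ᵥ (S.PhiHat N *ᵥ x))
    (Sum.elim (fun _ => ku) (fun _ => kx))

/-- The constraint matrix of the quadratic program; the six block rows are
`(𝐊Ψ̂+I, I, 0)`, `(𝐊Ψ̂+I, -I, 0)`, `(0, I, 0)`, `(Ψ, 0, I)`, `(Ψ, 0, -I)`, `(0, 0, I)`. -/
def qpM (N : ℕ) :
    Matrix (((Fin N × Fin m) ⊕ ((Fin N × Fin m) ⊕ (Fin N × Fin m))) ⊕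
        ((Fin N × Fin n) ⊕ ((Fin N × Fin n) ⊕ (Fin N × Fin n))))
      ((Fin N × Fin m) ⊕ ((Fin N × Fin m) ⊕ (Fin N × Fin n))) ℝ :=
  Matrix.fromRows
    (Matrix.fromRows (Matrix.fromCols (S.inputMap N) (Matrix.fromCols 1 0))
      (Matrix.fromRows (Matrix.fromCols (S.inputMap N) (Matrix.fromCols (-1) 0))
        (Matrix.fromCols 0 (Matrix.fromCols 1 0))))
    (Matrix.fromRows (Matrix.fromCols (S.Psi N) (Matrix.fromCols 0 1))
      (Matrix.fromRows (Matrix.fromCols (S.Psi N) (Matrix.fromCols 0 (-1)))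
        (Matrix.fromCols 0 (Matrix.fromCols 0 1))))

end MPCData

end

-- The norm of a matrix is the operator norm induced by the sup norm (largest absolute row sum).
attribute [local instance] Matrix.linftyOpNormedAddCommGroup

/-! ### Quadratic forms of real matrices. -/

section QuadraticForms

variable {ι κ : Type*} [Fintype ι] [Fintype κ]

/-! The Riccati equation completes the square: with `u = K x + v` and `W = R + Bᵀ P B`, stage cost
plus successor terminal cost equals `xᵀ P x + vᵀ W v` (`stageCost_add_terminal`). Once each slack is
replaced by the least feasible one, the problem is the unconstrained minimisation over `v` of `xᵀ P
x` plus a sum of `vᵀ W v` and penalties. `W` is positive definite, so a unique minimiser exists, and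
the value is at least `xᵀ P x`.

On the invariant set `xᵀ P x ≤ α` the feedback `K` meets all constraints and `v = 0` is optimal;
outside it each stage costs more than `d`. So an optimal prediction of cost at most `N d + α` ends
in this set (`quadP_terminal_le`). Appending a zero to it is then free, and longer horizons never
cost less, so it is optimal for every longer horizon and for the infinite one, and the closed loop
follows it (`settles_closedLoop`, `settles_infOptimal`).

Violations vanish near the origin and grow linearly, so `v = 0` costs at most `C xᵀ Q x` for every
horizon (`exists_cost_zero_le`). This yields the sets of infinite-horizon optimality and makes the
value contract along the closed loop. On `Γ_N` the shifted optimal sequence is the candidate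
(`Gam_successor`). A model error changes later predictions by a geometrically decaying response,
since `A + B K` is stable, so its effect on the cost is uniform in the horizon
(`exists_cost_perturbation`). Together these give robust invariance and input-to-state stability
(`exists_contraction`).

Exactness of the penalties rests on Hoffman's bound: a sequence of violation `τ` can be repaired by
a change of size `O(τ)`, which raises the quadratic cost by at most `G τ`; a penalty weight above
`G` forces `τ = 0` at the optimum (`exists_exact_penalty`). The bounds on the quadratic program are
row and column sums of block Toeplitz matrices whose entries decay geometrically. -/

theorem dotProduct_self_nonneg_real (x : ι → ℝ) : 0 ≤ x ⬝ᵥ x :=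
  Finset.sum_nonneg fun i _ => mul_self_nonneg (x i)

theorem sq_le_dotProduct_self (x : ι → ℝ) (i : ι) : x i ^ 2 ≤ x ⬝ᵥ x := by
  rw [sq]
  exact Finset.single_le_sum (f := fun i => x i * x i) (fun j _ => mul_self_nonneg _)
    (Finset.mem_univ i)

theorem vnorm_sq (x : ι → ℝ) : vnorm x ^ 2 = x ⬝ᵥ x := by
  rw [vnorm, EuclideanSpace.real_norm_sq_eq]
  simp [dotProduct, sq]

theorem vnorm_nonneg (x : ι → ℝ) : 0 ≤ vnorm x := norm_nonneg _

theorem abs_apply_le_vnorm (x : ι → ℝ) (i : ι) : |x i| ≤ vnorm x := by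
  refine abs_le_of_sq_le_sq ?_ (vnorm_nonneg x)
  rw [vnorm_sq]
  exact sq_le_dotProduct_self x i

theorem vnorm_zero : vnorm (0 : ι → ℝ) = 0 := by simp [vnorm]

theorem dotProduct_mulVec_comm {M : Matrix ι ι ℝ} (hM : Mᵀ = M) (x y : ι → ℝ) :
    x ⬝ᵥ M *ᵥ y = y ⬝ᵥ M *ᵥ x := by
  rw [dotProduct_mulVec, ← mulVec_transpose, hM, dotProduct_comm]

theorem quad_add {M : Matrix ι ι ℝ} (hM : Mᵀ = M) (x y : ι → ℝ) :
    (x + y) ⬝ᵥ M *ᵥ (x + y) = x ⬝ᵥ M *ᵥ x + 2 * (x ⬝ᵥ M *ᵥ y) + y ⬝ᵥ M *ᵥ y := by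
  rw [mulVec_add, add_dotProduct, dotProduct_add, dotProduct_add, dotProduct_mulVec_comm hM y x]
  ring

theorem quad_smul (M : Matrix ι ι ℝ) (a : ℝ) (x : ι → ℝ) :
    (a • x) ⬝ᵥ M *ᵥ (a • x) = a ^ 2 * (x ⬝ᵥ M *ᵥ x) := by
  rw [mulVec_smul, smul_dotProduct, dotProduct_smul, smul_eq_mul, smul_eq_mul]
  ring

theorem quad_neg (M : Matrix ι ι ℝ) (x : ι → ℝ) :
    (-x) ⬝ᵥ M *ᵥ (-x) = x ⬝ᵥ M *ᵥ x := by
  rw [mulVec_neg, neg_dotProduct, dotProduct_neg, neg_neg]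

omit [Fintype ι] in
theorem Matrix.PosSemidef.transpose_eq {M : Matrix ι ι ℝ} (hM : M.PosSemidef) : Mᵀ = M := by
  have := hM.1
  rwa [Matrix.IsHermitian, conjTranspose_eq_transpose_of_trivial] at this

theorem Matrix.PosSemidef.quad_nonneg {M : Matrix ι ι ℝ} (hM : M.PosSemidef) (x : ι → ℝ) :
    0 ≤ x ⬝ᵥ M *ᵥ x := by
  simpa using hM.dotProduct_mulVec_nonneg x

theorem Matrix.PosDef.quad_pos {M : Matrix ι ι ℝ} (hM : M.PosDef) {x : ι → ℝ} (hx : x ≠ 0) :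
    0 < x ⬝ᵥ M *ᵥ x := by
  simpa using hM.dotProduct_mulVec_pos hx

/-- Young's inequality: expand the form at `a x - y` and divide by `a`. -/
theorem Matrix.PosSemidef.two_mul_le {M : Matrix ι ι ℝ} (hM : M.PosSemidef) (x y : ι → ℝ)
    {a : ℝ} (ha : 0 < a) :
    2 * (x ⬝ᵥ M *ᵥ y) ≤ a * (x ⬝ᵥ M *ᵥ x) + a⁻¹ * (y ⬝ᵥ M *ᵥ y) := by
  have h := hM.quad_nonneg (a • x + (-y))
  rw [quad_add hM.transpose_eq, quad_smul, quad_neg, mulVec_neg, dotProduct_neg,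
    smul_dotProduct, smul_eq_mul] at h
  have h2 : 0 ≤ a⁻¹ * (a ^ 2 * (x ⬝ᵥ M *ᵥ x) + 2 * -(a * (x ⬝ᵥ M *ᵥ y)) + y ⬝ᵥ M *ᵥ y) :=
    mul_nonneg (inv_nonneg.2 ha.le) h
  have h3 : a⁻¹ * (a ^ 2 * (x ⬝ᵥ M *ᵥ x) + 2 * -(a * (x ⬝ᵥ M *ᵥ y)) + y ⬝ᵥ M *ᵥ y)
      = a * (x ⬝ᵥ M *ᵥ x) - 2 * (x ⬝ᵥ M *ᵥ y) + a⁻¹ * (y ⬝ᵥ M *ᵥ y) := by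
    field_simp
    ring
  linarith

theorem Matrix.PosSemidef.quad_add_le {M : Matrix ι ι ℝ} (hM : M.PosSemidef) (x y : ι → ℝ)
    {a : ℝ} (ha : 0 < a) :
    (x + y) ⬝ᵥ M *ᵥ (x + y) ≤ (1 + a) * (x ⬝ᵥ M *ᵥ x) + (1 + a⁻¹) * (y ⬝ᵥ M *ᵥ y) := by
  rw [quad_add hM.transpose_eq]
  linarith [hM.two_mul_le x y ha]

/-- Cauchy-Schwarz in each row; the constant is the squared Frobenius norm. -/
theorem exists_mulVec_bound (M : Matrix κ ι ℝ) :
    ∃ C : ℝ, 0 ≤ C ∧ ∀ x : ι → ℝ, (M *ᵥ x) ⬝ᵥ (M *ᵥ x) ≤ C * (x ⬝ᵥ x) := by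
  refine ⟨∑ i, ∑ j, M i j ^ 2, by positivity, fun x => ?_⟩
  rw [dotProduct, Finset.sum_mul]
  refine Finset.sum_le_sum fun i _ => ?_
  have := Finset.sum_mul_sq_le_sq_mul_sq Finset.univ (M i) x
  simp only [mulVec, dotProduct, ← sq]
  exact this

/-- Expand `0 ≤ ‖x - M x‖²` and bound `‖M x‖²`; no symmetry of `M` is needed. -/
theorem exists_quad_le (M : Matrix ι ι ℝ) :
    ∃ C : ℝ, 0 < C ∧ ∀ x : ι → ℝ, x ⬝ᵥ M *ᵥ x ≤ C * (x ⬝ᵥ x) := by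
  obtain ⟨C, hC, h⟩ := exists_mulVec_bound M
  refine ⟨C + 1, by linarith, fun x => ?_⟩
  have h1 := dotProduct_self_nonneg_real (x - M *ᵥ x)
  rw [sub_dotProduct, dotProduct_sub, dotProduct_sub, dotProduct_comm (M *ᵥ x) x] at h1
  have h2 := dotProduct_self_nonneg_real x
  nlinarith [h x]

theorem continuous_quad (M : Matrix ι ι ℝ) : Continuous fun x : ι → ℝ => x ⬝ᵥ M *ᵥ x := by
  fun_prop

/-- The constant is the minimum of the form on the compact unit sphere; homogeneity does the rest.
-/
theorem Matrix.PosDef.exists_le_quad {M : Matrix ι ι ℝ} (hM : M.PosDef) :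
    ∃ c : ℝ, 0 < c ∧ ∀ x : ι → ℝ, c * (x ⬝ᵥ x) ≤ x ⬝ᵥ M *ᵥ x := by
  rcases isEmpty_or_nonempty ι with hι | hι
  -- Without coordinates the unit sphere is empty and has no minimiser.
  · exact ⟨1, one_pos, fun x => by simp [dotProduct]⟩
  have hK : IsCompact {x : ι → ℝ | x ⬝ᵥ x = 1} := by
    refine Metric.isCompact_of_isClosed_isBounded
      (isClosed_eq (by fun_prop) continuous_const) ?_
    refine (Metric.isBounded_closedBall (x := (0 : ι → ℝ)) (r := 1)).subset fun x hx => ?_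
    rw [mem_closedBall_zero_iff, pi_norm_le_iff_of_nonneg zero_le_one]
    intro i
    have := sq_le_dotProduct_self x i
    rw [Set.mem_ofPred_eq] at hx
    rw [hx] at this
    exact abs_le_one_iff_mul_self_le_one.2 (by rwa [sq] at this)
  have hne : {x : ι → ℝ | x ⬝ᵥ x = 1}.Nonempty := by
    classical
    obtain ⟨i⟩ := hι
    exact ⟨Pi.single i 1, by simp⟩
  obtain ⟨x₀, hx₀, hmin⟩ := hK.exists_isMinOn hne (continuous_quad M).continuousOn
  refine ⟨x₀ ⬝ᵥ M *ᵥ x₀, hM.quad_pos ?_, fun x => ?_⟩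
  · rintro rfl
    simp at hx₀
  · by_cases hx : x = 0
    · simp [hx]
    have hpos : 0 < x ⬝ᵥ x :=
      lt_of_le_of_ne (dotProduct_self_nonneg_real x) (fun h => hx (dotProduct_self_eq_zero.1 h.symm))
    set r := Real.sqrt (x ⬝ᵥ x)
    have hr : 0 < r := Real.sqrt_pos.2 hpos
    have hr2 : r ^ 2 = x ⬝ᵥ x := Real.sq_sqrt hpos.le
    have h1 : (r⁻¹ • x) ∈ {x : ι → ℝ | x ⬝ᵥ x = 1} := by
      rw [Set.mem_ofPred_eq, smul_dotProduct, dotProduct_smul, smul_eq_mul, smul_eq_mul, ← hr2]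
      field_simp
    have h2 := hmin h1
    simp only [Set.mem_ofPred_eq] at h2
    rw [quad_smul, inv_pow, hr2, inv_mul_eq_div, le_div_iff₀ hpos] at h2
    exact h2

/-- The exact convexity defect at a midpoint; uniqueness of the optimal perturbations comes from it.
-/
theorem quad_midpoint {M : Matrix ι ι ℝ} (hM : Mᵀ = M)
    (x y : ι → ℝ) :
    ((1 / 2 : ℝ) • (x + y)) ⬝ᵥ M *ᵥ ((1 / 2 : ℝ) • (x + y))
      = 1 / 2 * (x ⬝ᵥ M *ᵥ x) + 1 / 2 * (y ⬝ᵥ M *ᵥ y) - 1 / 4 * ((x - y) ⬝ᵥ M *ᵥ (x - y)) := by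
  rw [quad_smul, sub_eq_add_neg x y, quad_add hM, quad_add hM, quad_neg, mulVec_neg,
    dotProduct_neg]
  ring

end QuadraticForms

/-! ### Violation of box constraints. -/

section Violation

/-- The least slack `t ≥ 0` with `lo ≤ v + t` and `v - t ≤ hi`. -/
noncomputable def viol (lo hi : EReal) (v : ℝ) : ℝ :=
  max 0 (max (lo - v).toReal (v - hi).toReal)

theorem viol_nonneg (lo hi : EReal) (v : ℝ) : 0 ≤ viol lo hi v := le_max_left _ _

/-- An infinite bound makes the difference infinite, and `toReal` sends that to `0`, so it never
contributes. The sign hypotheses exclude `lo = ⊤` and `hi = ⊥`, where this default value would be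
wrong. -/
theorem viol_le_iff {lo hi : EReal} (hlo : lo < 0) (hhi : 0 < hi) {v t : ℝ} (ht : 0 ≤ t) :
    viol lo hi v ≤ t ↔ lo ≤ ((v + t : ℝ) : EReal) ∧ ((v - t : ℝ) : EReal) ≤ hi := by
  have h1 : (lo - v).toReal ≤ t ↔ lo ≤ ((v + t : ℝ) : EReal) := by
    induction lo with
    | bot => simp [ht]
    | top => simp at hlo
    | coe a =>
      rw [← EReal.coe_sub, EReal.toReal_coe, EReal.coe_le_coe_iff]
      constructor <;> intro h <;> linarith
  have h2 : (v - hi).toReal ≤ t ↔ ((v - t : ℝ) : EReal) ≤ hi := by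
    induction hi with
    | bot => simp at hhi
    | top => simp [ht]
    | coe a =>
      rw [← EReal.coe_sub, EReal.toReal_coe, EReal.coe_le_coe_iff]
      constructor <;> intro h <;> linarith
  rw [viol, max_le_iff, max_le_iff, h1, h2]
  exact and_iff_right ht

variable {lo hi : EReal}

/-- The least slack at `v`, enlarged by `|e|`, is feasible at `v + e`. -/
theorem viol_add_le (hlo : lo < 0) (hhi : 0 < hi) (v e : ℝ) :
    viol lo hi (v + e) ≤ viol lo hi v + |e| := by
  have h := (viol_le_iff hlo hhi (viol_nonneg lo hi v)).1 le_rfl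
  rw [viol_le_iff hlo hhi (add_nonneg (viol_nonneg _ _ _) (abs_nonneg e))]
  constructor
  · refine h.1.trans (EReal.coe_le_coe_iff.2 ?_)
    linarith [neg_abs_le e]
  · refine le_trans (EReal.coe_le_coe_iff.2 ?_) h.2
    linarith [le_abs_self e]

theorem viol_zero (hlo : lo < 0) (hhi : 0 < hi) : viol lo hi 0 = 0 := by
  refine le_antisymm ((viol_le_iff hlo hhi le_rfl).2 ?_) (viol_nonneg _ _ _)
  simp [hlo.le, hhi.le]

theorem viol_le_abs (hlo : lo < 0) (hhi : 0 < hi) (v : ℝ) : viol lo hi v ≤ |v| := by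
  have := viol_add_le hlo hhi 0 v
  rwa [zero_add, viol_zero hlo hhi, zero_add] at this

theorem continuous_viol (hlo : lo < 0) (hhi : 0 < hi) : Continuous (viol lo hi) := by
  refine (LipschitzWith.of_le_add_mul 1 fun x y => ?_).continuous
  have := viol_add_le hlo hhi y (x - y)
  rwa [add_sub_cancel, ← Real.dist_eq, ← one_mul (dist x y)] at this

/-- Extended bounds are not averaged: the mean of two numbers above `lo` lies above the smaller of
them, and dually for `hi`. -/
theorem viol_midpoint_le (hlo : lo < 0) (hhi : 0 < hi) (v w : ℝ) :
    viol lo hi (1 / 2 * (v + w)) ≤ 1 / 2 * viol lo hi v + 1 / 2 * viol lo hi w := by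
  have hv := (viol_le_iff hlo hhi (viol_nonneg lo hi v)).1 le_rfl
  have hw := (viol_le_iff hlo hhi (viol_nonneg lo hi w)).1 le_rfl
  have h0 := viol_nonneg lo hi v
  have h1 := viol_nonneg lo hi w
  rw [viol_le_iff hlo hhi (by linarith)]
  constructor
  · rcases le_total (v + viol lo hi v) (w + viol lo hi w) with h | h
    · exact hv.1.trans (EReal.coe_le_coe_iff.2 (by linarith))
    · exact hw.1.trans (EReal.coe_le_coe_iff.2 (by linarith))
  · rcases le_total (v - viol lo hi v) (w - viol lo hi w) with h | h
    · exact le_trans (EReal.coe_le_coe_iff.2 (by linarith)) hw.2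
    · exact le_trans (EReal.coe_le_coe_iff.2 (by linarith)) hv.2

theorem exists_viol_eq_zero (hlo : lo < 0) (hhi : 0 < hi) :
    ∃ ε : ℝ, 0 < ε ∧ ∀ v, |v| ≤ ε → viol lo hi v = 0 := by
  obtain ⟨a, ha, ha'⟩ := EReal.lt_iff_exists_real_btwn.1 hlo
  obtain ⟨b, hb, hb'⟩ := EReal.lt_iff_exists_real_btwn.1 hhi
  have ha0 : a < 0 := by exact_mod_cast ha'
  have hb0 : 0 < b := by exact_mod_cast hb
  refine ⟨min (-a) b, lt_min (by linarith) hb0, fun v hv => ?_⟩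
  have h1 := (abs_le.1 hv).1
  have h2 := (abs_le.1 hv).2
  have h3 := min_le_left (-a) b
  have h4 := min_le_right (-a) b
  refine le_antisymm ((viol_le_iff hlo hhi le_rfl).2 ⟨?_, ?_⟩) (viol_nonneg _ _ _)
  · exact ha.le.trans (EReal.coe_le_coe_iff.2 (by linarith))
  · exact le_trans (EReal.coe_le_coe_iff.2 (by linarith)) hb'.le

/-- The least slack vector of a box constraint. -/
noncomputable def violVec {p : ℕ} (lo hi : Fin p → EReal) (v : Fin p → ℝ) : Fin p → ℝ :=
  fun i => viol (lo i) (hi i) (v i)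

/-- The total violation of a box constraint. -/
noncomputable def violSum {p : ℕ} (lo hi : Fin p → EReal) (v : Fin p → ℝ) : ℝ :=
  ∑ i, viol (lo i) (hi i) (v i)

variable {p : ℕ} {lo hi : Fin p → EReal}

theorem violVec_nonneg (v : Fin p → ℝ) : 0 ≤ violVec lo hi v := fun _ => viol_nonneg _ _ _

theorem violSum_nonneg (v : Fin p → ℝ) : 0 ≤ violSum lo hi v :=
  Finset.sum_nonneg fun _ _ => viol_nonneg _ _ _

theorem inBox_iff (h : ∀ i, lo i < 0 ∧ 0 < hi i) {s v : Fin p → ℝ} (hs : 0 ≤ s) :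
    InBox lo hi s v ↔ violVec lo hi v ≤ s :=
  forall_congr' fun i => (viol_le_iff (h i).1 (h i).2 (hs i)).symm

theorem violSum_eq_zero_iff (v : Fin p → ℝ) : violSum lo hi v = 0 ↔ violVec lo hi v = 0 := by
  rw [violSum, Finset.sum_eq_zero_iff_of_nonneg fun _ _ => viol_nonneg _ _ _, funext_iff]
  simp [violVec]

theorem violSum_add_le (h : ∀ i, lo i < 0 ∧ 0 < hi i) (v e : Fin p → ℝ) :
    violSum lo hi (v + e) ≤ violSum lo hi v + ∑ i, |e i| := by
  rw [violSum, violSum, ← Finset.sum_add_distrib]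
  exact Finset.sum_le_sum fun i _ => viol_add_le (h i).1 (h i).2 _ _

theorem continuous_violSum (h : ∀ i, lo i < 0 ∧ 0 < hi i) : Continuous (violSum lo hi) :=
  continuous_finsetSum _ fun i _ => (continuous_viol (h i).1 (h i).2).comp (continuous_apply i)

theorem violSum_midpoint_le (h : ∀ i, lo i < 0 ∧ 0 < hi i) (v w : Fin p → ℝ) :
    violSum lo hi ((1 / 2 : ℝ) • (v + w)) ≤ 1 / 2 * violSum lo hi v + 1 / 2 * violSum lo hi w := by
  rw [violSum, violSum, violSum, Finset.mul_sum, Finset.mul_sum, ← Finset.sum_add_distrib]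
  exact Finset.sum_le_sum fun i _ => viol_midpoint_le (h i).1 (h i).2 _ _

theorem exists_violSum_eq_zero (h : ∀ i, lo i < 0 ∧ 0 < hi i) :
    ∃ ε : ℝ, 0 < ε ∧ ∀ v : Fin p → ℝ, v ⬝ᵥ v ≤ ε → violSum lo hi v = 0 := by
  choose e he hv using fun i => exists_viol_eq_zero (h i).1 (h i).2
  have : ∃ ε : ℝ, 0 < ε ∧ ∀ i, ε ≤ e i := by
    rcases isEmpty_or_nonempty (Fin p) with hp | hp
    · exact ⟨1, one_pos, fun i => hp.elim i⟩
    · obtain ⟨i, hi⟩ := Finite.exists_min e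
      exact ⟨e i, he i, hi⟩
  obtain ⟨ε, hε, hεe⟩ := this
  refine ⟨ε ^ 2, by positivity, fun v hvε => Finset.sum_eq_zero fun i _ => hv i _ ?_⟩
  exact (abs_le_of_sq_le_sq ((sq_le_dotProduct_self v i).trans hvε) hε.le).trans (hεe i)

/-- A function that vanishes near the origin and grows at most linearly is dominated by a quadratic.
This makes the linear penalties comparable with the stage cost. -/
theorem exists_violSum_le_quad (h : ∀ i, lo i < 0 ∧ 0 < hi i) :
    ∃ C : ℝ, 0 ≤ C ∧ ∀ v : Fin p → ℝ, violSum lo hi v ≤ C * (v ⬝ᵥ v) := by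
  obtain ⟨ε, hε, hz⟩ := exists_violSum_eq_zero h
  refine ⟨p * ε⁻¹ + p, by positivity, fun v => ?_⟩
  have h0 := dotProduct_self_nonneg_real v
  rcases le_or_gt (v ⬝ᵥ v) ε with hle | hgt
  · rw [hz v hle]; positivity
  have hsum : violSum lo hi v ≤ ∑ _i : Fin p, (1 + v ⬝ᵥ v) := by
    refine Finset.sum_le_sum fun i _ => (viol_le_abs (h i).1 (h i).2 _).trans ?_
    have := sq_le_dotProduct_self v i
    nlinarith [sq_nonneg (|v i| - 1), sq_abs (v i)]
  rw [Finset.sum_const, Finset.card_univ, Fintype.card_fin, nsmul_eq_mul] at hsum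
  have h1 : 1 ≤ ε⁻¹ * (v ⬝ᵥ v) := by
    rw [inv_mul_eq_div, le_div_iff₀ hε]; linarith
  have h2 : (p : ℝ) * 1 ≤ p * (ε⁻¹ * (v ⬝ᵥ v)) := by gcongr
  linarith

end Violation

/-! ### The Riccati identity and the terminal region. -/

namespace MPCData

variable {n m : ℕ}

/-- The standing assumptions on the data. -/
structure Admissible (S : MPCData n m) : Prop where
  hQ : S.Q.PosDef
  hR : S.R.PosSemidef
  hP : S.P.PosSemidef
  hinv : IsUnit (S.R + S.Bᵀ * S.P * S.B)
  hDARE : S.P = S.Aᵀ * S.P * S.A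
      - S.Aᵀ * S.P * S.B * (S.R + S.Bᵀ * S.P * S.B)⁻¹ * S.Bᵀ * S.P * S.A + S.Q
  hK : S.K = -((S.R + S.Bᵀ * S.P * S.B)⁻¹ * S.Bᵀ * S.P * S.A)
  hx : ∀ i, S.xlo i < 0 ∧ 0 < S.xhi i
  hu : ∀ i, S.ulo i < 0 ∧ 0 < S.uhi i

/-- The weight `R + Bᵀ P B` of input perturbations. -/
noncomputable def weight (S : MPCData n m) : Matrix (Fin m) (Fin m) ℝ := S.R + S.Bᵀ * S.P * S.B

namespace Admissible

variable {S : MPCData n m} (h : S.Admissible)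
include h

theorem weight_posSemidef : S.weight.PosSemidef := by
  have := h.hP.conjTranspose_mul_mul_same S.B
  rw [conjTranspose_eq_transpose_of_trivial] at this
  exact h.hR.add this

/-- An invertible positive semidefinite matrix is definite, so `R` itself may be singular. -/
theorem weight_posDef : S.weight.PosDef :=
  h.weight_posSemidef.posDef_iff_isUnit.2 h.hinv

theorem weight_mul_K : S.weight * S.K = -(S.Bᵀ * S.P * S.A) := by
  have hdet : IsUnit S.weight.det := (Matrix.isUnit_iff_isUnit_det _).1 h.hinv
  have hK : S.K = -(S.weight⁻¹ * (S.Bᵀ * S.P * S.A)) := by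
    rw [h.hK, weight]; simp only [Matrix.mul_assoc]
  rw [hK, Matrix.mul_neg, Matrix.mul_nonsing_inv_cancel_left _ _ hdet]

/-- The Riccati equation with the inverse absorbed into `K`: `Kᵀ W = -Aᵀ P B` is the transpose of
`weight_mul_K`. -/
theorem P_eq : S.P = S.Aᵀ * S.P * S.A - S.Kᵀ * S.weight * S.K + S.Q := by
  have hPt := h.hP.transpose_eq
  have hWt := h.weight_posSemidef.transpose_eq
  have h1 : S.Kᵀ * S.weight = -(S.Aᵀ * S.P * S.B) := by
    have := congrArg transpose h.weight_mul_K
    rw [transpose_mul, hWt, transpose_neg, transpose_mul, transpose_mul, transpose_transpose,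
      hPt, ← Matrix.mul_assoc] at this
    exact this
  rw [h1]
  conv_lhs => rw [h.hDARE]
  conv_rhs => rw [h.hK]
  simp only [Matrix.mul_assoc, Matrix.neg_mul, Matrix.mul_neg, neg_neg]

/-- Completion of the square. With `u = K x + v`, the cross term of `A x` and `B u` in the successor
cost is `-uᵀ W K x` by `weight_mul_K`, and together with `uᵀ W u` and the Riccati term `(K x)ᵀ W (K
x)` it forms the square `(u - K x)ᵀ W (u - K x)`. -/
theorem stageCost_add_terminal (x : Fin n → ℝ) (v : Fin m → ℝ) :
    S.stageCost x (S.K *ᵥ x + v) + (S.AK *ᵥ x + S.B *ᵥ v) ⬝ᵥ S.P *ᵥ (S.AK *ᵥ x + S.B *ᵥ v)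
      = x ⬝ᵥ S.P *ᵥ x + v ⬝ᵥ S.weight *ᵥ v := by
  have hPt := h.hP.transpose_eq
  have hWt := h.weight_posSemidef.transpose_eq
  set u := S.K *ᵥ x + v with hu
  have hnext : S.AK *ᵥ x + S.B *ᵥ v = S.A *ᵥ x + S.B *ᵥ u := by
    rw [AK, hu, add_mulVec, mulVec_add, mulVec_mulVec, add_assoc]
  have hv : v = u + -(S.K *ᵥ x) := by rw [hu]; abel
  have hcross : (S.A *ᵥ x) ⬝ᵥ S.P *ᵥ (S.B *ᵥ u) = -(u ⬝ᵥ S.weight *ᵥ (S.K *ᵥ x)) := by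
    rw [dotProduct_mulVec_comm hPt, mulVec_mulVec x S.weight S.K, h.weight_mul_K, neg_mulVec,
      dotProduct_neg, neg_neg, ← mulVec_mulVec, ← mulVec_mulVec,
      dotProduct_mulVec u S.Bᵀ, vecMul_transpose]
  have hxP : x ⬝ᵥ S.P *ᵥ x = (S.A *ᵥ x) ⬝ᵥ S.P *ᵥ (S.A *ᵥ x)
      - (S.K *ᵥ x) ⬝ᵥ S.weight *ᵥ (S.K *ᵥ x) + x ⬝ᵥ S.Q *ᵥ x := by
    conv_lhs => rw [h.P_eq]
    rw [add_mulVec, sub_mulVec, dotProduct_add, dotProduct_sub, ← mulVec_mulVec, ← mulVec_mulVec,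
      ← mulVec_mulVec, ← mulVec_mulVec, dotProduct_mulVec x S.Aᵀ, dotProduct_mulVec x S.Kᵀ,
      vecMul_transpose, vecMul_transpose]
  have hBB : (S.B *ᵥ u) ⬝ᵥ S.P *ᵥ (S.B *ᵥ u) + u ⬝ᵥ S.R *ᵥ u = u ⬝ᵥ S.weight *ᵥ u := by
    rw [weight, add_mulVec, dotProduct_add, ← mulVec_mulVec, ← mulVec_mulVec,
      dotProduct_mulVec u S.Bᵀ, vecMul_transpose]
    ring
  rw [hnext, quad_add hPt, hcross, hxP]
  conv_rhs => rw [hv]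
  rw [quad_add hWt, quad_neg, mulVec_neg, dotProduct_neg, stageCost]
  linarith

theorem quadQ_nonneg (x : Fin n → ℝ) : 0 ≤ x ⬝ᵥ S.Q *ᵥ x := h.hQ.posSemidef.quad_nonneg x

theorem quadQ_le_stageCost (x : Fin n → ℝ) (u : Fin m → ℝ) :
    x ⬝ᵥ S.Q *ᵥ x ≤ S.stageCost x u := le_add_of_nonneg_right (h.hR.quad_nonneg u)

theorem stageCost_nonneg (x : Fin n → ℝ) (u : Fin m → ℝ) : 0 ≤ S.stageCost x u :=
  (h.quadQ_nonneg x).trans (h.quadQ_le_stageCost x u)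

theorem quadP_AK_le (x : Fin n → ℝ) :
    (S.AK *ᵥ x) ⬝ᵥ S.P *ᵥ (S.AK *ᵥ x) ≤ x ⬝ᵥ S.P *ᵥ x - x ⬝ᵥ S.Q *ᵥ x := by
  have h1 := h.stageCost_add_terminal x 0
  simp only [mulVec_zero, add_zero, dotProduct_zero] at h1
  linarith [h.quadQ_le_stageCost x (S.K *ᵥ x)]

theorem quadQ_le_quadP (x : Fin n → ℝ) : x ⬝ᵥ S.Q *ᵥ x ≤ x ⬝ᵥ S.P *ᵥ x := by
  linarith [h.quadP_AK_le x, h.hP.quad_nonneg (S.AK *ᵥ x)]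

/-- The terminal cost decays under the unconstrained optimal feedback. -/
theorem exists_rate : ∃ η : ℝ, 0 < η ∧ η < 1 ∧
    (∀ x : Fin n → ℝ, η * (x ⬝ᵥ S.P *ᵥ x) ≤ x ⬝ᵥ S.Q *ᵥ x) ∧
    ∀ x : Fin n → ℝ, (S.AK *ᵥ x) ⬝ᵥ S.P *ᵥ (S.AK *ᵥ x) ≤ (1 - η) * (x ⬝ᵥ S.P *ᵥ x) := by
  obtain ⟨c, hc, hcQ⟩ := h.hQ.exists_le_quad
  obtain ⟨C, hC, hCP⟩ := exists_quad_le S.P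
  -- With `c ‖x‖² ≤ xᵀ Q x` and `xᵀ P x ≤ C ‖x‖²` the ratio `c / C` would do; the larger denominator
  -- keeps the rate strictly below one.
  have key : ∀ x : Fin n → ℝ, c / (C + c) * (x ⬝ᵥ S.P *ᵥ x) ≤ x ⬝ᵥ S.Q *ᵥ x := by
    intro x
    rw [div_mul_eq_mul_div, div_le_iff₀ (by linarith)]
    have h1 := mul_le_mul_of_nonneg_left (hCP x) hc.le
    have h2 := mul_le_mul_of_nonneg_left (hcQ x) hC.le
    nlinarith [h.quadQ_nonneg x]
  refine ⟨c / (C + c), by positivity, (div_lt_one (by linarith)).2 (by linarith), key,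
    fun x => ?_⟩
  linarith [key x, h.quadP_AK_le x]

/-- A sublevel set of the terminal cost on which the linear feedback meets the constraints. -/
theorem exists_terminal_level : ∃ α : ℝ, 0 < α ∧ ∀ x : Fin n → ℝ, x ⬝ᵥ S.P *ᵥ x ≤ α →
    violSum S.xlo S.xhi x = 0 ∧ violSum S.ulo S.uhi (S.K *ᵥ x) = 0 := by
  obtain ⟨c, hc, hcQ⟩ := h.hQ.exists_le_quad
  obtain ⟨C, hC, hCK⟩ := exists_mulVec_bound S.K
  obtain ⟨ε₁, h1, hx⟩ := exists_violSum_eq_zero h.hx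
  obtain ⟨ε₂, h2, hu⟩ := exists_violSum_eq_zero h.hu
  -- Both entries turn `c ‖x‖² ≤ xᵀ P x ≤ α` into a bound on `‖x‖²`; `C + 1` avoids division by
  -- zero.
  refine ⟨min (c * ε₁) (c * (ε₂ / (C + 1))), by positivity, fun x hxα => ?_⟩
  have hb := (hcQ x).trans ((h.quadQ_le_quadP x).trans hxα)
  have hb1 := le_of_mul_le_mul_left (hb.trans (min_le_left _ _)) hc
  have hb2 := le_of_mul_le_mul_left (hb.trans (min_le_right _ _)) hc
  rw [le_div_iff₀ (by linarith)] at hb2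
  exact ⟨hx _ hb1, hu _ ((hCK x).trans (by nlinarith [dotProduct_self_nonneg_real x]))⟩

end Admissible

/-! ### Cost of input perturbation sequences -/

section Cost

variable (S : MPCData n m) (ku kx : ℝ)

/-- The sequence `v` without its first entry. -/
def shift (v : ℕ → Fin m → ℝ) : ℕ → Fin m → ℝ := fun k => v (k + 1)

/-- Penalty of the least slacks in stage `k`. -/
noncomputable def penalty (x : Fin n → ℝ) (v : ℕ → Fin m → ℝ) (k : ℕ) : ℝ :=
  2 * ku * violSum S.ulo S.uhi (S.predInput x v k)
    + 2 * kx * violSum S.xlo S.xhi (S.predState x v (k + 1))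

/-- The horizon-`N` cost of `v` with least slacks, in the normalisation of the stage cost. -/
noncomputable def cost (N : ℕ) (x : Fin n → ℝ) (v : ℕ → Fin m → ℝ) : ℝ :=
  x ⬝ᵥ S.P *ᵥ x + ∑ k ∈ Finset.range N, (v k ⬝ᵥ S.weight *ᵥ v k + S.penalty ku kx x v k)

/-- `v` minimises the horizon-`N` cost. -/
def IsOpt (N : ℕ) (x : Fin n → ℝ) (v : ℕ → Fin m → ℝ) : Prop :=
  ∀ v', S.cost ku kx N x v ≤ S.cost ku kx N x v'

variable {S ku kx}

theorem predState_succ' (x : Fin n → ℝ) (v : ℕ → Fin m → ℝ) (k : ℕ) :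
    S.predState x v (k + 1) = S.predState (S.predState x v 1) (shift v) k := by
  induction k with
  | zero => rfl
  | succ k ih => rw [predState, ih]; rfl

theorem predInput_succ (x : Fin n → ℝ) (v : ℕ → Fin m → ℝ) (k : ℕ) :
    S.predInput x v (k + 1) = S.predInput (S.predState x v 1) (shift v) k := by
  rw [predInput, predState_succ']; rfl

theorem penalty_succ (x : Fin n → ℝ) (v : ℕ → Fin m → ℝ) (k : ℕ) :
    S.penalty ku kx x v (k + 1) = S.penalty ku kx (S.predState x v 1) (shift v) k := by
  rw [penalty, predInput_succ, predState_succ' x v (k + 1), penalty]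

theorem predState_congr {x : Fin n → ℝ} {v v' : ℕ → Fin m → ℝ} {k : ℕ}
    (hv : ∀ j < k, v j = v' j) : S.predState x v k = S.predState x v' k := by
  induction k with
  | zero => rfl
  | succ k ih => rw [predState, predState, ih fun j hj => hv j (by omega), hv k (by omega)]

theorem predInput_congr {x : Fin n → ℝ} {v v' : ℕ → Fin m → ℝ} {k : ℕ}
    (hv : ∀ j < k + 1, v j = v' j) : S.predInput x v k = S.predInput x v' k := by
  rw [predInput, predInput, predState_congr fun j hj => hv j (by omega), hv k (by omega)]

theorem penalty_congr {x : Fin n → ℝ} {v v' : ℕ → Fin m → ℝ} {k : ℕ}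
    (hv : ∀ j < k + 1, v j = v' j) : S.penalty ku kx x v k = S.penalty ku kx x v' k := by
  rw [penalty, penalty, predInput_congr hv, predState_congr hv]

theorem cost_congr {N : ℕ} {x : Fin n → ℝ} {v v' : ℕ → Fin m → ℝ}
    (hv : ∀ j < N, v j = v' j) : S.cost ku kx N x v = S.cost ku kx N x v' := by
  rw [cost, cost]
  congr 1
  refine Finset.sum_congr rfl fun k hk => ?_
  rw [Finset.mem_range] at hk
  rw [hv k hk, penalty_congr fun j hj => hv j (by omega)]

theorem penalty_nonneg (hku : 0 ≤ ku) (hkx : 0 ≤ kx) (x : Fin n → ℝ) (v : ℕ → Fin m → ℝ) (k : ℕ) :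
    0 ≤ S.penalty ku kx x v k := by
  have := violSum_nonneg (lo := S.ulo) (hi := S.uhi) (S.predInput x v k)
  have := violSum_nonneg (lo := S.xlo) (hi := S.xhi) (S.predState x v (k + 1))
  rw [penalty]; positivity

theorem cost_zero (x : Fin n → ℝ) (v : ℕ → Fin m → ℝ) :
    S.cost ku kx 0 x v = x ⬝ᵥ S.P *ᵥ x := by simp [cost]

theorem cost_succ_last (N : ℕ) (x : Fin n → ℝ) (v : ℕ → Fin m → ℝ) :
    S.cost ku kx (N + 1) x v
      = S.cost ku kx N x v + (v N ⬝ᵥ S.weight *ᵥ v N + S.penalty ku kx x v N) := by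
  rw [cost, cost, Finset.sum_range_succ, add_assoc]

namespace Admissible

variable (h : S.Admissible)
include h

/-- Bellman's recursion: the Riccati identity trades `xᵀ P x + v₀ᵀ W v₀` for the first stage cost
and the terminal form at the successor, from which the shifted sequence starts. -/
theorem cost_succ (N : ℕ) (x : Fin n → ℝ) (v : ℕ → Fin m → ℝ) :
    S.cost ku kx (N + 1) x v = S.stageCost x (S.predInput x v 0) + S.penalty ku kx x v 0
      + S.cost ku kx N (S.predState x v 1) (shift v) := by
  have := h.stageCost_add_terminal x (v 0)
  rw [cost, Finset.sum_range_succ']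
  simp only [penalty_succ]
  rw [cost, predInput]
  simp only [predState] at this ⊢
  simp only [shift]
  linarith

/-- The Riccati identity telescopes along the prediction. The definition of `cost` displays
convexity and the lower bound; this form is the cost that the controller minimises. -/
theorem cost_eq_sum (N : ℕ) (x : Fin n → ℝ) (v : ℕ → Fin m → ℝ) :
    S.cost ku kx N x v = ∑ k ∈ Finset.range N,
      (S.stageCost (S.predState x v k) (S.predInput x v k) + S.penalty ku kx x v k)
      + S.predState x v N ⬝ᵥ S.P *ᵥ S.predState x v N := by
  induction N with
  | zero => simp [cost, predState]
  | succ N ih =>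
    rw [cost_succ_last, ih, Finset.sum_range_succ]
    have := h.stageCost_add_terminal (S.predState x v N) (v N)
    rw [predInput, predState]
    linarith

theorem quadP_le_cost (hku : 0 ≤ ku) (hkx : 0 ≤ kx) (N : ℕ) (x : Fin n → ℝ)
    (v : ℕ → Fin m → ℝ) : x ⬝ᵥ S.P *ᵥ x ≤ S.cost ku kx N x v :=
  le_add_of_nonneg_right <| Finset.sum_nonneg fun _ _ =>
    add_nonneg (h.weight_posSemidef.quad_nonneg _) (penalty_nonneg hku hkx _ _ _)

theorem cost_le_cost_succ (hku : 0 ≤ ku) (hkx : 0 ≤ kx) (N : ℕ) (x : Fin n → ℝ)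
    (v : ℕ → Fin m → ℝ) : S.cost ku kx N x v ≤ S.cost ku kx (N + 1) x v := by
  rw [cost_succ_last]
  exact le_add_of_nonneg_right
    (add_nonneg (h.weight_posSemidef.quad_nonneg _) (penalty_nonneg hku hkx _ _ _))

/-- The tail of an optimal sequence is optimal. -/
theorem isOpt_shift {N : ℕ} {x : Fin n → ℝ} {v : ℕ → Fin m → ℝ}
    (hv : S.IsOpt ku kx (N + 1) x v) :
    S.IsOpt ku kx N (S.predState x v 1) (shift v) := by
  intro v'
  -- Prepend the optimal first entry to a competitor of the tail; the first stage then cancels.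
  have h1 := hv (fun k => Nat.casesOn k (v 0) v')
  rw [h.cost_succ, h.cost_succ] at h1
  exact le_of_add_le_add_left h1

/-- The cost of the unconstrained optimal feedback is bounded by the stage cost. -/
theorem exists_cost_zero_le (hku : 0 ≤ ku) (hkx : 0 ≤ kx) : ∃ C : ℝ, 1 < C ∧
    ∀ (N : ℕ) (x : Fin n → ℝ), S.cost ku kx N x 0 ≤ C * (x ⬝ᵥ S.Q *ᵥ x) := by
  obtain ⟨η, hη, hη1, hPQ, -⟩ := h.exists_rate
  obtain ⟨c, hc, hcQ⟩ := h.hQ.exists_le_quad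
  obtain ⟨C₁, hC₁, hK⟩ := exists_mulVec_bound S.K
  obtain ⟨C₂, hC₂, hA⟩ := exists_mulVec_bound S.AK
  obtain ⟨D₁, hD₁, hu⟩ := exists_violSum_le_quad h.hu
  obtain ⟨D₂, hD₂, hx⟩ := exists_violSum_le_quad h.hx
  -- In each stage the penalty is at most `E` times the state cost, so the penalised cost is at most
  -- `1 + E` times the unpenalised one.
  set E := 2 * ku * (D₁ * C₁ / c) + 2 * kx * (D₂ * C₂ / c) with hE
  have hE0 : 0 ≤ E := by positivity
  have hpen : ∀ x k, S.penalty ku kx x 0 k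
      ≤ E * (S.predState x 0 k ⬝ᵥ S.Q *ᵥ S.predState x 0 k) := by
    intro x k
    rw [penalty, predInput, predState]
    simp only [Pi.zero_apply, mulVec_zero, add_zero]
    set y := S.predState x 0 k
    have hy : y ⬝ᵥ y ≤ (y ⬝ᵥ S.Q *ᵥ y) / c := by
      rw [le_div_iff₀ hc, mul_comm]; exact hcQ y
    have e1 : violSum S.ulo S.uhi (S.K *ᵥ y) ≤ D₁ * (C₁ * ((y ⬝ᵥ S.Q *ᵥ y) / c)) :=
      (hu _).trans (mul_le_mul_of_nonneg_left
        ((hK y).trans (mul_le_mul_of_nonneg_left hy hC₁)) hD₁)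
    have e2 : violSum S.xlo S.xhi (S.AK *ᵥ y) ≤ D₂ * (C₂ * ((y ⬝ᵥ S.Q *ᵥ y) / c)) :=
      (hx _).trans (mul_le_mul_of_nonneg_left
        ((hA y).trans (mul_le_mul_of_nonneg_left hy hC₂)) hD₂)
    calc _ ≤ 2 * ku * (D₁ * (C₁ * ((y ⬝ᵥ S.Q *ᵥ y) / c)))
          + 2 * kx * (D₂ * (C₂ * ((y ⬝ᵥ S.Q *ᵥ y) / c))) := by gcongr
      _ = _ := by rw [hE]; ring
  refine ⟨(1 + E) * η⁻¹, ?_, fun N x => ?_⟩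
  · have : 1 < η⁻¹ := (one_lt_inv₀ hη).2 hη1
    nlinarith
  -- With both penalties zero and no perturbations, the two forms of the cost give the unconstrained
  -- value `xᵀ P x` for every horizon.
  have hbase : ∑ k ∈ Finset.range N, S.stageCost (S.predState x 0 k) (S.predInput x 0 k)
      + S.predState x 0 N ⬝ᵥ S.P *ᵥ S.predState x 0 N = x ⬝ᵥ S.P *ᵥ x := by
    have := h.cost_eq_sum (ku := 0) (kx := 0) N x 0
    simp only [cost, penalty, mul_zero, zero_mul, add_zero, Pi.zero_apply, dotProduct_zero,
      mulVec_zero, Finset.sum_const_zero] at this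
    exact this.symm
  have hterm := h.hP.quad_nonneg (S.predState x 0 N)
  have hsum : ∑ k ∈ Finset.range N, S.penalty ku kx x 0 k
      ≤ E * ∑ k ∈ Finset.range N, S.stageCost (S.predState x 0 k) (S.predInput x 0 k) := by
    rw [Finset.mul_sum]
    exact Finset.sum_le_sum fun k _ => (hpen x k).trans
      (mul_le_mul_of_nonneg_left (h.quadQ_le_stageCost _ _) hE0)
  have hfin : S.cost ku kx N x 0 ≤ (1 + E) * (x ⬝ᵥ S.P *ᵥ x) := by
    rw [h.cost_eq_sum, Finset.sum_add_distrib, ← hbase]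
    nlinarith
  refine hfin.trans ?_
  rw [mul_assoc]
  refine mul_le_mul_of_nonneg_left ?_ (by linarith)
  rw [inv_mul_eq_div, le_div_iff₀ hη, mul_comm]
  exact hPQ x

end Admissible

end Cost

end MPCData

/-! ### Elimination of the slacks, existence and uniqueness of the solution. -/

theorem extendZero_of_lt {N p : ℕ} (w : Fin N → Fin p → ℝ) {k : ℕ} (hk : k < N) :
    extendZero w k = w ⟨k, hk⟩ := dif_pos hk

theorem extendZero_of_le {N p : ℕ} (w : Fin N → Fin p → ℝ) {k : ℕ} (hk : N ≤ k) :
    extendZero w k = 0 := dif_neg (by omega)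

theorem continuous_extendZero {N p : ℕ} (k : ℕ) :
    Continuous fun w : Fin N → Fin p → ℝ => extendZero w k := by
  rcases lt_or_ge k N with hk | hk
  · simp only [extendZero_of_lt _ hk]; fun_prop
  · simp only [extendZero_of_le _ hk]; fun_prop

namespace MPCData

variable {n m : ℕ} {S : MPCData n m} {ku kx : ℝ}

theorem continuous_predState {E : Type*} [TopologicalSpace E] (x : Fin n → ℝ)
    {f : E → ℕ → Fin m → ℝ} (hf : ∀ k, Continuous fun w => f w k) (k : ℕ) :
    Continuous fun w => S.predState x (f w) k := by
  induction k with
  | zero => exact continuous_const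
  | succ k ih =>
    simp only [predState]
    exact (continuous_const.matrix_mulVec ih).add (continuous_const.matrix_mulVec (hf k))

theorem continuous_predInput {E : Type*} [TopologicalSpace E] (x : Fin n → ℝ)
    {f : E → ℕ → Fin m → ℝ} (hf : ∀ k, Continuous fun w => f w k) (k : ℕ) :
    Continuous fun w => S.predInput x (f w) k :=
  (continuous_const.matrix_mulVec (continuous_predState x hf k)).add (hf k)

theorem predState_midpoint (x : Fin n → ℝ) (v v' : ℕ → Fin m → ℝ) (k : ℕ) :
    S.predState x (fun k => (1 / 2 : ℝ) • (v k + v' k)) k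
      = (1 / 2 : ℝ) • (S.predState x v k + S.predState x v' k) := by
  induction k with
  | zero => simp only [predState]; rw [← two_smul ℝ x, smul_smul]; norm_num
  | succ k ih =>
    simp only [predState]
    rw [ih, mulVec_smul, mulVec_smul, mulVec_add, mulVec_add, ← smul_add]
    congr 1
    abel

theorem predInput_midpoint (x : Fin n → ℝ) (v v' : ℕ → Fin m → ℝ) (k : ℕ) :
    S.predInput x (fun k => (1 / 2 : ℝ) • (v k + v' k)) k
      = (1 / 2 : ℝ) • (S.predInput x v k + S.predInput x v' k) := by
  rw [predInput, predState_midpoint, mulVec_smul, mulVec_add, ← smul_add, predInput, predInput]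
  congr 1
  abel

/-- The decision with input perturbations `v` and the least feasible slacks. -/
noncomputable def leastSlack (S : MPCData n m) (N : ℕ) (x : Fin n → ℝ) (v : ℕ → Fin m → ℝ) :
    MPCDecision n m N :=
  ⟨fun k => v k, fun k => violVec S.ulo S.uhi (S.predInput x v k),
    fun k => violVec S.xlo S.xhi (S.predState x v (k + 1))⟩

theorem extendZero_leastSlack {N : ℕ} (x : Fin n → ℝ) (v : ℕ → Fin m → ℝ) {k : ℕ} (hk : k < N) :
    extendZero (S.leastSlack N x v).du k = v k := extendZero_of_lt _ hk

/-- The optimal input perturbations, continued by zero. -/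
noncomputable def opt (S : MPCData n m) (ku kx : ℝ) (N : ℕ) (x : Fin n → ℝ) : ℕ → Fin m → ℝ :=
  extendZero (S.solution ku kx N x).du

theorem opt_of_le {N k : ℕ} (x : Fin n → ℝ) (hk : N ≤ k) : S.opt ku kx N x k = 0 :=
  extendZero_of_le _ hk

namespace Admissible

variable (h : S.Admissible)
include h

theorem isFeasible_iff {N : ℕ} {x : Fin n → ℝ} {z : MPCDecision n m N} :
    S.IsFeasible N x z ↔ ∀ k : Fin N,
      violVec S.ulo S.uhi (S.predInput x (extendZero z.du) k) ≤ z.r k ∧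
      violVec S.xlo S.xhi (S.predState x (extendZero z.du) (k + 1)) ≤ z.s k := by
  rw [IsFeasible, ← forall_and]
  refine forall_congr' fun k => and_congr ⟨fun hk => (inBox_iff h.hu hk.1).1 hk.2, fun hk => ?_⟩
    ⟨fun hk => (inBox_iff h.hx hk.1).1 hk.2, fun hk => ?_⟩
  · have h0 := (violVec_nonneg _).trans hk
    exact ⟨h0, (inBox_iff h.hu h0).2 hk⟩
  · have h0 := (violVec_nonneg _).trans hk
    exact ⟨h0, (inBox_iff h.hx h0).2 hk⟩

/-- The objective is the reduced cost plus the penalised excess of the slacks over the least ones.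
The added `xᵀ Q x` is the stage `k = 0` that the objective omits; splitting it off needs `N ≥ 1`. -/
theorem two_mul_objective {N : ℕ} (hN : 1 ≤ N) (x : Fin n → ℝ) (z : MPCDecision n m N) :
    x ⬝ᵥ S.Q *ᵥ x + 2 * S.objective ku kx N x z = S.cost ku kx N x (extendZero z.du)
      + 2 * ku * ∑ k : Fin N, ∑ i,
        (z.r k i - violVec S.ulo S.uhi (S.predInput x (extendZero z.du) k) i)
      + 2 * kx * ∑ k : Fin N, ∑ i,
        (z.s k i - violVec S.xlo S.xhi (S.predState x (extendZero z.du) (k + 1)) i) := by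
  simp only [Finset.sum_sub_distrib]
  rw [h.cost_eq_sum, objective]
  simp only [penalty, stageCost, violSum, violVec, Finset.sum_add_distrib, ← Finset.mul_sum]
  rw [Fin.sum_univ_eq_sum_range (fun k => ∑ i, viol (S.ulo i) (S.uhi i)
      (S.predInput x (extendZero z.du) k i)),
    Fin.sum_univ_eq_sum_range (fun k => ∑ i, viol (S.xlo i) (S.xhi i)
      (S.predState x (extendZero z.du) (k + 1) i)),
    Finset.range_eq_Ico, Finset.sum_eq_sum_Ico_succ_bot (show 0 < N by omega)
      (fun k => S.predState x (extendZero z.du) k ⬝ᵥ S.Q *ᵥ S.predState x (extendZero z.du) k)]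
  simp only [predState, zero_add]
  ring

/-- The reduced cost is continuous and dominates `c ‖w‖²`, so a minimiser over a large enough closed
ball is global. -/
theorem exists_isOpt (hku : 0 ≤ ku) (hkx : 0 ≤ kx) (N : ℕ) (x : Fin n → ℝ) :
    ∃ v, S.IsOpt ku kx N x v := by
  set g : (Fin N → Fin m → ℝ) → ℝ := fun w => S.cost ku kx N x (extendZero w) with hg
  have hcont : Continuous g := by
    refine continuous_const.add (continuous_finsetSum _ fun k _ => ?_)
    refine ((continuous_quad S.weight).comp (continuous_extendZero k)).add ?_
    exact (continuous_const.mul ((continuous_violSum h.hu).comp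
      (continuous_predInput x continuous_extendZero k))).add
      (continuous_const.mul ((continuous_violSum h.hx).comp
      (continuous_predState x continuous_extendZero (k + 1))))
  obtain ⟨c, hc, hcW⟩ := h.weight_posDef.exists_le_quad
  have hcoer : ∀ w, c * ‖w‖ ^ 2 ≤ g w := by
    intro w
    have hg0 : 0 ≤ g w := (h.hP.quad_nonneg x).trans (h.quadP_le_cost hku hkx N x _)
    have hw : ‖w‖ ≤ Real.sqrt (g w / c) := by
      refine (pi_norm_le_iff_of_nonneg (Real.sqrt_nonneg _)).2 fun k =>
        (pi_norm_le_iff_of_nonneg (Real.sqrt_nonneg _)).2 fun i => ?_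
      refine Real.abs_le_sqrt ?_
      rw [le_div_iff₀ hc, mul_comm]
      have h1 := (mul_le_mul_of_nonneg_left (sq_le_dotProduct_self (w k) i) hc.le).trans (hcW _)
      have h2 : extendZero w k ⬝ᵥ S.weight *ᵥ extendZero w k ≤ g w := by
        have hnn : ∀ j ∈ Finset.range N, 0 ≤ extendZero w j ⬝ᵥ S.weight *ᵥ extendZero w j
            + S.penalty ku kx x (extendZero w) j := fun j _ =>
          add_nonneg (h.weight_posSemidef.quad_nonneg _) (penalty_nonneg hku hkx _ _ _)
        have h3 := Finset.single_le_sum hnn (Finset.mem_range.2 k.2)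
        have h4 := penalty_nonneg (S := S) hku hkx x (extendZero w) k
        have h5 := h.hP.quad_nonneg x
        simp only [hg, cost]
        linarith
      rw [extendZero_of_lt w k.2] at h2
      exact h1.trans h2
    have := pow_le_pow_left₀ (norm_nonneg w) hw 2
    rw [Real.sq_sqrt (by positivity), le_div_iff₀ hc] at this
    linarith
  have hg0 : 0 ≤ g 0 := (h.hP.quad_nonneg x).trans (h.quadP_le_cost hku hkx N x _)
  obtain ⟨w, -, hw⟩ := (isCompact_closedBall (0 : Fin N → Fin m → ℝ)
    (Real.sqrt (g 0 / c))).exists_isMinOn ⟨0, by simp⟩ hcont.continuousOn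
  have hmin : ∀ w', g w ≤ g w' := by
    intro w'
    by_cases hw' : w' ∈ Metric.closedBall (0 : Fin N → Fin m → ℝ) (Real.sqrt (g 0 / c))
    · exact hw hw'
    · rw [mem_closedBall_zero_iff, not_le] at hw'
      have h1 : g w ≤ g 0 := hw (by simp)
      have h2 := pow_lt_pow_left₀ hw' (Real.sqrt_nonneg _) two_ne_zero
      rw [Real.sq_sqrt (by positivity), div_lt_iff₀ hc] at h2
      linarith [hcoer w']
  refine ⟨extendZero w, fun v' => ?_⟩
  have := hmin fun k => v' k
  simp only [hg] at this
  rwa [cost_congr (v := extendZero fun k : Fin N => v' k) (v' := v')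
    fun j hj => extendZero_of_lt _ hj] at this

/-- The midpoint of two minimisers would be cheaper by a quarter of the `W`-form of their
difference. Entries from `N` on do not enter the cost. -/
theorem isOpt_unique (hku : 0 ≤ ku) (hkx : 0 ≤ kx) {N : ℕ} {x : Fin n → ℝ}
    {v v' : ℕ → Fin m → ℝ} (hv : S.IsOpt ku kx N x v) (hv' : S.IsOpt ku kx N x v') :
    ∀ k < N, v k = v' k := by
  have hmid := hv fun k => (1 / 2 : ℝ) • (v k + v' k)
  have heq : S.cost ku kx N x v = S.cost ku kx N x v' := le_antisymm (hv _) (hv' _)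
  have hle : S.cost ku kx N x (fun k => (1 / 2 : ℝ) • (v k + v' k))
      ≤ 1 / 2 * S.cost ku kx N x v + 1 / 2 * S.cost ku kx N x v'
        - 1 / 4 * ∑ k ∈ Finset.range N, (v k - v' k) ⬝ᵥ S.weight *ᵥ (v k - v' k) := by
    simp only [cost]
    have hterm : ∀ k ∈ Finset.range N,
        ((1 / 2 : ℝ) • (v k + v' k)) ⬝ᵥ S.weight *ᵥ ((1 / 2 : ℝ) • (v k + v' k))
          + S.penalty ku kx x (fun k => (1 / 2 : ℝ) • (v k + v' k)) k
        ≤ 1 / 2 * (v k ⬝ᵥ S.weight *ᵥ v k + S.penalty ku kx x v k)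
          + 1 / 2 * (v' k ⬝ᵥ S.weight *ᵥ v' k + S.penalty ku kx x v' k)
          - 1 / 4 * ((v k - v' k) ⬝ᵥ S.weight *ᵥ (v k - v' k)) := by
      intro k _
      rw [quad_midpoint h.weight_posSemidef.transpose_eq, penalty,
        penalty, penalty, predInput_midpoint, predState_midpoint]
      have h1 := mul_le_mul_of_nonneg_left
        (violSum_midpoint_le h.hu (S.predInput x v k) (S.predInput x v' k))
        (mul_nonneg zero_le_two hku)
      have h2 := mul_le_mul_of_nonneg_left
        (violSum_midpoint_le h.hx (S.predState x v (k + 1)) (S.predState x v' (k + 1)))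
        (mul_nonneg zero_le_two hkx)
      linarith
    have hs := Finset.sum_le_sum hterm
    simp only [Finset.sum_sub_distrib, Finset.sum_add_distrib, ← Finset.mul_sum] at hs ⊢
    linarith
  have hnn : ∀ k ∈ Finset.range N, 0 ≤ (v k - v' k) ⬝ᵥ S.weight *ᵥ (v k - v' k) :=
    fun k _ => h.weight_posSemidef.quad_nonneg _
  have hzero : ∑ k ∈ Finset.range N, (v k - v' k) ⬝ᵥ S.weight *ᵥ (v k - v' k) = 0 :=
    le_antisymm (by linarith) (Finset.sum_nonneg hnn)
  intro k hk
  by_contra hne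
  exact (h.weight_posDef.quad_pos (sub_ne_zero.2 hne)).ne'
    ((Finset.sum_eq_zero_iff_of_nonneg hnn).1 hzero k (Finset.mem_range.2 hk))

theorem isFeasible_leastSlack (N : ℕ) (x : Fin n → ℝ) (v : ℕ → Fin m → ℝ) :
    S.IsFeasible N x (S.leastSlack N x v) := by
  rw [h.isFeasible_iff]
  intro k
  rw [predInput_congr (v' := v) fun j hj => extendZero_leastSlack x v (by omega),
    predState_congr (v' := v) fun j hj => extendZero_leastSlack x v (by omega)]
  exact ⟨le_rfl, le_rfl⟩

theorem objective_leastSlack {N : ℕ} (hN : 1 ≤ N) (x : Fin n → ℝ) (v : ℕ → Fin m → ℝ) :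
    x ⬝ᵥ S.Q *ᵥ x + 2 * S.objective ku kx N x (S.leastSlack N x v) = S.cost ku kx N x v := by
  rw [h.two_mul_objective hN, cost_congr (v' := v) fun j hj => extendZero_leastSlack x v hj,
    Finset.sum_eq_zero, Finset.sum_eq_zero]
  · simp
  all_goals
    intro k _
    refine Finset.sum_eq_zero fun i _ => ?_
  · rw [predState_congr (v' := v) fun j hj => extendZero_leastSlack x v (by omega)]
    exact sub_self _
  · rw [predInput_congr (v' := v) fun j hj => extendZero_leastSlack x v (by omega)]
    exact sub_self _

theorem cost_le_objective (hku : 0 ≤ ku) (hkx : 0 ≤ kx) {N : ℕ} (hN : 1 ≤ N) {x : Fin n → ℝ}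
    {z : MPCDecision n m N} (hz : S.IsFeasible N x z) :
    S.cost ku kx N x (extendZero z.du) ≤ x ⬝ᵥ S.Q *ᵥ x + 2 * S.objective ku kx N x z := by
  rw [h.two_mul_objective hN, add_assoc]
  rw [h.isFeasible_iff] at hz
  refine le_add_of_nonneg_right (add_nonneg (mul_nonneg (by linarith) ?_)
    (mul_nonneg (by linarith) ?_))
  · exact Finset.sum_nonneg fun k _ => Finset.sum_nonneg fun i _ => sub_nonneg.2 ((hz k).1 i)
  · exact Finset.sum_nonneg fun k _ => Finset.sum_nonneg fun i _ => sub_nonneg.2 ((hz k).2 i)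

theorem isSolution_leastSlack (hku : 0 ≤ ku) (hkx : 0 ≤ kx) {N : ℕ} (hN : 1 ≤ N) {x : Fin n → ℝ}
    {v : ℕ → Fin m → ℝ} (hv : S.IsOpt ku kx N x v) :
    S.IsSolution ku kx N x (S.leastSlack N x v) := by
  refine ⟨h.isFeasible_leastSlack N x v, fun z hz => ?_⟩
  have h1 := h.objective_leastSlack (ku := ku) (kx := kx) hN x v
  have h2 := h.cost_le_objective hku hkx hN hz
  have h3 := hv (extendZero z.du)
  linarith

/-- The perturbations of a solution minimise the reduced cost, hence agree with `v`; the remaining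
excess of the slacks has positive weight and must vanish. -/
theorem eq_leastSlack_of_isSolution (hku : 0 < ku) (hkx : 0 < kx) {N : ℕ} (hN : 1 ≤ N)
    {x : Fin n → ℝ} {v : ℕ → Fin m → ℝ} (hv : S.IsOpt ku kx N x v)
    {z : MPCDecision n m N} (hz : S.IsSolution ku kx N x z) : z = S.leastSlack N x v := by
  have h1 := h.objective_leastSlack (ku := ku) (kx := kx) hN x v
  have h2 := h.cost_le_objective hku.le hkx.le hN hz.1
  have h3 := hz.2 _ (h.isFeasible_leastSlack N x v)
  have h4 := hv (extendZero z.du)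
  have hopt : S.IsOpt ku kx N x (extendZero z.du) := fun v' => by linarith [hv v']
  have hdu : ∀ k < N, extendZero z.du k = v k := h.isOpt_unique hku.le hkx.le hopt hv
  have h5 := h.two_mul_objective (ku := ku) (kx := kx) hN x z
  have hf := h.isFeasible_iff.1 hz.1
  have hr0 : ∀ k ∈ (Finset.univ : Finset (Fin N)), 0 ≤ ∑ i,
      (z.r k i - violVec S.ulo S.uhi (S.predInput x (extendZero z.du) k) i) := fun k _ =>
    Finset.sum_nonneg fun i _ => sub_nonneg.2 ((hf k).1 i)
  have hs0 : ∀ k ∈ (Finset.univ : Finset (Fin N)), 0 ≤ ∑ i,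
      (z.s k i - violVec S.xlo S.xhi (S.predState x (extendZero z.du) (k + 1)) i) := fun k _ =>
    Finset.sum_nonneg fun i _ => sub_nonneg.2 ((hf k).2 i)
  have hr1 := Finset.sum_nonneg hr0
  have hs1 := Finset.sum_nonneg hs0
  have hr2 := mul_nonneg hku.le hr1
  have hs2 := mul_nonneg hkx.le hs1
  have hr3 := (Finset.sum_eq_zero_iff_of_nonneg hr0).1
    ((mul_eq_zero_iff_left hku.ne').1 (le_antisymm (by linarith) hr2))
  have hs3 := (Finset.sum_eq_zero_iff_of_nonneg hs0).1
    ((mul_eq_zero_iff_left hkx.ne').1 (le_antisymm (by linarith) hs2))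
  ext k i
  · rw [← extendZero_of_lt z.du k.2, hdu k k.2]; rfl
  · have := (Finset.sum_eq_zero_iff_of_nonneg fun i _ => sub_nonneg.2 ((hf k).1 i)).1
      (hr3 k (Finset.mem_univ _)) i (Finset.mem_univ _)
    rw [predInput_congr fun j hj => hdu j (by omega)] at this
    exact sub_eq_zero.1 this
  · have := (Finset.sum_eq_zero_iff_of_nonneg fun i _ => sub_nonneg.2 ((hf k).2 i)).1
      (hs3 k (Finset.mem_univ _)) i (Finset.mem_univ _)
    rw [predState_congr fun j hj => hdu j (by omega)] at this
    exact sub_eq_zero.1 this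

theorem existsUnique_isSolution (hku : 0 < ku) (hkx : 0 < kx) {N : ℕ} (hN : 1 ≤ N)
    (x : Fin n → ℝ) : ∃! z : MPCDecision n m N, S.IsSolution ku kx N x z := by
  obtain ⟨v, hv⟩ := h.exists_isOpt hku.le hkx.le N x
  exact ⟨_, h.isSolution_leastSlack hku.le hkx.le hN hv,
    fun z hz => h.eq_leastSlack_of_isSolution hku hkx hN hv hz⟩

theorem solution_eq (hku : 0 < ku) (hkx : 0 < kx) {N : ℕ} (hN : 1 ≤ N) {x : Fin n → ℝ}
    {v : ℕ → Fin m → ℝ} (hv : S.IsOpt ku kx N x v) :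
    S.solution ku kx N x = S.leastSlack N x v :=
  h.eq_leastSlack_of_isSolution hku hkx hN hv
    (Classical.epsilon_spec (h.existsUnique_isSolution hku hkx hN x).exists)

theorem opt_eq (hku : 0 < ku) (hkx : 0 < kx) {N : ℕ} (hN : 1 ≤ N) {x : Fin n → ℝ}
    {v : ℕ → Fin m → ℝ} (hv : S.IsOpt ku kx N x v) : ∀ k < N, S.opt ku kx N x k = v k := by
  intro k hk
  rw [opt, h.solution_eq hku hkx hN hv, extendZero_leastSlack x v hk]

theorem isOpt_opt (hku : 0 < ku) (hkx : 0 < kx) {N : ℕ} (hN : 1 ≤ N) (x : Fin n → ℝ) :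
    S.IsOpt ku kx N x (S.opt ku kx N x) := by
  obtain ⟨v, hv⟩ := h.exists_isOpt hku.le hkx.le N x
  intro v'
  rw [cost_congr (h.opt_eq hku hkx hN hv)]
  exact hv v'

theorem solution_eq_opt (hku : 0 < ku) (hkx : 0 < kx) {N : ℕ} (hN : 1 ≤ N) (x : Fin n → ℝ) :
    S.solution ku kx N x = S.leastSlack N x (S.opt ku kx N x) :=
  h.solution_eq hku hkx hN (h.isOpt_opt hku hkx hN x)

theorem value_eq (hku : 0 < ku) (hkx : 0 < kx) {N : ℕ} (hN : 1 ≤ N) (x : Fin n → ℝ) :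
    S.value ku kx N x = S.cost ku kx N x (S.opt ku kx N x) := by
  have hopt := h.isOpt_opt hku hkx hN x
  have hsol := h.isSolution_leastSlack hku.le hkx.le hN hopt
  rw [value, ← h.objective_leastSlack hN]
  congr 2
  refine IsLeast.csInf_eq ⟨⟨_, hsol.1, rfl⟩, ?_⟩
  rintro _ ⟨z, hz, rfl⟩
  exact hsol.2 z hz

theorem value_le (hku : 0 < ku) (hkx : 0 < kx) {N : ℕ} (hN : 1 ≤ N) (x : Fin n → ℝ)
    (v : ℕ → Fin m → ℝ) : S.value ku kx N x ≤ S.cost ku kx N x v := by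
  rw [h.value_eq hku hkx hN]
  exact h.isOpt_opt hku hkx hN x v

end Admissible

theorem control_eq (N : ℕ) (x : Fin n → ℝ) :
    S.control ku kx N x = S.predInput x (S.opt ku kx N x) 0 := rfl

theorem step_eq (N : ℕ) (x w : Fin n → ℝ) :
    S.step ku kx N x w = S.predState x (S.opt ku kx N x) 1 - w := by
  rw [step, control_eq, predInput]
  simp only [predState, AK, add_mulVec, mulVec_add, ← mulVec_mulVec, add_assoc]

end MPCData

/-! ### Settling in the terminal region and infinite-horizon optimality. -/

namespace MPCData

variable {n m : ℕ} {S : MPCData n m} {ku kx d α : ℝ}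

/-- On `xᵀ P x ≤ α` the unconstrained optimal feedback meets the constraints, and this set contains
all states with `xᵀ Q x ≤ d`. -/
structure IsTerminalLevel (S : MPCData n m) (d α : ℝ) : Prop where
  d_pos : 0 < d
  α_pos : 0 < α
  box : ∀ x : Fin n → ℝ, x ⬝ᵥ S.P *ᵥ x ≤ α →
    violSum S.xlo S.xhi x = 0 ∧ violSum S.ulo S.uhi (S.K *ᵥ x) = 0
  mem : ∀ x : Fin n → ℝ, x ⬝ᵥ S.Q *ᵥ x ≤ d → x ⬝ᵥ S.P *ᵥ x ≤ α

theorem Admissible.exists_isTerminalLevel (h : S.Admissible) :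
    ∃ d α : ℝ, S.IsTerminalLevel d α := by
  obtain ⟨α, hα, hbox⟩ := h.exists_terminal_level
  obtain ⟨η, hη, -, hPQ, -⟩ := h.exists_rate
  exact ⟨η * α, α, by positivity, hα, hbox, fun x hx =>
    le_of_mul_le_mul_left ((hPQ x).trans hx) hη⟩

namespace Admissible

variable (h : S.Admissible) (hT : S.IsTerminalLevel d α)
include h

theorem quadP_AK_le_quadP (x : Fin n → ℝ) :
    (S.AK *ᵥ x) ⬝ᵥ S.P *ᵥ (S.AK *ᵥ x) ≤ x ⬝ᵥ S.P *ᵥ x := by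
  linarith [h.quadP_AK_le x, h.quadQ_nonneg x]

include hT

theorem penalty_eq_zero {x : Fin n → ℝ} {v : ℕ → Fin m → ℝ} {k : ℕ}
    (hx : S.predState x v k ⬝ᵥ S.P *ᵥ S.predState x v k ≤ α) (hv : v k = 0) :
    S.penalty ku kx x v k = 0 := by
  rw [penalty, predInput, predState, hv, mulVec_zero, add_zero, add_zero, (hT.box _ hx).2,
    (hT.box _ ((h.quadP_AK_le_quadP _).trans hx)).1]
  simp

omit hT in
theorem quadP_predState_succ_le {x : Fin n → ℝ} {v : ℕ → Fin m → ℝ} {k : ℕ}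
    (hx : S.predState x v k ⬝ᵥ S.P *ᵥ S.predState x v k ≤ α) (hv : v k = 0) :
    S.predState x v (k + 1) ⬝ᵥ S.P *ᵥ S.predState x v (k + 1) ≤ α := by
  rw [predState, hv, mulVec_zero, add_zero]
  exact (h.quadP_AK_le_quadP _).trans hx

omit hT in
theorem quadP_predState_le {x : Fin n → ℝ} {v : ℕ → Fin m → ℝ} {k : ℕ}
    (hx : x ⬝ᵥ S.P *ᵥ x ≤ α) (hv : ∀ j < k, v j = 0) :
    S.predState x v k ⬝ᵥ S.P *ᵥ S.predState x v k ≤ α := by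
  induction k with
  | zero => exact hx
  | succ k ih => exact h.quadP_predState_succ_le (ih fun j hj => hv j (by omega)) (hv k (by omega))

theorem cost_zero_eq {x : Fin n → ℝ} (hx : x ⬝ᵥ S.P *ᵥ x ≤ α) (N : ℕ) :
    S.cost ku kx N x 0 = x ⬝ᵥ S.P *ᵥ x := by
  rw [cost, Finset.sum_eq_zero, add_zero]
  intro k _
  rw [h.penalty_eq_zero hT (v := 0) (h.quadP_predState_le hx fun _ _ => rfl) rfl]
  simp

/-- In the terminal region the optimal input perturbations vanish. -/
theorem isOpt_eq_zero (hku : 0 ≤ ku) (hkx : 0 ≤ kx) {N : ℕ} {x : Fin n → ℝ}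
    {v : ℕ → Fin m → ℝ} (hv : S.IsOpt ku kx N x v) (hx : x ⬝ᵥ S.P *ᵥ x ≤ α) :
    ∀ k < N, v k = 0 := by
  have h0 : S.IsOpt ku kx N x 0 := fun v' => by
    rw [h.cost_zero_eq hT hx]; exact h.quadP_le_cost hku hkx N x v'
  exact h.isOpt_unique hku hkx hv h0

theorem cost_succ_eq {N : ℕ} {x : Fin n → ℝ} {v : ℕ → Fin m → ℝ}
    (hx : S.predState x v N ⬝ᵥ S.P *ᵥ S.predState x v N ≤ α) (hv : v N = 0) :
    S.cost ku kx (N + 1) x v = S.cost ku kx N x v := by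
  rw [cost_succ_last, h.penalty_eq_zero hT hx hv, hv]
  simp

/-- A sufficiently long optimal prediction of bounded cost ends in the terminal region. -/
theorem quadP_terminal_le (hku : 0 ≤ ku) (hkx : 0 ≤ kx) {N : ℕ} {x : Fin n → ℝ}
    {v : ℕ → Fin m → ℝ} (hv : S.IsOpt ku kx N x v) (hc : S.cost ku kx N x v ≤ N * d + α) :
    S.predState x v N ⬝ᵥ S.P *ᵥ S.predState x v N ≤ α := by
  induction N generalizing x v with
  | zero => simpa [cost_zero, predState] using hc
  | succ N ih =>
    by_cases hx : x ⬝ᵥ S.P *ᵥ x ≤ α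
    · exact h.quadP_predState_le hx (h.isOpt_eq_zero hT hku hkx hv hx)
    · rw [predState_succ']
      refine ih (h.isOpt_shift hv) ?_
      -- Outside the terminal region the first stage uses up more than `d`, which leaves a budget of
      -- `N d + α` for the optimal tail.
      have hd : d < x ⬝ᵥ S.Q *ᵥ x := not_le.1 fun hle => hx (hT.mem x hle)
      rw [h.cost_succ] at hc
      have h1 := h.quadQ_le_stageCost x (S.predInput x v 0)
      have h2 := penalty_nonneg (S := S) hku hkx x v 0
      push_cast at hc
      linarith

end Admissible

/-- `v` is optimal for the horizon `N`, leads into the terminal region, and vanishes afterwards. -/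
structure Settles (S : MPCData n m) (ku kx α : ℝ) (N : ℕ) (x : Fin n → ℝ) (v : ℕ → Fin m → ℝ) :
    Prop where
  isOpt : S.IsOpt ku kx N x v
  terminal : S.predState x v N ⬝ᵥ S.P *ᵥ S.predState x v N ≤ α
  zero : ∀ k, N ≤ k → v k = 0

namespace Admissible

variable (h : S.Admissible) (hT : S.IsTerminalLevel d α)
include h hT

/-- Sandwich: the extra stage is free for `v`, and no competitor becomes cheaper when the horizon
grows. -/
theorem settles_succ (hku : 0 ≤ ku) (hkx : 0 ≤ kx) {N : ℕ} {x : Fin n → ℝ} {v : ℕ → Fin m → ℝ}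
    (hv : S.Settles ku kx α N x v) : S.Settles ku kx α (N + 1) x v where
  isOpt := fun v' => by
    rw [h.cost_succ_eq hT hv.terminal (hv.zero N le_rfl)]
    exact (hv.isOpt v').trans (h.cost_le_cost_succ hku hkx N x v')
  terminal := h.quadP_predState_succ_le hv.terminal (hv.zero N le_rfl)
  zero := fun k hk => hv.zero k (by omega)

theorem settles_of_le (hku : 0 ≤ ku) (hkx : 0 ≤ kx) {N N' : ℕ} (hN : N ≤ N') {x : Fin n → ℝ}
    {v : ℕ → Fin m → ℝ} (hv : S.Settles ku kx α N x v) : S.Settles ku kx α N' x v := by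
  induction N', hN using Nat.le_induction with
  | base => exact hv
  | succ N' _ ih => exact h.settles_succ hT hku hkx ih

theorem settles_cost_eq {N N' : ℕ} (hN : N ≤ N') {x : Fin n → ℝ} {v : ℕ → Fin m → ℝ}
    (hku : 0 ≤ ku) (hkx : 0 ≤ kx) (hv : S.Settles ku kx α N x v) :
    S.cost ku kx N' x v = S.cost ku kx N x v := by
  induction N', hN using Nat.le_induction with
  | base => rfl
  | succ N' hN' ih =>
    have := h.settles_of_le hT hku hkx hN' hv
    rw [h.cost_succ_eq hT this.terminal (this.zero N' le_rfl), ih]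

/-- The tail is optimal for the horizon `N - 1` and settles there, so `settles_succ` restores the
horizon `N`. -/
theorem settles_shift (hku : 0 ≤ ku) (hkx : 0 ≤ kx) {N : ℕ} (hN : 1 ≤ N) {x : Fin n → ℝ}
    {v : ℕ → Fin m → ℝ} (hv : S.Settles ku kx α N x v) :
    S.Settles ku kx α N (S.predState x v 1) (shift v) := by
  obtain ⟨N, rfl⟩ := Nat.exists_eq_add_of_le' hN
  refine h.settles_succ hT hku hkx ⟨h.isOpt_shift hv.isOpt, ?_, fun k hk => hv.zero _ (by omega)⟩
  rw [← predState_succ']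
  exact hv.terminal

/-- Replanning changes nothing: at a predicted state the unique optimum is the tail of the original
plan. -/
theorem settles_closedLoop (hku : 0 < ku) (hkx : 0 < kx) {N : ℕ} (hN : 1 ≤ N) {x : Fin n → ℝ}
    {v : ℕ → Fin m → ℝ} (hv : S.Settles ku kx α N x v) (t : ℕ) :
    S.closedLoop ku kx N x 0 t = S.predState x v t ∧
      S.Settles ku kx α N (S.predState x v t) (fun k => v (t + k)) := by
  induction t with
  | zero => exact ⟨rfl, by simpa [predState] using hv⟩
  | succ t ih =>
    have hnext : S.predState (S.predState x v t) (fun k => v (t + k)) 1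
        = S.predState x v (t + 1) := rfl
    constructor
    · rw [closedLoop, step_eq, ih.1, Pi.zero_apply, sub_zero, ← hnext]
      refine predState_congr fun j hj => h.opt_eq hku hkx hN ih.2.isOpt j (by omega)
    · have := h.settles_shift hT hku.le hkx.le hN ih.2
      rw [hnext] at this
      convert this using 2
      rw [add_assoc, add_comm 1]
      rfl

theorem settles_control (hku : 0 < ku) (hkx : 0 < kx) {N : ℕ} (hN : 1 ≤ N) {x : Fin n → ℝ}
    {v : ℕ → Fin m → ℝ} (hv : S.Settles ku kx α N x v) (t : ℕ) :
    S.control ku kx N (S.closedLoop ku kx N x 0 t) = S.predInput x v t := by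
  obtain ⟨h1, h2⟩ := h.settles_closedLoop hT hku hkx hN hv t
  rw [control_eq, h1, predInput, h.opt_eq hku hkx hN h2.isOpt 0 (by omega)]
  rfl

omit hT in
theorem infFeasible_iff {x : Fin n → ℝ} {v r : ℕ → Fin m → ℝ} {s : ℕ → Fin n → ℝ} :
    S.InfFeasible x v r s ↔ ∀ k, violVec S.ulo S.uhi (S.predInput x v k) ≤ r k ∧
      violVec S.xlo S.xhi (S.predState x v (k + 1)) ≤ s k := by
  refine forall_congr' fun k => and_congr ⟨fun hk => (inBox_iff h.hu hk.1).1 hk.2, fun hk => ?_⟩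
    ⟨fun hk => (inBox_iff h.hx hk.1).1 hk.2, fun hk => ?_⟩
  · have h0 := (violVec_nonneg _).trans hk
    exact ⟨h0, (inBox_iff h.hu h0).2 hk⟩
  · have h0 := (violVec_nonneg _).trans hk
    exact ⟨h0, (inBox_iff h.hx h0).2 hk⟩

/-- After stage `N` the feedback `K` makes the terminal form decay geometrically, while the
finite-horizon cost stays constant; hence the partial sums of the stage costs converge to it. -/
theorem settles_infCost (hku : 0 ≤ ku) (hkx : 0 ≤ kx) {N : ℕ} {x : Fin n → ℝ}
    {v : ℕ → Fin m → ℝ} (hv : S.Settles ku kx α N x v) :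
    S.infCost ku kx x v (fun k => violVec S.ulo S.uhi (S.predInput x v k))
      (fun k => violVec S.xlo S.xhi (S.predState x v (k + 1)))
      = ENNReal.ofReal (S.cost ku kx N x v) := by
  obtain ⟨η, hη, hη1, -, hAK⟩ := h.exists_rate
  have hterm : ∀ j, S.predState x v (j + N) ⬝ᵥ S.P *ᵥ S.predState x v (j + N)
      ≤ (1 - η) ^ j * α := by
    intro j
    induction j with
    | zero => simpa using hv.terminal
    | succ j ih =>
      rw [add_right_comm, predState, hv.zero _ (by omega), mulVec_zero, add_zero, pow_succ',
        mul_assoc]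
      exact (hAK _).trans (mul_le_mul_of_nonneg_left ih (by linarith))
  have hlim : Tendsto (fun k => S.predState x v k ⬝ᵥ S.P *ᵥ S.predState x v k) atTop (𝓝 0) := by
    rw [← tendsto_add_atTop_iff_nat N]
    refine squeeze_zero (fun j => h.hP.quad_nonneg _) hterm ?_
    simpa using (tendsto_pow_atTop_nhds_zero_of_lt_one (by linarith : (0 : ℝ) ≤ 1 - η)
      (by linarith)).mul_const α
  set g : ℕ → ℝ := fun k =>
    S.stageCost (S.predState x v k) (S.predInput x v k) + S.penalty ku kx x v k with hg
  have hg0 : ∀ k, 0 ≤ g k := fun k =>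
    add_nonneg (h.stageCost_nonneg _ _) (penalty_nonneg hku hkx _ _ _)
  have hsum : HasSum g (S.cost ku kx N x v) := by
    rw [hasSum_iff_tendsto_nat_of_nonneg hg0]
    have h1 : Tendsto (fun _ : ℕ => S.cost ku kx N x v) atTop (𝓝 (S.cost ku kx N x v)) :=
      tendsto_const_nhds
    have h2 := h1.sub hlim
    rw [sub_zero] at h2
    refine h2.congr' ?_
    filter_upwards [eventually_ge_atTop N] with N' hN'
    rw [← h.settles_cost_eq hT hN' hku hkx hv, h.cost_eq_sum]
    exact add_sub_cancel_right _ _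
  rw [← hsum.tsum_eq, ENNReal.ofReal_tsum_of_nonneg hg0 hsum.summable, infCost]
  refine tsum_congr fun k => ?_
  congr 1
  simp only [hg, penalty, violSum, violVec]
  ring

/-- A competitor of finite cost has stage costs tending to zero, hence also terminal costs tending
to zero. Finite-horizon optimality of `v` for every long horizon passes to the limit. -/
theorem settles_infOptimal (hku : 0 ≤ ku) (hkx : 0 ≤ kx) {N : ℕ} {x : Fin n → ℝ}
    {v : ℕ → Fin m → ℝ} (hv : S.Settles ku kx α N x v) :
    S.InfOptimal ku kx x v (fun k => violVec S.ulo S.uhi (S.predInput x v k))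
      (fun k => violVec S.xlo S.xhi (S.predState x v (k + 1))) := by
  refine ⟨h.infFeasible_iff.2 fun k => ⟨le_rfl, le_rfl⟩, ?_, fun v' r' s' hf => ?_⟩
  · rw [h.settles_infCost hT hku hkx hv]; exact ENNReal.ofReal_ne_top
  rw [h.settles_infCost hT hku hkx hv]
  by_cases htop : S.infCost ku kx x v' r' s' = ⊤
  · rw [htop]; exact le_top
  rw [h.infFeasible_iff] at hf
  obtain ⟨η, hη, hη1, hPQ, -⟩ := h.exists_rate
  set g : ℕ → ℝ := fun k => S.stageCost (S.predState x v' k) (S.predInput x v' k)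
    + 2 * ku * (∑ i, r' k i) + 2 * kx * (∑ i, s' k i) with hg
  have hge : ∀ k, S.stageCost (S.predState x v' k) (S.predInput x v' k)
      + S.penalty ku kx x v' k ≤ g k := by
    intro k
    have h1 : violSum S.ulo S.uhi (S.predInput x v' k) ≤ ∑ i, r' k i :=
      Finset.sum_le_sum fun i _ => (hf k).1 i
    have h2 : violSum S.xlo S.xhi (S.predState x v' (k + 1)) ≤ ∑ i, s' k i :=
      Finset.sum_le_sum fun i _ => (hf k).2 i
    rw [penalty, hg, ← add_assoc]
    dsimp only
    gcongr
  have hQg : ∀ k, S.predState x v' k ⬝ᵥ S.Q *ᵥ S.predState x v' k ≤ g k := fun k =>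
    (h.quadQ_le_stageCost _ _).trans
      ((le_add_of_nonneg_right (penalty_nonneg hku hkx _ _ _)).trans (hge k))
  have hg0 : ∀ k, 0 ≤ g k := fun k => (h.quadQ_nonneg _).trans (hQg k)
  have hsum : Summable g := by
    have := ENNReal.summable_toReal htop
    refine this.congr fun k => ?_
    rw [ENNReal.toReal_ofReal (hg0 k)]
  have hlim : Tendsto (fun k => S.predState x v' k ⬝ᵥ S.P *ᵥ S.predState x v' k) atTop (𝓝 0) := by
    have h1 := hsum.tendsto_atTop_zero.const_mul η⁻¹
    rw [mul_zero] at h1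
    refine squeeze_zero (fun j => h.hP.quad_nonneg _) (fun k => ?_) h1
    rw [inv_mul_eq_div, le_div_iff₀ hη, mul_comm]
    exact (hPQ _).trans (hQg k)
  have hle : S.cost ku kx N x v ≤ ∑' k, g k := by
    have h1 := hlim.const_add (∑' k, g k)
    rw [add_zero] at h1
    refine ge_of_tendsto h1 ?_
    filter_upwards [eventually_ge_atTop N] with N' hN'
    rw [← h.settles_cost_eq hT hN' hku hkx hv]
    refine ((h.settles_of_le hT hku hkx hN' hv).isOpt v').trans ?_
    rw [h.cost_eq_sum]
    have := Finset.sum_le_sum fun k (_ : k ∈ Finset.range N') => hge k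
    have := hsum.sum_le_tsum (Finset.range N') fun k _ => hg0 k
    linarith
  rw [infCost, ← ENNReal.ofReal_tsum_of_nonneg hg0 hsum]
  exact ENNReal.ofReal_le_ofReal hle

omit hT in
theorem isCompact_quadQ_sublevel (b : ℝ) : IsCompact {x : Fin n → ℝ | x ⬝ᵥ S.Q *ᵥ x ≤ b} := by
  obtain ⟨c, hc, hcQ⟩ := h.hQ.exists_le_quad
  refine Metric.isCompact_of_isClosed_isBounded
    (isClosed_le (continuous_quad S.Q) continuous_const) ?_
  refine (Metric.isBounded_closedBall (x := (0 : Fin n → ℝ))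
    (r := Real.sqrt (b / c))).subset fun x hx => ?_
  rw [mem_closedBall_zero_iff, pi_norm_le_iff_of_nonneg (Real.sqrt_nonneg _)]
  intro i
  refine Real.abs_le_sqrt ?_
  rw [le_div_iff₀ hc, mul_comm]
  exact (mul_le_mul_of_nonneg_left (sq_le_dotProduct_self x i) hc.le).trans ((hcQ x).trans hx)

theorem infinite_horizon_optimality (hku : 0 < ku) (hkx : 0 < kx) :
    ∃ Om : ℕ → Set (Fin n → ℝ),
      (∀ C : Set (Fin n → ℝ), IsCompact C → ∃ Nbar : ℕ, 1 ≤ Nbar ∧ C ⊆ Om Nbar) ∧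
      ∀ Nbar : ℕ, 1 ≤ Nbar → IsCompact (Om Nbar) ∧ Om Nbar ∈ 𝓝 0 ∧
        ∀ x₀ ∈ Om Nbar, ∃ (v r : ℕ → Fin m → ℝ) (s : ℕ → Fin n → ℝ),
          S.InfOptimal ku kx x₀ v r s ∧
          ∀ N : ℕ, Nbar ≤ N →
            (∀ k : Fin N, (S.solution ku kx N x₀).du k = v k ∧
              (S.solution ku kx N x₀).r k = r k ∧ (S.solution ku kx N x₀).s k = s k) ∧
            (∀ t : ℕ, S.closedLoop ku kx N x₀ 0 t = S.predState x₀ v t ∧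
              S.control ku kx N (S.closedLoop ku kx N x₀ 0 t) = S.predInput x₀ v t) ∧
            ENNReal.ofReal (S.value ku kx N x₀) = S.infCost ku kx x₀ v r s := by
  obtain ⟨C, hC, hCQ⟩ := h.exists_cost_zero_le hku.le hkx.le
  have hd := hT.d_pos
  have hα := hT.α_pos
  -- On this set the sequence `0`, and hence the optimum, costs at most `N d + α`, the budget of
  -- `quadP_terminal_le`.
  refine ⟨fun N => {x | x ⬝ᵥ S.Q *ᵥ x ≤ (N * d + α) / C}, fun D hD => ?_,
    fun Nbar hNbar => ⟨h.isCompact_quadQ_sublevel _, ?_, fun x₀ hx₀ => ?_⟩⟩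
  · obtain ⟨b, hb⟩ := hD.bddAbove_image (continuous_quad S.Q).continuousOn
    obtain ⟨N, hN⟩ := exists_nat_ge (C * b / d)
    refine ⟨N + 1, by omega, fun x hx => ?_⟩
    have h1 : x ⬝ᵥ S.Q *ᵥ x ≤ b := hb ⟨x, hx, rfl⟩
    rw [div_le_iff₀ hd] at hN
    rw [Set.mem_ofPred_eq, le_div_iff₀ (by linarith)]
    push_cast
    nlinarith
  · refine mem_of_superset (IsOpen.mem_nhds (isOpen_lt (continuous_quad S.Q) continuous_const)
      (?_ : (0 : Fin n → ℝ) ∈ {x : Fin n → ℝ | x ⬝ᵥ S.Q *ᵥ x < (Nbar * d + α) / C}))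
      fun x hx => by rw [Set.mem_ofPred_eq] at hx ⊢; exact hx.le
    rw [Set.mem_ofPred_eq, zero_dotProduct]
    positivity
  · have hopt := h.isOpt_opt hku hkx hNbar x₀
    have hset : S.Settles ku kx α Nbar x₀ (S.opt ku kx Nbar x₀) := by
      refine ⟨hopt, h.quadP_terminal_le hT hku.le hkx.le hopt ?_, fun k hk => opt_of_le x₀ hk⟩
      refine (hopt 0).trans ((hCQ Nbar x₀).trans ?_)
      rw [Set.mem_ofPred_eq, le_div_iff₀ (by linarith)] at hx₀
      linarith
    refine ⟨_, _, _, h.settles_infOptimal hT hku.le hkx.le hset, fun N hN => ?_⟩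
    have hsetN := h.settles_of_le hT hku.le hkx.le hN hset
    have hN1 : 1 ≤ N := hNbar.trans hN
    have hsol := h.solution_eq hku hkx hN1 hsetN.isOpt
    refine ⟨fun k => ?_, fun t => ⟨(h.settles_closedLoop hT hku hkx hN1 hsetN t).1,
      h.settles_control hT hku hkx hN1 hsetN t⟩, ?_⟩
    · rw [hsol]; exact ⟨rfl, rfl, rfl⟩
    · rw [h.settles_infCost hT hku.le hkx.le hsetN, h.value_eq hku hkx hN1,
        cost_congr (h.opt_eq hku hkx hN1 hsetN.isOpt)]

end Admissible

end MPCData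

/-! ### Model errors and robust contraction of the value. -/

theorem sum_abs_le_card_mul_vnorm {p : ℕ} (x : Fin p → ℝ) : ∑ i, |x i| ≤ p * vnorm x := by
  have := Finset.sum_le_sum fun i (_ : i ∈ Finset.univ) => abs_apply_le_vnorm x i
  simpa using this

theorem exists_vnorm_mulVec_le {p q : ℕ} (M : Matrix (Fin p) (Fin q) ℝ) :
    ∃ C : ℝ, 0 ≤ C ∧ ∀ x, vnorm (M *ᵥ x) ≤ C * vnorm x := by
  obtain ⟨C, hC, hM⟩ := exists_mulVec_bound M
  refine ⟨Real.sqrt C, Real.sqrt_nonneg _, fun x => ?_⟩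
  refine le_of_sq_le_sq ?_ (mul_nonneg (Real.sqrt_nonneg _) (vnorm_nonneg x))
  rw [mul_pow, Real.sq_sqrt hC, vnorm_sq, vnorm_sq]
  exact hM x

theorem sum_geometric_le {ρ : ℝ} (h0 : 0 ≤ ρ) (h1 : ρ < 1) (N : ℕ) :
    ∑ k ∈ Finset.range N, ρ ^ k ≤ (1 - ρ)⁻¹ := by
  rw [← tsum_geometric_of_lt_one h0 h1]
  exact (summable_geometric_of_lt_one h0 h1).sum_le_tsum _ fun k _ => pow_nonneg h0 k

theorem vnorm_neg {ι : Type*} [Fintype ι] (x : ι → ℝ) : vnorm (-x) = vnorm x := by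
  simp [vnorm]

namespace MPCData

variable {n m : ℕ} {S : MPCData n m} {ku kx d α : ℝ}

theorem predState_add (x y : Fin n → ℝ) (v v' : ℕ → Fin m → ℝ) (k : ℕ) :
    S.predState (x + y) (v + v') k = S.predState x v k + S.predState y v' k := by
  induction k with
  | zero => rfl
  | succ k ih =>
    simp only [predState, ih, Pi.add_apply, mulVec_add]
    abel

theorem predInput_add (x y : Fin n → ℝ) (v v' : ℕ → Fin m → ℝ) (k : ℕ) :
    S.predInput (x + y) (v + v') k = S.predInput x v k + S.predInput y v' k := by
  simp only [predInput, predState_add, mulVec_add, Pi.add_apply]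
  abel

/-- Robust contraction of the optimal value on `Γ_N` for model errors of norm at most `μ`, at rates
that do not depend on the horizon. -/
structure IsContraction (S : MPCData n m) (ku kx d α l E μ : ℝ) : Prop where
  l_pos : 0 < l
  l_lt : l < 1
  E_pos : 0 < E
  μ_pos : 0 < μ
  μ_le : μ ≤ 1
  small : 2 * (E * μ) ≤ (1 - l) * α
  step : ∀ N : ℕ, 1 ≤ N → ∀ x ∈ S.Gam ku kx d α N, ∀ w : Fin n → ℝ, vnorm w ≤ μ →
    S.step ku kx N x w ∈ S.Gam ku kx d α N ∧
    S.value ku kx N (S.step ku kx N x w) ≤ l * S.value ku kx N x + E * vnorm w ∧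
    S.value ku kx N (S.step ku kx N x w) ≤ 2 * ((N - 1) * d + α) + E

namespace Admissible

variable (h : S.Admissible)
include h

/-- The pre-stabilised system is exponentially stable. -/
theorem exists_vnorm_predState_le : ∃ D ρ : ℝ, 0 ≤ D ∧ 0 ≤ ρ ∧ ρ < 1 ∧
    ∀ (x : Fin n → ℝ) (k : ℕ), vnorm (S.predState x 0 k) ≤ D * ρ ^ k * vnorm x := by
  obtain ⟨η, hη, hη1, -, hAK⟩ := h.exists_rate
  obtain ⟨c, hc, hcQ⟩ := h.hQ.exists_le_quad
  obtain ⟨C, hC, hCP⟩ := exists_quad_le S.P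
  have hη' : 0 ≤ 1 - η := by linarith
  have hdec : ∀ (x : Fin n → ℝ) (k : ℕ), S.predState x 0 k ⬝ᵥ S.P *ᵥ S.predState x 0 k
      ≤ (1 - η) ^ k * (x ⬝ᵥ S.P *ᵥ x) := by
    intro x k
    induction k with
    | zero => simp [predState]
    | succ k ih =>
      rw [predState, Pi.zero_apply, mulVec_zero, add_zero, pow_succ', mul_assoc]
      exact (hAK _).trans (mul_le_mul_of_nonneg_left ih hη')
  refine ⟨Real.sqrt (C / c), Real.sqrt (1 - η), Real.sqrt_nonneg _, Real.sqrt_nonneg _,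
    by rw [Real.sqrt_lt' one_pos]; linarith, fun x k => ?_⟩
  refine le_of_sq_le_sq ?_ (mul_nonneg (mul_nonneg (Real.sqrt_nonneg _)
    (pow_nonneg (Real.sqrt_nonneg _) _)) (vnorm_nonneg x))
  rw [mul_pow, mul_pow, Real.sq_sqrt (by positivity), ← pow_mul, mul_comm k, pow_mul,
    Real.sq_sqrt hη', vnorm_sq, vnorm_sq, div_mul_eq_mul_div, div_mul_eq_mul_div,
    le_div_iff₀ hc, mul_comm]
  refine (hcQ _).trans ((h.quadQ_le_quadP _).trans ((hdec x k).trans ?_))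
  rw [mul_comm C, mul_assoc]
  exact mul_le_mul_of_nonneg_left (hCP x) (pow_nonneg hη' k)

/-- Effect of a perturbation of the initial state on the cost, uniformly in the horizon. -/
theorem exists_cost_perturbation (hku : 0 ≤ ku) (hkx : 0 ≤ kx) : ∃ L : ℝ, 0 ≤ L ∧
    ∀ (N : ℕ) (x w : Fin n → ℝ) (v : ℕ → Fin m → ℝ) (a : ℝ), 0 < a →
      S.cost ku kx N (x - w) v ≤ S.cost ku kx N x v + a * (x ⬝ᵥ S.P *ᵥ x)
        + (1 + a⁻¹) * (w ⬝ᵥ S.P *ᵥ w) + L * vnorm w := by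
  obtain ⟨D, ρ, hD, hρ, hρ1, hdec⟩ := h.exists_vnorm_predState_le
  obtain ⟨CK, hCK, hK⟩ := exists_vnorm_mulVec_le S.K
  set G := 2 * ku * (m * (CK * D)) + 2 * kx * (n * D) with hG
  have hG0 : 0 ≤ G := by positivity
  have hpen : ∀ (x w : Fin n → ℝ) (v : ℕ → Fin m → ℝ) (k : ℕ),
      S.penalty ku kx (x - w) v k ≤ S.penalty ku kx x v k + G * vnorm w * ρ ^ k := by
    intro x w v k
    -- Under the same perturbations the two predictions differ by the free response of `A + B K` to
    -- `-w`.
    have h1 : S.predInput (x - w) v k = S.predInput x v k + S.K *ᵥ S.predState (-w) 0 k := by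
      rw [sub_eq_add_neg]
      conv_lhs => rw [← add_zero v]
      rw [predInput_add, predInput.eq_1 S (-w), Pi.zero_apply, add_zero]
    have h2 : S.predState (x - w) v (k + 1) = S.predState x v (k + 1)
        + S.predState (-w) 0 (k + 1) := by
      rw [sub_eq_add_neg]
      conv_lhs => rw [← add_zero v]
      rw [predState_add]
    have h3 : ∑ i, |(S.K *ᵥ S.predState (-w) 0 k) i| ≤ m * (CK * (D * ρ ^ k * vnorm w)) := by
      refine (sum_abs_le_card_mul_vnorm _).trans ?_
      have := hdec (-w) k
      rw [vnorm_neg] at this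
      have := (hK (S.predState (-w) 0 k)).trans (mul_le_mul_of_nonneg_left this hCK)
      gcongr
    have h4 : ∑ i, |S.predState (-w) 0 (k + 1) i| ≤ n * (D * ρ ^ k * vnorm w) := by
      refine (sum_abs_le_card_mul_vnorm _).trans ?_
      have := hdec (-w) (k + 1)
      rw [vnorm_neg] at this
      have h5 : D * ρ ^ (k + 1) * vnorm w ≤ D * ρ ^ k * vnorm w := by
        have := pow_le_pow_of_le_one hρ hρ1.le (Nat.le_succ k)
        have := vnorm_nonneg w
        gcongr
      have := this.trans h5
      gcongr
    rw [penalty, penalty, h1, h2]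
    have h5 := violSum_add_le h.hu (S.predInput x v k) (S.K *ᵥ S.predState (-w) 0 k)
    have h6 := violSum_add_le h.hx (S.predState x v (k + 1)) (S.predState (-w) 0 (k + 1))
    have h7 := mul_le_mul_of_nonneg_left (h5.trans (add_le_add_right h3 _))
      (mul_nonneg zero_le_two hku)
    have h8 := mul_le_mul_of_nonneg_left (h6.trans (add_le_add_right h4 _))
      (mul_nonneg zero_le_two hkx)
    rw [hG]
    linarith
  -- Summing the geometric changes of the penalties gives a constant free of the horizon; the
  -- terminal form is handled by Young's inequality with weight `a`.
  refine ⟨G * (1 - ρ)⁻¹, mul_nonneg hG0 (inv_nonneg.2 (by linarith)), fun N x w v a ha => ?_⟩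
  have h1 := h.hP.quad_add_le x (-w) ha
  rw [← sub_eq_add_neg, quad_neg] at h1
  have h2 : ∑ k ∈ Finset.range N, (v k ⬝ᵥ S.weight *ᵥ v k + S.penalty ku kx (x - w) v k)
      ≤ ∑ k ∈ Finset.range N, (v k ⬝ᵥ S.weight *ᵥ v k + S.penalty ku kx x v k
        + G * vnorm w * ρ ^ k) :=
    Finset.sum_le_sum fun k _ => by linarith [hpen x w v k]
  simp only [Finset.sum_add_distrib, ← Finset.mul_sum] at h2
  have h3 := mul_le_mul_of_nonneg_left (sum_geometric_le hρ hρ1 N)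
    (mul_nonneg hG0 (vnorm_nonneg w))
  simp only [cost, Finset.sum_add_distrib]
  linarith

theorem quadP_le_value (hku : 0 < ku) (hkx : 0 < kx) {N : ℕ} (hN : 1 ≤ N) (x : Fin n → ℝ) :
    x ⬝ᵥ S.P *ᵥ x ≤ S.value ku kx N x := by
  rw [h.value_eq hku hkx hN]
  exact h.quadP_le_cost hku.le hkx.le N x _

variable (hT : S.IsTerminalLevel d α)
include hT

theorem value_eq_of_quadP_le (hku : 0 < ku) (hkx : 0 < kx) {N : ℕ} (hN : 1 ≤ N) {x : Fin n → ℝ}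
    (hx : x ⬝ᵥ S.P *ᵥ x ≤ α) : S.value ku kx N x = x ⬝ᵥ S.P *ᵥ x := by
  refine le_antisymm ?_ (h.quadP_le_value hku hkx hN x)
  rw [← h.cost_zero_eq hT hx N]
  exact h.value_le hku hkx hN x 0

omit hT in
theorem mem_Gam_of_value_le (hT : S.IsTerminalLevel d α) {N : ℕ} (hN : 1 ≤ N) {x : Fin n → ℝ}
    (hx : S.value ku kx N x ≤ α) : x ∈ S.Gam ku kx d α N := by
  rw [Gam, Set.mem_ofPred_eq]
  have h1 := h.stageCost_nonneg x (S.control ku kx N x)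
  have h2 : (1 : ℝ) ≤ N := by exact_mod_cast hN
  have h3 := hT.d_pos
  nlinarith

/-- The shifted optimal sequence is a candidate at the successor state. -/
theorem Gam_successor (hku : 0 < ku) (hkx : 0 < kx) {N : ℕ} (hN : 1 ≤ N) {x : Fin n → ℝ}
    (hx : x ∈ S.Gam ku kx d α N) :
    (let v := S.opt ku kx N x
     S.cost ku kx N (S.predState x v 1) (shift v) ≤ (N - 1) * d + α ∧
     S.cost ku kx N (S.predState x v 1) (shift v)
       ≤ S.value ku kx N x - S.stageCost x (S.control ku kx N x) ∧
     S.predState x v N ⬝ᵥ S.P *ᵥ S.predState x v N ≤ α) := by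
  intro v
  have hopt := h.isOpt_opt hku hkx hN x
  rw [Gam, Set.mem_ofPred_eq] at hx
  rw [h.value_eq hku hkx hN] at hx ⊢
  obtain ⟨N, rfl⟩ := Nat.exists_eq_add_of_le' hN
  have hpen := penalty_nonneg (S := S) hku.le hkx.le x v 0
  have hs := h.cost_succ (ku := ku) (kx := kx) N x v
  rw [hs] at hx
  rw [control_eq] at hx ⊢
  push_cast at hx ⊢
  -- The stage cost in the definition of `Γ_N` cancels the first stage, so membership bounds the
  -- tail by exactly the budget of its own horizon, here called `N` after renaming.
  have hc : S.cost ku kx N (S.predState x v 1) (shift v) ≤ N * d + α := by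
    change _ + S.cost ku kx N (S.predState x v 1) (shift v) ≤ S.stageCost x (S.predInput x v 0) +
      ((N : ℝ) + 1 - 1) * d + α at hx
    linarith
  have hterm := h.quadP_terminal_le hT hku.le hkx.le (h.isOpt_shift hopt) hc
  have hzero : shift v N = 0 := opt_of_le x le_rfl
  -- The shifted sequence ends in the default value `0` of `extendZero`; in the terminal region this
  -- last stage is free.
  rw [h.cost_succ_eq hT hterm hzero]
  refine ⟨by linarith, ?_, by rw [predState_succ']; exact hterm⟩
  change _ ≤ S.cost ku kx (N + 1) x v - S.stageCost x (S.predInput x v 0)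
  linarith

/-- Robust contraction of the optimal value on `Γ_N`, uniformly in the horizon. -/
theorem exists_contraction (hku : 0 < ku) (hkx : 0 < kx) :
    ∃ l E μ : ℝ, S.IsContraction ku kx d α l E μ := by
  have hα := hT.α_pos
  have hd := hT.d_pos
  obtain ⟨C, hC, hCQ⟩ := h.exists_cost_zero_le hku.le hkx.le
  obtain ⟨L, hL, hpert⟩ := h.exists_cost_perturbation hku.le hkx.le
  obtain ⟨CP, hCP, hP⟩ := exists_quad_le S.P
  -- The value is at most `C xᵀ Q x`, so each stage removes at least the fraction `2 a` of it.
  -- Young's inequality with weight `a` returns part of this, and the net rate is at most `1 - a`.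
  set a := (2 * C)⁻¹ with ha
  have hC0 : 0 < C := by linarith
  have haC : a * C = 1 / 2 := by rw [ha]; field_simp
  have ha0 : 0 < a := by positivity
  have ha1 : a < 1 / 2 := by nlinarith
  set E := (1 + a⁻¹) * CP + L with hE
  have hE0 : 0 < E := by positivity
  refine ⟨1 - a, E, min 1 (a * α / (2 * E)), by linarith, by linarith, hE0, by positivity,
    min_le_left _ _, ?_, fun N hN x hx w hw => ?_⟩
  · calc 2 * (E * min 1 (a * α / (2 * E))) ≤ 2 * (E * (a * α / (2 * E))) := by
          gcongr; exact min_le_right _ _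
      _ = (1 - (1 - a)) * α := by field_simp; ring
  have hw0 := vnorm_nonneg w
  have hw1 : vnorm w ≤ 1 := hw.trans (min_le_left _ _)
  have hwE : 2 * (E * vnorm w) ≤ a * α := by
    have := hw.trans (min_le_right _ _)
    rw [le_div_iff₀ (by positivity)] at this
    linarith
  obtain ⟨h1, h2, -⟩ := h.Gam_successor hT hku hkx hN hx
  set v := S.opt ku kx N x
  set y := S.predState x v 1 with hy
  have hM : α ≤ (N - 1) * d + α := by
    have : (1 : ℝ) ≤ N := by exact_mod_cast hN
    nlinarith
  set M := ((N : ℝ) - 1) * d + α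
  have hyP := h.quadP_le_cost hku.le hkx.le N y (shift v)
  have hstep : S.value ku kx N (S.step ku kx N x w)
      ≤ (1 + a) * S.cost ku kx N y (shift v) + E * vnorm w := by
    rw [step_eq]
    refine (h.value_le hku hkx hN _ (shift v)).trans ((hpert N y w (shift v) a ha0).trans ?_)
    have h3 : w ⬝ᵥ S.P *ᵥ w ≤ CP * vnorm w := by
      refine (hP w).trans ?_
      rw [← vnorm_sq]
      gcongr
      nlinarith
    have h4 : (1 + a⁻¹) * (w ⬝ᵥ S.P *ᵥ w) ≤ (1 + a⁻¹) * (CP * vnorm w) := by gcongr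
    have h5 : a * (y ⬝ᵥ S.P *ᵥ y) ≤ a * S.cost ku kx N y (shift v) := by gcongr
    rw [hE]
    linarith
  have hval : ∀ z : Fin n → ℝ, 2 * a * S.value ku kx N z ≤ z ⬝ᵥ S.Q *ᵥ z := by
    intro z
    have h3 := (h.value_le hku hkx hN z 0).trans (hCQ N z)
    have h4 := mul_le_mul_of_nonneg_left h3 (by positivity : 0 ≤ 2 * a)
    have h5 : 2 * a * (C * (z ⬝ᵥ S.Q *ᵥ z)) = 2 * (a * C) * (z ⬝ᵥ S.Q *ᵥ z) := by ring
    rw [h5, haC] at h4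
    linarith
  have hV0 : 0 ≤ S.value ku kx N x :=
    (h.hP.quad_nonneg x).trans (h.quadP_le_value hku hkx hN x)
  have hVs0 : 0 ≤ S.value ku kx N (S.step ku kx N x w) :=
    (h.hP.quad_nonneg _).trans (h.quadP_le_value hku hkx hN _)
  refine ⟨?_, ?_, ?_⟩
  -- The stage cost at the new state covers the fraction `2 a` of the new value. The rest is at most
  -- `(1 - 2 a) ((1 + a) M + E ‖w‖)`, which is at most `M` because `2 E ‖w‖ ≤ a α` and `α ≤ M`.
  · rw [Gam, Set.mem_ofPred_eq]
    have h3 := h.quadQ_le_stageCost (S.step ku kx N x w)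
      (S.control ku kx N (S.step ku kx N x w))
    have h4 := hval (S.step ku kx N x w)
    have h5 : (1 + a) * S.cost ku kx N y (shift v) ≤ (1 + a) * M := by gcongr
    have h6 : S.value ku kx N (S.step ku kx N x w) ≤ (1 + a) * M + E * vnorm w := by linarith
    have h7 : (1 - 2 * a) * S.value ku kx N (S.step ku kx N x w)
        ≤ (1 - 2 * a) * ((1 + a) * M + E * vnorm w) :=
      mul_le_mul_of_nonneg_left h6 (by linarith)
    have h8 : (1 - 2 * a) * ((1 + a) * M + E * vnorm w) ≤ M := by
      have h9 : a * α ≤ a * M := by gcongr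
      have h10 : 0 ≤ 2 * a * (E * vnorm w) := by positivity
      have h11 : 0 ≤ 2 * a ^ 2 * M := by
        have : 0 ≤ M := by linarith
        positivity
      nlinarith
    change _ ≤ _ + (((N : ℝ) - 1) * d) + α
    have h12 : M = ((N : ℝ) - 1) * d + α := rfl
    linarith
  · have h3 := h.quadQ_le_stageCost x (S.control ku kx N x)
    have h4 := hval x
    have h5 : (1 + a) * S.cost ku kx N y (shift v)
        ≤ (1 + a) * ((1 - 2 * a) * S.value ku kx N x) := by
      gcongr; linarith
    have h6 : (1 + a) * ((1 - 2 * a) * S.value ku kx N x) ≤ (1 - a) * S.value ku kx N x := by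
      have : 0 ≤ 2 * a ^ 2 * S.value ku kx N x := by positivity
      nlinarith
    linarith
  -- This bound on the new value is free of `x`; it yields a time common to all initial states in
  -- `Γ_N`.
  · have h5 : (1 + a) * S.cost ku kx N y (shift v) ≤ 2 * M := by
      have h6 : (1 + a) * S.cost ku kx N y (shift v) ≤ (1 + a) * M := by gcongr
      have : 0 ≤ M := by linarith
      nlinarith
    have h7 : E * vnorm w ≤ E * 1 := by gcongr
    linarith

end Admissible

end MPCData

/-! ### Nominal stability, input-to-state stability and robust constraint satisfaction. -/

namespace MPCData

variable {n m : ℕ} {S : MPCData n m} {ku kx d α l E μ : ℝ}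

namespace Admissible

variable (h : S.Admissible) (hT : S.IsTerminalLevel d α)
include h

include hT in
-- Here the weight in Young's inequality is `‖w‖` itself. The error then vanishes with `w` and the
-- full stage cost is kept, at the price of a constant that depends on `N` through the bound `M` on
-- the candidate cost.
theorem exists_decrease (hku : 0 < ku) (hkx : 0 < kx) {N : ℕ} (hN : 1 ≤ N) :
    ∃ σ : ℝ → ℝ, ClassK σ ∧ (∃ b : ℝ, ∀ a : ℝ, 0 ≤ a → σ a ≤ b) ∧
      ∀ x ∈ S.Gam ku kx d α N, ∀ w : Fin n → ℝ, vnorm w ≤ 1 →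
        S.value ku kx N (S.step ku kx N x w)
          ≤ S.value ku kx N x - S.stageCost x (S.control ku kx N x) + σ (vnorm w) := by
  obtain ⟨L, hL, hpert⟩ := h.exists_cost_perturbation hku.le hkx.le
  obtain ⟨CP, hCP, hP⟩ := exists_quad_le S.P
  have hM : 0 < (N - 1) * d + α := by
    have : (1 : ℝ) ≤ N := by exact_mod_cast hN
    have := hT.d_pos
    have := hT.α_pos
    have : 0 ≤ ((N : ℝ) - 1) * d := mul_nonneg (by linarith) (by linarith)
    linarith
  set M := ((N : ℝ) - 1) * d + α with hMdef
  set F := M + 2 * CP + L with hF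
  have hF0 : 0 < F := by positivity
  have hσ : ∀ s : ℝ, 0 ≤ s → 2 * F * s / (1 + s) = 2 * F - 2 * F / (1 + s) := by
    intro s hs
    field_simp
    ring
  -- A bounded increasing function that dominates `F s` for `s ≤ 1`.
  refine ⟨fun s => 2 * F * s / (1 + s), ⟨?_, ?_, by simp⟩, ⟨2 * F, fun s hs => ?_⟩,
    fun x hx w hw => ?_⟩
  · refine ContinuousOn.div (by fun_prop) (by fun_prop) fun s hs => ?_
    have : (0 : ℝ) ≤ s := hs
    positivity
  · intro s hs t ht hst
    have hs0 : (0 : ℝ) ≤ s := hs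
    have ht0 : (0 : ℝ) ≤ t := ht
    dsimp only
    rw [hσ s hs0, hσ t ht0]
    have : 2 * F / (1 + t) < 2 * F / (1 + s) :=
      div_lt_div_of_pos_left (by positivity) (by positivity) (by linarith)
    linarith
  · dsimp only
    rw [hσ s hs]
    have : 0 ≤ 2 * F / (1 + s) := by positivity
    linarith
  obtain ⟨h1, h2, -⟩ := h.Gam_successor hT hku hkx hN hx
  set v := S.opt ku kx N x
  set y := S.predState x v 1
  have hw0 := vnorm_nonneg w
  rw [step_eq]
  refine (h.value_le hku hkx hN _ (shift v)).trans ?_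
  suffices hs : S.cost ku kx N (y - w) (shift v)
      ≤ S.cost ku kx N y (shift v) + F * vnorm w by
    have h3 : F * vnorm w ≤ 2 * F * vnorm w / (1 + vnorm w) := by
      rw [le_div_iff₀ (by linarith)]
      have : F * vnorm w * vnorm w ≤ F * vnorm w * 1 := by gcongr
      linarith
    linarith
  -- The weight must be positive, so `w = 0` is treated apart.
  rcases hw0.eq_or_lt with hz | hpos
  · have hw2 : w = 0 := by
      have := vnorm_sq w
      rw [← hz, zero_pow two_ne_zero] at this
      exact dotProduct_self_eq_zero.1 this.symm
    rw [← hz, hw2, sub_zero, mul_zero, add_zero]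
  · refine (hpert N y w (shift v) (vnorm w) hpos).trans ?_
    have h3 : y ⬝ᵥ S.P *ᵥ y ≤ M := (h.quadP_le_cost hku.le hkx.le N y (shift v)).trans h1
    have h4 : vnorm w * (y ⬝ᵥ S.P *ᵥ y) ≤ vnorm w * M := by gcongr
    have h5 : (1 + (vnorm w)⁻¹) * (w ⬝ᵥ S.P *ᵥ w)
        ≤ (1 + (vnorm w)⁻¹) * (CP * vnorm w ^ 2) := by
      have := hP w
      rw [← vnorm_sq] at this
      gcongr
    have h6 : (1 + (vnorm w)⁻¹) * (CP * vnorm w ^ 2) = CP * vnorm w * vnorm w + CP * vnorm w := by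
      field_simp
    have h7 : CP * vnorm w * vnorm w ≤ CP * vnorm w * 1 := by gcongr
    rw [hF]
    linarith

variable (hC : S.IsContraction ku kx d α l E μ)
include hC

omit h in
theorem closedLoop_mem_Gam {N : ℕ} (hN : 1 ≤ N) {x₀ : Fin n → ℝ}
    (hx₀ : x₀ ∈ S.Gam ku kx d α N) {w : ℕ → Fin n → ℝ} (hw : ∀ t, vnorm (w t) ≤ μ) (t : ℕ) :
    S.closedLoop ku kx N x₀ w t ∈ S.Gam ku kx d α N := by
  induction t with
  | zero => exact hx₀
  | succ t ih => exact (hC.step N hN _ ih _ (hw t)).1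

omit h in
theorem value_closedLoop_le {N : ℕ} (hN : 1 ≤ N) {x₀ : Fin n → ℝ}
    (hx₀ : x₀ ∈ S.Gam ku kx d α N) {w : ℕ → Fin n → ℝ} (hw : ∀ t, vnorm (w t) ≤ μ) (t : ℕ)
    {c : ℝ} (hc0 : 0 ≤ c) (hc : ∀ τ < t, vnorm (w τ) ≤ c) :
    S.value ku kx N (S.closedLoop ku kx N x₀ w t)
      ≤ l ^ t * S.value ku kx N x₀ + E * c / (1 - l) := by
  have hl := hC.l_lt
  have hl0 := hC.l_pos
  have hE := hC.E_pos
  induction t with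
  | zero =>
    have : 0 ≤ E * c / (1 - l) := div_nonneg (by positivity) (by linarith)
    simpa [closedLoop] using this
  | succ t ih =>
    have h1 := (hC.step N hN _ (closedLoop_mem_Gam hC hN hx₀ hw t) _ (hw t)).2.1
    have h2 := mul_le_mul_of_nonneg_left (ih fun τ hτ => hc τ (by omega)) hl0.le
    have h3 := mul_le_mul_of_nonneg_left (hc t (by omega)) hE.le
    -- The offset is the fixed point of `y ↦ l y + E c`.
    have h4 : l * (E * c / (1 - l)) + E * c = E * c / (1 - l) := by
      have : 1 - l ≠ 0 := by linarith
      field_simp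
      ring
    rw [closedLoop, pow_succ']
    linarith

/-- The value lies between multiples of `‖x‖²` that do not depend on `N`; the square root of the
contraction estimate gives rate `√l` and a gain proportional to `√c`. -/
theorem exists_iss_bound (hku : 0 < ku) (hkx : 0 < kx) :
    ∃ a b ρ : ℝ, 0 < a ∧ 0 < b ∧ 0 < ρ ∧ ρ < 1 ∧ ∀ N : ℕ, 1 ≤ N →
      ∀ x₀ ∈ S.Gam ku kx d α N, ∀ w : ℕ → Fin n → ℝ, (∀ t, vnorm (w t) ≤ μ) →
        ∀ (t : ℕ) (c : ℝ), 0 ≤ c → (∀ τ < t, vnorm (w τ) ≤ c) →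
          vnorm (S.closedLoop ku kx N x₀ w t) ≤ a * ρ ^ t * vnorm x₀ + b * Real.sqrt c := by
  obtain ⟨C, hC1, hCQ⟩ := h.exists_cost_zero_le hku.le hkx.le
  obtain ⟨q, hq, hqQ⟩ := h.hQ.exists_le_quad
  obtain ⟨q', hq', hQq⟩ := exists_quad_le S.Q
  have hl := hC.l_lt
  have hl0 := hC.l_pos
  have hE := hC.E_pos
  have hl1 : 0 < 1 - l := by linarith
  have hC0 : 0 < C := by linarith
  refine ⟨Real.sqrt (C * q' / q), Real.sqrt (E / (1 - l) / q), Real.sqrt l, by positivity,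
    by positivity, by positivity, by rw [Real.sqrt_lt' one_pos]; linarith,
    fun N hN x₀ hx₀ w hw t c hc0 hc => ?_⟩
  set z := S.closedLoop ku kx N x₀ w t
  have h1 := value_closedLoop_le hC hN hx₀ hw t hc0 hc
  have h2 : q * vnorm z ^ 2 ≤ S.value ku kx N z := by
    rw [vnorm_sq]
    exact (hqQ z).trans ((h.quadQ_le_quadP z).trans (h.quadP_le_value hku hkx hN z))
  have h3 : S.value ku kx N x₀ ≤ C * (q' * vnorm x₀ ^ 2) := by
    rw [vnorm_sq]
    exact (h.value_le hku hkx hN x₀ 0).trans ((hCQ N x₀).trans (by gcongr; exact hQq x₀))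
  have h4 := mul_le_mul_of_nonneg_left h3 (pow_nonneg hl0.le t)
  have h5 : vnorm z ^ 2 ≤ C * q' / q * l ^ t * vnorm x₀ ^ 2 + E / (1 - l) / q * c := by
    have : C * q' / q * l ^ t * vnorm x₀ ^ 2 + E / (1 - l) / q * c
        = (l ^ t * (C * (q' * vnorm x₀ ^ 2)) + E * c / (1 - l)) / q := by
      field_simp
    rw [this, le_div_iff₀ hq]
    linarith
  have hx0 := vnorm_nonneg x₀
  refine le_of_sq_le_sq (h5.trans ?_) (by positivity)
  have h6 : (Real.sqrt (C * q' / q) * Real.sqrt l ^ t * vnorm x₀) ^ 2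
      = C * q' / q * l ^ t * vnorm x₀ ^ 2 := by
    rw [mul_pow, mul_pow, Real.sq_sqrt (by positivity), ← pow_mul, mul_comm t, pow_mul,
      Real.sq_sqrt hl0.le]
  have h7 : (Real.sqrt (E / (1 - l) / q) * Real.sqrt c) ^ 2 = E / (1 - l) / q * c := by
    rw [mul_pow, Real.sq_sqrt (by positivity), Real.sq_sqrt hc0]
  have h8 : 0 ≤ (Real.sqrt (C * q' / q) * Real.sqrt l ^ t * vnorm x₀)
      * (Real.sqrt (E / (1 - l) / q) * Real.sqrt c) := by positivity
  rw [add_sq, h6, h7]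
  linarith

theorem input_to_state_stability (hku : 0 < ku) (hkx : 0 < kx) {N : ℕ} (hN : 1 ≤ N) :
    ∃ (β : ℝ → ℕ → ℝ) (γ : ℝ → ℝ), ClassKL β ∧ ClassK γ ∧
      ∀ x₀ ∈ S.Gam ku kx d α N, ∀ w : ℕ → Fin n → ℝ, (∀ t, vnorm (w t) ≤ μ) →
        ∀ (t : ℕ) (c : ℝ), 0 ≤ c → (∀ τ < t, vnorm (w τ) ≤ c) →
          vnorm (S.closedLoop ku kx N x₀ w t) ≤ β (vnorm x₀) t + γ c := by
  obtain ⟨a, b, ρ, ha, hb, hρ, hρ1, hiss⟩ := h.exists_iss_bound hC hku hkx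
  refine ⟨fun s t => a * ρ ^ t * s, fun c => b * Real.sqrt c,
    ⟨fun t => ⟨by fun_prop, ?_, by simp⟩, fun s hs => ⟨?_, ?_⟩⟩, ⟨by fun_prop, ?_, by simp⟩,
    hiss N hN⟩
  · intro s _ s' _ hss
    dsimp only
    gcongr
  · intro t t' htt
    have := pow_le_pow_of_le_one hρ.le hρ1.le htt
    dsimp only
    gcongr
  · simpa using ((tendsto_pow_atTop_nhds_zero_of_lt_one hρ.le hρ1).const_mul a).mul_const s
  · intro s hs s' _ hss
    have := Real.sqrt_lt_sqrt hs hss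
    dsimp only
    gcongr

include hT

omit hC in
theorem Gam_mem_nhds (hku : 0 < ku) (hkx : 0 < kx) {N : ℕ} (hN : 1 ≤ N) :
    S.Gam ku kx d α N ∈ 𝓝 0 := by
  have hopen : IsOpen {x : Fin n → ℝ | x ⬝ᵥ S.P *ᵥ x < α} :=
    isOpen_lt (continuous_quad S.P) continuous_const
  refine mem_of_superset (hopen.mem_nhds ?_) fun x hx => ?_
  · rw [Set.mem_ofPred_eq, zero_dotProduct]; exact hT.α_pos
  · rw [Set.mem_ofPred_eq] at hx
    refine h.mem_Gam_of_value_le hT hN ?_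
    rw [h.value_eq_of_quadP_le hT hku hkx hN hx.le]
    exact hx.le

theorem nominal_stability (hku : 0 < ku) (hkx : 0 < kx) {N : ℕ} (hN : 1 ≤ N) :
    S.Gam ku kx d α N ∈ 𝓝 0 ∧
    (∀ ε : ℝ, 0 < ε → ∃ δ : ℝ, 0 < δ ∧ ∀ x₀ : Fin n → ℝ, vnorm x₀ < δ →
      ∀ t, vnorm (S.closedLoop ku kx N x₀ 0 t) < ε) ∧
    ∀ x₀ ∈ S.Gam ku kx d α N,
      (∀ t, S.closedLoop ku kx N x₀ 0 t ∈ S.Gam ku kx d α N) ∧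
      Tendsto (S.closedLoop ku kx N x₀ 0) atTop (𝓝 0) := by
  obtain ⟨a, b, ρ, ha, hb, hρ, hρ1, hiss⟩ := h.exists_iss_bound hC hku hkx
  have hw : ∀ t, vnorm ((0 : ℕ → Fin n → ℝ) t) ≤ μ := fun t => by
    rw [Pi.zero_apply, vnorm_zero]; exact hC.μ_pos.le
  have hdec : ∀ x₀ ∈ S.Gam ku kx d α N, ∀ t,
      vnorm (S.closedLoop ku kx N x₀ 0 t) ≤ a * ρ ^ t * vnorm x₀ := fun x₀ hx₀ t => by
    have := hiss N hN x₀ hx₀ 0 hw t 0 le_rfl fun τ _ => by rw [Pi.zero_apply, vnorm_zero]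
    simpa using this
  have hnhds := h.Gam_mem_nhds hT hku hkx hN
  refine ⟨hnhds, fun ε hε => ?_, fun x₀ hx₀ => ⟨closedLoop_mem_Gam hC hN hx₀ hw, ?_⟩⟩
  · obtain ⟨δ, hδ, hball⟩ := Metric.mem_nhds_iff.1 hnhds
    refine ⟨min δ (ε / a), by positivity, fun x₀ hx₀ t => ?_⟩
    have hx₀' : x₀ ∈ S.Gam ku kx d α N := by
      refine hball ?_
      rw [mem_ball_zero_iff, pi_norm_lt_iff hδ]
      exact fun i => (abs_apply_le_vnorm x₀ i).trans_lt (hx₀.trans_le (min_le_left _ _))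
    have h1 := hx₀.trans_le (min_le_right _ _)
    rw [lt_div_iff₀ ha] at h1
    have h2 : a * ρ ^ t * vnorm x₀ ≤ a * 1 * vnorm x₀ := by
      have := pow_le_one₀ (n := t) hρ.le hρ1.le
      have := vnorm_nonneg x₀
      gcongr
    linarith [hdec x₀ hx₀' t]
  · rw [tendsto_pi_nhds]
    intro i
    refine squeeze_zero_norm (a := fun t => a * ρ ^ t * vnorm x₀)
      (fun t => (abs_apply_le_vnorm _ i).trans (hdec x₀ hx₀ t)) ?_
    simpa using ((tendsto_pow_atTop_nhds_zero_of_lt_one hρ.le hρ1).const_mul a).mul_const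
      (vnorm x₀)

omit hC in
-- All optimal perturbations vanish here, so the whole prediction is that of the feedback `K` and
-- stays in the region where the constraints hold.
theorem terminal_zero_slack (hku : 0 < ku) (hkx : 0 < kx) {N : ℕ} (hN : 1 ≤ N) {x : Fin n → ℝ}
    (hx : x ⬝ᵥ S.P *ᵥ x ≤ α) :
    (S.solution ku kx N x).r = 0 ∧ (S.solution ku kx N x).s = 0 ∧
      InBox S.ulo S.uhi 0 (S.control ku kx N x) ∧ InBox S.xlo S.xhi 0 x := by
  have hopt := h.isOpt_opt hku hkx hN x
  have hz := h.isOpt_eq_zero hT hku.le hkx.le hopt hx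
  have hstate : ∀ k ≤ N, S.predState x (S.opt ku kx N x) k ⬝ᵥ S.P *ᵥ
      S.predState x (S.opt ku kx N x) k ≤ α := fun k hk =>
    h.quadP_predState_le hx fun j hj => hz j (by omega)
  have hinput : ∀ k < N, violVec S.ulo S.uhi (S.predInput x (S.opt ku kx N x) k) = 0 := by
    intro k hk
    rw [← violSum_eq_zero_iff, predInput, hz k hk, add_zero]
    exact (hT.box _ (hstate k hk.le)).2
  rw [h.solution_eq_opt hku hkx hN]
  refine ⟨funext fun k => hinput k k.2, funext fun k => ?_, ?_, ?_⟩
  · exact (violSum_eq_zero_iff _).1 (hT.box _ (hstate (k + 1) k.2)).1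
  · rw [inBox_iff h.hu le_rfl, control_eq, hinput 0 (by omega)]
  · rw [inBox_iff h.hx le_rfl, (violSum_eq_zero_iff _).1 (hT.box x hx).1]

theorem robust_constraints (hku : 0 < ku) (hkx : 0 < kx) {N : ℕ} (hN : 1 ≤ N) :
    ∃ T : ℕ, ∀ x₀ ∈ S.Gam ku kx d α N, ∀ w : ℕ → Fin n → ℝ, (∀ t, vnorm (w t) ≤ μ) →
      ∀ t : ℕ, (T ≤ t ∨ x₀ ⬝ᵥ S.P *ᵥ x₀ ≤ α) →
        (S.solution ku kx N (S.closedLoop ku kx N x₀ w t)).r = 0 ∧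
        (S.solution ku kx N (S.closedLoop ku kx N x₀ w t)).s = 0 ∧
        InBox S.ulo S.uhi 0 (S.control ku kx N (S.closedLoop ku kx N x₀ w t)) ∧
        InBox S.xlo S.xhi 0 (S.closedLoop ku kx N x₀ w t) := by
  have hα := hT.α_pos
  have hl0 := hC.l_pos
  have hl := hC.l_lt
  have hl1 : 0 < 1 - l := by linarith
  -- The asymptotic level of the value takes half of `α`; the initial value must decay below the
  -- other half.
  have hsmall : E * μ / (1 - l) ≤ α / 2 := by
    rw [div_le_iff₀ hl1]; linarith [hC.small]
  -- The value on `Γ_N` is not bounded a priori, but after one step it is at most `M`. Hence the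
  -- count starts at time one and `T + 1` appears below.
  set M := 2 * (((N : ℝ) - 1) * d + α) + E with hM
  obtain ⟨T, hTM⟩ : ∃ T : ℕ, l ^ T * |M| < α / 2 := by
    have h1 : Tendsto (fun T : ℕ => l ^ T * |M|) atTop (𝓝 0) := by
      simpa using (tendsto_pow_atTop_nhds_zero_of_lt_one hl0.le hl).mul_const |M|
    exact (h1.eventually_lt_const (by linarith : 0 < α / 2)).exists
  have htail : ∀ (x₀ : Fin n → ℝ) (w : ℕ → Fin n → ℝ) (s t : ℕ),
      S.closedLoop ku kx N x₀ w (s + t)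
        = S.closedLoop ku kx N (S.closedLoop ku kx N x₀ w s) (fun j => w (s + j)) t := by
    intro x₀ w s t
    induction t with
    | zero => rfl
    | succ t ih => rw [← add_assoc, closedLoop, ih]; rfl
  refine ⟨T + 1, fun x₀ hx₀ w hw t ht => h.terminal_zero_slack hT hku hkx hN ?_⟩
  refine (h.quadP_le_value hku hkx hN _).trans ?_
  rcases ht with ht | hx
  · obtain ⟨s, rfl⟩ := Nat.exists_eq_add_of_le ht
    have hstep := hC.step N hN x₀ hx₀ (w 0) (hw 0)
    rw [show T + 1 + s = 1 + (T + s) by omega, htail]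
    have h1 := value_closedLoop_le hC hN hstep.1 (fun j => hw (1 + j)) (T + s) hC.μ_pos.le
      fun τ _ => hw (1 + τ)
    refine h1.trans ?_
    have h2 : l ^ (T + s) * S.value ku kx N (S.step ku kx N x₀ (w 0)) ≤ l ^ T * |M| := by
      have h3 : l ^ (T + s) ≤ l ^ T := pow_le_pow_of_le_one hl0.le hl.le (by omega)
      have h4 := hstep.2.2.trans (le_abs_self M)
      have h5 : 0 ≤ S.value ku kx N (S.step ku kx N x₀ (w 0)) :=
        (h.hP.quad_nonneg _).trans (h.quadP_le_value hku hkx hN _)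
      gcongr
    linarith
  -- In the terminal region the value is `xᵀ P x`, and `small` makes the level `value ≤ α`
  -- invariant.
  · induction t with
    | zero => exact (h.value_eq_of_quadP_le hT hku hkx hN hx).trans_le hx
    | succ t ih =>
      have h1 := (hC.step N hN _ (closedLoop_mem_Gam hC hN hx₀ hw t) _ (hw t)).2.1
      have h2 := mul_le_mul_of_nonneg_left ih hl0.le
      have h3 := mul_le_mul_of_nonneg_left (hw t) hC.E_pos.le
      have h4 := hC.small
      have h5 : 0 ≤ (1 - l) * α := by positivity
      rw [closedLoop]
      linarith

end Admissible

end MPCData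

/-! ### Hoffman's error bound for linear inequalities. -/

section Hoffman

theorem Finite.exists_nonneg_bound {ι : Type*} [Finite ι] (f : ι → ℝ) :
    ∃ C : ℝ, 0 ≤ C ∧ ∀ i, f i ≤ C := by
  obtain ⟨C, hC⟩ := Set.Finite.bddAbove (Set.finite_range f)
  exact ⟨max C 0, le_max_right _ _, fun i => (hC ⟨i, rfl⟩).trans (le_max_left _ _)⟩

theorem abs_dotProduct_le {p : ℕ} (a y : Fin p → ℝ) {r : ℝ} (hy : ∀ j, |y j| ≤ r) :
    |a ⬝ᵥ y| ≤ (∑ j, |a j|) * r := by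
  rw [dotProduct, Finset.sum_mul]
  refine (Finset.abs_sum_le_sum_abs _ _).trans (Finset.sum_le_sum fun j _ => ?_)
  rw [abs_mul]
  exact mul_le_mul_of_nonneg_left (hy j) (abs_nonneg _)

/-- Hoffman's error bound for the origin, by Fourier-Motzkin elimination. -/
theorem exists_hoffman_fin (p : ℕ) : ∀ (ι : Type) [Finite ι] (a : ι → Fin p → ℝ),
    ∃ H : ℝ, 0 ≤ H ∧ ∀ (b : ι → ℝ) (ε : ℝ), 0 ≤ ε → (∀ i, -ε ≤ b i) →
      (∃ v, ∀ i, a i ⬝ᵥ v ≤ b i) → ∃ v, (∀ i, a i ⬝ᵥ v ≤ b i) ∧ ∀ j, |v j| ≤ H * ε := by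
  induction p with
  | zero =>
    intro ι _ a
    exact ⟨0, le_rfl, fun b ε _ _ ⟨v, hv⟩ => ⟨v, hv, fun j => j.elim0⟩⟩
  | succ p ih =>
    intro ι _ a
    -- Eliminate the first coordinate: pair each upper bound on it with each lower bound, and keep
    -- the constraints that do not involve it.
    obtain ⟨H, hH, hind⟩ := ih (({i // 0 < a i 0} × {i // a i 0 < 0}) ⊕ {i // a i 0 = 0})
      (Sum.elim (fun e => (a e.1.1 0)⁻¹ • Fin.tail (a e.1.1) - (a e.2.1 0)⁻¹ • Fin.tail (a e.2.1))
        (fun i => Fin.tail (a i.1)))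
    obtain ⟨D, hD, hDa⟩ := Finite.exists_nonneg_bound fun i => |(a i 0)⁻¹|
    obtain ⟨A, hA, hAa⟩ := Finite.exists_nonneg_bound fun i => ∑ j, |Fin.tail (a i) j|
    have hsplit : ∀ i v, a i ⬝ᵥ v = a i 0 * v 0 + Fin.tail (a i) ⬝ᵥ Fin.tail v := fun i v =>
      Fin.sum_univ_succ _
    set H' := H * (2 * D + 1) with hH'
    have hH'0 : 0 ≤ H' := by positivity
    set G := D * (1 + A * H') with hG
    have hG0 : 0 ≤ G := by positivity
    refine ⟨max H' G, le_max_of_le_left hH'0, fun b ε hε hb ⟨v₀, hv₀⟩ => ?_⟩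
    have hDb : ∀ i, -(D * ε) ≤ |(a i 0)⁻¹| * b i := by
      intro i
      have h1 := mul_le_mul_of_nonneg_left (hb i) (abs_nonneg (a i 0)⁻¹)
      have h2 := mul_le_mul_of_nonneg_right (hDa i) hε
      linarith
    obtain ⟨y, hy, hyb⟩ := hind
      (Sum.elim (fun e => (a e.1.1 0)⁻¹ * b e.1.1 - (a e.2.1 0)⁻¹ * b e.2.1) (fun i => b i.1))
      -- The origin violates a paired constraint by at most `2 D ε` and a kept one by at most `ε`.
      ((2 * D + 1) * ε) (by positivity) (by
        rintro (⟨⟨i, hi⟩, ⟨k, hk⟩⟩ | ⟨i, hi⟩)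
        · have h1 := hDb i
          have h2 := hDb k
          rw [abs_of_pos (inv_pos.2 hi)] at h1
          rw [abs_of_neg (inv_lt_zero.2 hk)] at h2
          simp only [Sum.elim_inl]
          linarith
        · simp only [Sum.elim_inr]
          have : 0 ≤ D * ε := by positivity
          linarith [hb i]) ⟨Fin.tail v₀, by
        rintro (⟨⟨i, hi⟩, ⟨k, hk⟩⟩ | ⟨i, hi⟩)
        · simp only [Sum.elim_inl, sub_dotProduct, smul_dotProduct, smul_eq_mul]
          have h1 := hv₀ i
          have h2 := hv₀ k
          rw [hsplit] at h1 h2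
          have h3 := mul_le_mul_of_nonneg_left h1 (inv_pos.2 hi).le
          have h4 := mul_le_mul_of_nonpos_left h2 (inv_lt_zero.2 hk).le
          rw [mul_add, inv_mul_cancel_left₀ hi.ne'] at h3
          rw [mul_add, inv_mul_cancel_left₀ hk.ne] at h4
          linarith
        · have h1 := hv₀ i
          rw [hsplit, hi, zero_mul, zero_add] at h1
          exact h1⟩
    rw [← mul_assoc] at hyb
    have hres : ∀ i, -(G * ε) ≤ |(a i 0)⁻¹| * (b i - Fin.tail (a i) ⬝ᵥ y) := by
      intro i
      have h1 := hDb i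
      have h2 : |Fin.tail (a i) ⬝ᵥ y| ≤ A * (H' * ε) :=
        (abs_dotProduct_le _ _ hyb).trans
          (mul_le_mul_of_nonneg_right (hAa i) (by positivity))
      have h3 : |(a i 0)⁻¹| * (Fin.tail (a i) ⬝ᵥ y) ≤ D * (A * (H' * ε)) :=
        (mul_le_mul_of_nonneg_left ((le_abs_self _).trans h2) (abs_nonneg _)).trans
          (mul_le_mul_of_nonneg_right (hDa i) (by positivity))
      rw [hG]
      linarith
    -- The first coordinate is the largest of its lower bounds. Including `-(G ε)` makes the set
    -- nonempty and bounds the choice from below; `hres` bounds it from above.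
    set lower : Set ℝ := insert (-(G * ε)) (Set.range fun k : {i // a i 0 < 0} =>
      (a k.1 0)⁻¹ * (b k.1 - Fin.tail (a k.1) ⬝ᵥ y)) with hlower
    have hfin : lower.Finite := (Set.finite_range _).insert _
    obtain ⟨t, ht, hmax⟩ := Set.exists_max_image lower id hfin ⟨_, Set.mem_insert _ _⟩
    have ht1 : -(G * ε) ≤ t := hmax _ (Set.mem_insert _ _)
    have ht2 : t ≤ G * ε := by
      rcases ht with rfl | ⟨⟨k, hk⟩, rfl⟩
      · have : 0 ≤ G * ε := by positivity
        linarith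
      · have h1 := hres k
        rw [abs_of_neg (inv_lt_zero.2 hk)] at h1
        dsimp only
        linarith
    refine ⟨Fin.cons t y, fun i => ?_, fun j => ?_⟩
    · rw [hsplit, Fin.cons_zero, Fin.tail_cons]
      rcases lt_trichotomy (a i 0) 0 with hi | hi | hi
      · have h1 := hmax _ (Set.mem_insert_of_mem _ ⟨⟨i, hi⟩, rfl⟩)
        simp only [id] at h1
        have h2 := mul_le_mul_of_nonpos_left h1 hi.le
        rw [mul_inv_cancel_left₀ hi.ne] at h2
        linarith
      · have := hy (Sum.inr ⟨i, hi⟩)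
        simp only [Sum.elim_inr] at this
        rw [hi]
        linarith
      -- An upper bound exceeds `-(G ε)` by `hres`, and it exceeds each lower bound by the paired
      -- constraint that `y` satisfies.
      · have h1 : t ≤ (a i 0)⁻¹ * (b i - Fin.tail (a i) ⬝ᵥ y) := by
          rcases ht with rfl | ⟨⟨k, hk⟩, rfl⟩
          · have := hres i
            rwa [abs_of_pos (inv_pos.2 hi)] at this
          · have := hy (Sum.inl ⟨⟨i, hi⟩, ⟨k, hk⟩⟩)
            simp only [Sum.elim_inl, sub_dotProduct, smul_dotProduct, smul_eq_mul] at this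
            dsimp only
            linarith
        have h2 := mul_le_mul_of_nonneg_left h1 hi.le
        rw [mul_inv_cancel_left₀ hi.ne'] at h2
        linarith
    · refine Fin.cases ?_ (fun j => ?_) j
      · rw [Fin.cons_zero]
        exact (abs_le.2 ⟨ht1, ht2⟩).trans (mul_le_mul_of_nonneg_right (le_max_right _ _) hε)
      · rw [Fin.cons_succ]
        exact (hyb j).trans (mul_le_mul_of_nonneg_right (le_max_left _ _) hε)

variable {E : Type*} [NormedAddCommGroup E] [NormedSpace ℝ E] [FiniteDimensional ℝ E]

/-- Transport to coordinates; the constant picks up the operator norm of the inverse coordinate map.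
-/
theorem exists_hoffman {ι : Type} [Finite ι] (f : ι → E →ₗ[ℝ] ℝ) :
    ∃ H : ℝ, 0 ≤ H ∧ ∀ (b : ι → ℝ) (ε : ℝ), 0 ≤ ε → (∀ i, -ε ≤ b i) →
      (∃ v, ∀ i, f i v ≤ b i) → ∃ v, (∀ i, f i v ≤ b i) ∧ ‖v‖ ≤ H * ε := by
  set e := (Module.finBasis ℝ E).equivFun
  have hdot : ∀ i y, (fun j => f i (e.symm (Pi.single j 1))) ⬝ᵥ y = f i (e.symm y) := by
    intro i y
    conv_rhs => rw [← Finset.univ_sum_single y]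
    rw [map_sum, map_sum, dotProduct]
    refine Finset.sum_congr rfl fun j _ => ?_
    have : (Pi.single j (y j) : Fin _ → ℝ) = y j • Pi.single j 1 := by
      rw [← Pi.single_smul', smul_eq_mul, mul_one]
    rw [this, map_smul, map_smul, smul_eq_mul, mul_comm]
  obtain ⟨H, hH, hb⟩ := exists_hoffman_fin _ ι fun i j => f i (e.symm (Pi.single j 1))
  set g := LinearMap.toContinuousLinearMap e.symm.toLinearMap
  refine ⟨‖g‖ * H, by positivity, fun b ε hε hbε ⟨v₀, hv₀⟩ => ?_⟩
  obtain ⟨y, hy, hyH⟩ := hb b ε hε hbε ⟨e v₀, fun i => by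
    rw [hdot, e.symm_apply_apply]; exact hv₀ i⟩
  refine ⟨e.symm y, fun i => by rw [← hdot]; exact hy i, ?_⟩
  have h1 : ‖y‖ ≤ H * ε := (pi_norm_le_iff_of_nonneg (by positivity)).2 hyH
  have h2 : ‖e.symm y‖ ≤ ‖g‖ * ‖y‖ := g.le_opNorm y
  rw [mul_assoc]
  exact h2.trans (mul_le_mul_of_nonneg_left h1 (norm_nonneg _))

theorem viol_eq_zero_iff {lo hi : EReal} (hlo : lo < 0) (hhi : 0 < hi) {v : ℝ} :
    viol lo hi v = 0 ↔ lo ≤ v ∧ (v : EReal) ≤ hi := by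
  have := viol_le_iff hlo hhi (v := v) (le_refl (0 : ℝ))
  rw [add_zero, sub_zero] at this
  rw [← this]
  exact ⟨fun h => h.le, fun h => le_antisymm h (viol_nonneg _ _ _)⟩

/-- Only finite bounds become inequalities, whence the subtypes. The constant does not depend on
`c`, which later carries the current state and the sequence to be repaired. -/
theorem exists_hoffman_box {ι : Type} [Finite ι] (f : ι → E →ₗ[ℝ] ℝ) {lo hi : ι → EReal}
    (hlh : ∀ i, lo i < 0 ∧ 0 < hi i) :
    ∃ H : ℝ, 0 ≤ H ∧ ∀ (c : ι → ℝ) (ε : ℝ), 0 ≤ ε → (∀ i, viol (lo i) (hi i) (c i) ≤ ε) →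
      (∃ v, ∀ i, viol (lo i) (hi i) (c i + f i v) = 0) →
      ∃ v, (∀ i, viol (lo i) (hi i) (c i + f i v) = 0) ∧ ‖v‖ ≤ H * ε := by
  have hhi : ∀ {i}, hi i ≠ ⊤ → ((hi i).toReal : EReal) = hi i := fun {i} h =>
    EReal.coe_toReal h (ne_bot_of_gt (hlh i).2)
  have hlo : ∀ {i}, lo i ≠ ⊥ → ((lo i).toReal : EReal) = lo i := fun {i} h =>
    EReal.coe_toReal (ne_top_of_lt (hlh i).1) h
  obtain ⟨H, hH, hb⟩ := exists_hoffman (ι := {i // hi i ≠ ⊤} ⊕ {i // lo i ≠ ⊥})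
    (Sum.elim (fun i => f i.1) (fun i => -f i.1))
  refine ⟨H, hH, fun c ε hε hcε hex => ?_⟩
  have hiff : ∀ v, (∀ i, viol (lo i) (hi i) (c i + f i v) = 0) ↔
      ∀ i : {i // hi i ≠ ⊤} ⊕ {i // lo i ≠ ⊥},
        (Sum.elim (fun i => f i.1) (fun i => -f i.1) : _ → E →ₗ[ℝ] ℝ) i v
          ≤ Sum.elim (fun i : {i // hi i ≠ ⊤} => (hi i.1).toReal - c i.1)
            (fun i : {i // lo i ≠ ⊥} => c i.1 - (lo i.1).toReal) i := by
    intro v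
    simp only [viol_eq_zero_iff (hlh _).1 (hlh _).2]
    constructor
    · rintro hv (⟨i, hi'⟩ | ⟨i, hi'⟩)
      · have := (hv i).2
        rw [← hhi hi', EReal.coe_le_coe_iff] at this
        simp only [Sum.elim_inl]
        linarith
      · have := (hv i).1
        rw [← hlo hi', EReal.coe_le_coe_iff] at this
        simp only [Sum.elim_inr, LinearMap.neg_apply]
        linarith
    · intro hv i
      constructor
      · by_cases hi' : lo i = ⊥
        · rw [hi']; exact bot_le
        · have := hv (Sum.inr ⟨i, hi'⟩)
          simp only [Sum.elim_inr, LinearMap.neg_apply] at this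
          rw [← hlo hi', EReal.coe_le_coe_iff]
          linarith
      · by_cases hi' : hi i = ⊤
        · rw [hi']; exact le_top
        · have := hv (Sum.inl ⟨i, hi'⟩)
          simp only [Sum.elim_inl] at this
          rw [← hhi hi', EReal.coe_le_coe_iff]
          linarith
  simp only [hiff] at hex ⊢
  refine hb _ ε hε ?_ hex
  rintro (⟨i, hi'⟩ | ⟨i, hi'⟩)
  · have := ((viol_le_iff (hlh i).1 (hlh i).2 hε).1 (hcε i)).2
    rw [← hhi hi', EReal.coe_le_coe_iff] at this
    simp only [Sum.elim_inl]
    linarith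
  · have := ((viol_le_iff (hlh i).1 (hlh i).2 hε).1 (hcε i)).1
    rw [← hlo hi', EReal.coe_le_coe_iff] at this
    simp only [Sum.elim_inr]
    linarith

end Hoffman

/-! ### Exact penalties and recursive hard feasibility. -/

theorem abs_apply_le_of_norm_le {p : ℕ} {y : Fin p → ℝ} {r : ℝ} (hy : ‖y‖ ≤ r) (i : Fin p) :
    |y i| ≤ r := (norm_le_pi_norm y i).trans hy

theorem extendZero_add {N p : ℕ} (v w : Fin N → Fin p → ℝ) :
    extendZero (v + w) = extendZero v + extendZero w := by
  funext k
  rw [Pi.add_apply]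
  rcases lt_or_ge k N with hk | hk
  · simp only [extendZero_of_lt _ hk, Pi.add_apply]
  · simp only [extendZero_of_le _ hk, add_zero]

theorem extendZero_smul {N p : ℕ} (a : ℝ) (v : Fin N → Fin p → ℝ) :
    extendZero (a • v) = a • extendZero v := by
  funext k
  rw [Pi.smul_apply]
  rcases lt_or_ge k N with hk | hk
  · simp only [extendZero_of_lt _ hk, Pi.smul_apply]
  · simp only [extendZero_of_le _ hk, smul_zero]

theorem exists_abs_dotProduct_mulVec_le {p : ℕ} (M : Matrix (Fin p) (Fin p) ℝ) :
    ∃ C : ℝ, 0 ≤ C ∧ ∀ y z : Fin p → ℝ, |y ⬝ᵥ M *ᵥ z| ≤ C * ‖y‖ * ‖z‖ := by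
  refine ⟨p * ‖M‖, by positivity, fun y z => ?_⟩
  have h1 := abs_dotProduct_le (M *ᵥ z) y fun j => abs_apply_le_of_norm_le le_rfl j
  have h2 : ∑ j, |(M *ᵥ z) j| ≤ p * (‖M‖ * ‖z‖) := by
    have := Finset.sum_le_sum fun j (_ : j ∈ Finset.univ) =>
      abs_apply_le_of_norm_le (linfty_opNorm_mulVec M z) j
    simpa using this
  rw [dotProduct_comm]
  refine h1.trans ((mul_le_mul_of_nonneg_right h2 (norm_nonneg y)).trans_eq ?_)
  ring

namespace MPCData

variable {n m : ℕ} {S : MPCData n m} {ku kx d α l E μ : ℝ}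

theorem predState_smul (a : ℝ) (x : Fin n → ℝ) (v : ℕ → Fin m → ℝ) (k : ℕ) :
    S.predState (a • x) (a • v) k = a • S.predState x v k := by
  induction k with
  | zero => rfl
  | succ k ih => simp only [predState, ih, Pi.smul_apply, mulVec_smul, smul_add]

theorem predInput_smul (a : ℝ) (x : Fin n → ℝ) (v : ℕ → Fin m → ℝ) (k : ℕ) :
    S.predInput (a • x) (a • v) k = a • S.predInput x v k := by
  simp only [predInput, predState_smul, mulVec_smul, Pi.smul_apply, smul_add]

/-- The predicted states, as linear functions of the input perturbations. -/
def predStateLin (S : MPCData n m) (N k : ℕ) : (Fin N → Fin m → ℝ) →ₗ[ℝ] Fin n → ℝ where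
  toFun w := S.predState 0 (extendZero w) k
  map_add' v w := by rw [← predState_add, add_zero, extendZero_add]
  map_smul' a v := by rw [RingHom.id_apply, ← predState_smul, smul_zero, extendZero_smul]

/-- The predicted inputs, as linear functions of the input perturbations. -/
def predInputLin (S : MPCData n m) (N k : ℕ) : (Fin N → Fin m → ℝ) →ₗ[ℝ] Fin m → ℝ where
  toFun w := S.predInput 0 (extendZero w) k
  map_add' v w := by rw [← predInput_add, add_zero, extendZero_add]
  map_smul' a v := by rw [RingHom.id_apply, ← predInput_smul, smul_zero, extendZero_smul]

/-- Unit weights turn `penalty` into a measure of violation that is independent of `ku` and `kx`. -/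
theorem penalty_one_eq_zero_iff {x : Fin n → ℝ} {v : ℕ → Fin m → ℝ} {k : ℕ} :
    S.penalty 1 1 x v k = 0 ↔ violSum S.ulo S.uhi (S.predInput x v k) = 0 ∧
      violSum S.xlo S.xhi (S.predState x v (k + 1)) = 0 := by
  have h1 := violSum_nonneg (lo := S.ulo) (hi := S.uhi) (S.predInput x v k)
  have h2 := violSum_nonneg (lo := S.xlo) (hi := S.xhi) (S.predState x v (k + 1))
  rw [penalty]
  constructor
  · intro h
    constructor <;> linarith
  · rintro ⟨h3, h4⟩
    rw [h3, h4]
    ring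

theorem mul_penalty_one_le {κ : ℝ} (hku : κ ≤ ku) (hkx : κ ≤ kx) (x : Fin n → ℝ)
    (v : ℕ → Fin m → ℝ) (k : ℕ) : κ * S.penalty 1 1 x v k ≤ S.penalty ku kx x v k := by
  have h1 := mul_le_mul_of_nonneg_right hku
    (violSum_nonneg (lo := S.ulo) (hi := S.uhi) (S.predInput x v k))
  have h2 := mul_le_mul_of_nonneg_right hkx
    (violSum_nonneg (lo := S.xlo) (hi := S.xhi) (S.predState x v (k + 1)))
  rw [penalty, penalty]
  linarith

theorem penalty_eq_zero_of_one {x : Fin n → ℝ} {v : ℕ → Fin m → ℝ} {k : ℕ}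
    (hz : S.penalty 1 1 x v k = 0) : S.penalty ku kx x v k = 0 := by
  rw [penalty_one_eq_zero_iff] at hz
  rw [penalty, hz.1, hz.2]
  simp

namespace Admissible

variable (h : S.Admissible)
include h

theorem hardFeasible_iff {N : ℕ} {x : Fin n → ℝ} :
    S.HardFeasible N x ↔ ∃ v : ℕ → Fin m → ℝ, ∀ k < N, S.penalty 1 1 x v k = 0 := by
  have key : ∀ w : Fin N → Fin m → ℝ, S.IsFeasible N x ⟨w, 0, 0⟩ ↔
      ∀ k < N, S.penalty 1 1 x (extendZero w) k = 0 := by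
    intro w
    rw [h.isFeasible_iff]
    simp only [penalty_one_eq_zero_iff, violSum_eq_zero_iff]
    constructor
    · intro hw k hk
      exact ⟨le_antisymm (hw ⟨k, hk⟩).1 (violVec_nonneg _),
        le_antisymm (hw ⟨k, hk⟩).2 (violVec_nonneg _)⟩
    · intro hw k
      exact ⟨(hw k k.2).1.le, (hw k k.2).2.le⟩
  constructor
  · rintro ⟨w, hw⟩
    exact ⟨_, (key w).1 hw⟩
  · rintro ⟨v, hv⟩
    refine ⟨fun k => v k, (key _).2 fun k hk => ?_⟩
    rw [penalty_congr (v' := v) fun j hj => extendZero_of_lt _ (by omega)]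
    exact hv k hk

/-- The distance to the hard constraints is bounded by their violation. -/
theorem exists_repair (N : ℕ) : ∃ H : ℝ, 0 ≤ H ∧ ∀ (x : Fin n → ℝ) (v : ℕ → Fin m → ℝ),
    S.HardFeasible N x → ∃ e : ℕ → Fin m → ℝ, (∀ k < N, S.penalty 1 1 x (v + e) k = 0) ∧
      ∀ k < N, ‖e k‖ ≤ H * ∑ k ∈ Finset.range N, S.penalty 1 1 x v k := by
  obtain ⟨H, hH, hbox⟩ := exists_hoffman_box
    (ι := (Fin N × Fin m) ⊕ (Fin N × Fin n))
    (Sum.elim (fun p => LinearMap.proj p.2 ∘ₗ S.predInputLin N p.1)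
      (fun p => LinearMap.proj p.2 ∘ₗ S.predStateLin N (p.1 + 1)))
    (lo := Sum.elim (fun p => S.ulo p.2) (fun p => S.xlo p.2))
    (hi := Sum.elim (fun p => S.uhi p.2) (fun p => S.xhi p.2))
    (by rintro (p | p)
        · exact h.hu p.2
        · exact h.hx p.2)
  refine ⟨H, hH, fun x v hf => ?_⟩
  set τ := ∑ k ∈ Finset.range N, S.penalty 1 1 x v k with hτ
  have hτk : ∀ k < N, S.penalty 1 1 x v k ≤ τ := fun k hk =>
    Finset.single_le_sum (f := fun k => S.penalty 1 1 x v k)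
      (fun j _ => penalty_nonneg zero_le_one zero_le_one x v j) (Finset.mem_range.2 hk)
  have hτ0 : 0 ≤ τ := Finset.sum_nonneg fun j _ => penalty_nonneg zero_le_one zero_le_one x v j
  have hui : ∀ k (i : Fin m), viol (S.ulo i) (S.uhi i) (S.predInput x v k i)
      ≤ violSum S.ulo S.uhi (S.predInput x v k) := fun k i =>
    Finset.single_le_sum (f := fun i => viol (S.ulo i) (S.uhi i) (S.predInput x v k i))
      (fun _ _ => viol_nonneg _ _ _) (Finset.mem_univ i)
  have hxi : ∀ k (i : Fin n), viol (S.xlo i) (S.xhi i) (S.predState x v (k + 1) i)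
      ≤ violSum S.xlo S.xhi (S.predState x v (k + 1)) := fun k i =>
    Finset.single_le_sum (f := fun i => viol (S.xlo i) (S.xhi i) (S.predState x v (k + 1) i))
      (fun _ _ => viol_nonneg _ _ _) (Finset.mem_univ i)
  have hpk : ∀ k, S.penalty 1 1 x v k = 2 * violSum S.ulo S.uhi (S.predInput x v k)
      + 2 * violSum S.xlo S.xhi (S.predState x v (k + 1)) := fun k => by rw [penalty]; ring
  have hu0 := fun k => violSum_nonneg (lo := S.ulo) (hi := S.uhi) (S.predInput x v k)
  have hx0 := fun k => violSum_nonneg (lo := S.xlo) (hi := S.xhi) (S.predState x v (k + 1))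
  have hin : ∀ (w : Fin N → Fin m → ℝ) (k : ℕ), S.predInput x (v + extendZero w) k
      = S.predInput x v k + S.predInput 0 (extendZero w) k := fun w k => by
    rw [← predInput_add, add_zero]
  have hst : ∀ (w : Fin N → Fin m → ℝ) (k : ℕ), S.predState x (v + extendZero w) k
      = S.predState x v k + S.predState 0 (extendZero w) k := fun w k => by
    rw [← predState_add, add_zero]
  obtain ⟨w, hw, hwn⟩ := hbox
    (Sum.elim (fun p => S.predInput x v p.1 p.2) (fun p => S.predState x v (p.1 + 1) p.2)) τ hτ0
    (by rintro (⟨k, i⟩ | ⟨k, i⟩)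
        · have h1 := hτk k k.2
          rw [hpk] at h1
          simp only [Sum.elim_inl]
          linarith [hui k i, hu0 k, hx0 k]
        · have h1 := hτk k k.2
          rw [hpk] at h1
          simp only [Sum.elim_inr]
          linarith [hxi k i, hu0 k, hx0 k])
    -- A repair exists: the difference between a hard-feasible sequence and `v`. Hoffman's bound
    -- replaces it by a small one.
    (by obtain ⟨v', hv'⟩ := h.hardFeasible_iff.1 hf
        have hvv : ∀ j < N, (v + extendZero fun k : Fin N => v' k - v k) j = v' j := by
          intro j hj
          rw [Pi.add_apply, extendZero_of_lt _ hj]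
          exact add_sub_cancel _ _
        refine ⟨fun k => v' k - v k, ?_⟩
        rintro (⟨k, i⟩ | ⟨k, i⟩)
        · have h1 := (violSum_eq_zero_iff _).1 (penalty_one_eq_zero_iff.1 (hv' k k.2)).1
          rw [← predInput_congr fun j hj => hvv j (by omega), hin] at h1
          exact congrFun h1 i
        · have h1 := (violSum_eq_zero_iff _).1 (penalty_one_eq_zero_iff.1 (hv' k k.2)).2
          rw [← predState_congr fun j hj => hvv j (by omega), hst] at h1
          exact congrFun h1 i)
  refine ⟨extendZero w, fun k hk => ?_, fun k hk => ?_⟩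
  · rw [penalty_one_eq_zero_iff, hin, hst, violSum_eq_zero_iff, violSum_eq_zero_iff]
    exact ⟨funext fun i => hw (Sum.inl (⟨k, hk⟩, i)), funext fun i => hw (Sum.inr (⟨k, hk⟩, i))⟩
  · rw [extendZero_of_lt _ hk]
    exact (norm_le_pi_norm w _).trans hwn

theorem exists_penalty_zero_le (N : ℕ) : ∃ C : ℝ, 0 ≤ C ∧ ∀ x : Fin n → ℝ,
    ∑ k ∈ Finset.range N, S.penalty 1 1 x 0 k ≤ C * vnorm x := by
  obtain ⟨D, ρ, hD, hρ, hρ1, hdec⟩ := h.exists_vnorm_predState_le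
  obtain ⟨CK, hCK, hK⟩ := exists_vnorm_mulVec_le S.K
  have hs : ∀ (x : Fin n → ℝ) (k : ℕ), vnorm (S.predState x 0 k) ≤ D * vnorm x := by
    intro x k
    refine (hdec x k).trans ?_
    have := pow_le_one₀ (n := k) hρ hρ1.le
    have := vnorm_nonneg x
    calc D * ρ ^ k * vnorm x ≤ D * 1 * vnorm x := by gcongr
      _ = D * vnorm x := by ring
  have hv : ∀ {p : ℕ} {lo hi : Fin p → EReal} (_ : ∀ i, lo i < 0 ∧ 0 < hi i) (y : Fin p → ℝ),
      violSum lo hi y ≤ p * vnorm y := by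
    intro p lo hi hlh y
    exact (Finset.sum_le_sum fun i _ => viol_le_abs (hlh i).1 (hlh i).2 _).trans
      (sum_abs_le_card_mul_vnorm y)
  refine ⟨N * (2 * (m * (CK * D)) + 2 * (n * D)), by positivity, fun x => ?_⟩
  have hk : ∀ k ∈ Finset.range N, S.penalty 1 1 x 0 k
      ≤ (2 * (m * (CK * D)) + 2 * (n * D)) * vnorm x := by
    intro k _
    have h1 := hv h.hu (S.predInput x 0 k)
    have h2 := hv h.hx (S.predState x 0 (k + 1))
    have h3 : vnorm (S.predInput x 0 k) ≤ CK * (D * vnorm x) := by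
      rw [predInput, Pi.zero_apply, add_zero]
      exact (hK _).trans (mul_le_mul_of_nonneg_left (hs x k) hCK)
    have h4 := mul_le_mul_of_nonneg_left h3 (Nat.cast_nonneg (α := ℝ) m)
    have h5 := mul_le_mul_of_nonneg_left (hs x (k + 1)) (Nat.cast_nonneg (α := ℝ) n)
    rw [penalty]
    linarith
  refine (Finset.sum_le_sum hk).trans_eq ?_
  rw [Finset.sum_const, Finset.card_range, nsmul_eq_mul]
  ring

/-- On bounded sets of hard-feasible states the optimal value is bounded, uniformly in the
penalties. -/
theorem exists_value_bound (N : ℕ) (hN : 1 ≤ N) (r : ℝ) : ∃ B : ℝ, 0 ≤ B ∧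
    ∀ ku kx : ℝ, 0 < ku → 0 < kx → ∀ x : Fin n → ℝ, vnorm x ≤ r → S.HardFeasible N x →
      S.value ku kx N x ≤ B := by
  obtain ⟨H, hH, hrep⟩ := h.exists_repair N
  obtain ⟨C, hC, hpen⟩ := h.exists_penalty_zero_le N
  obtain ⟨CP, hCP, hP⟩ := exists_quad_le S.P
  obtain ⟨CW, hCW, hW⟩ := exists_abs_dotProduct_mulVec_le S.weight
  set F := H * (C * |r|)
  have hF : 0 ≤ F := by positivity
  refine ⟨CP * r ^ 2 + N * (CW * F * F), by positivity, fun ku kx hku hkx x hx hf => ?_⟩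
  -- Repairing the zero sequence gives a candidate of bounded size without penalties, so its cost
  -- ignores `ku` and `kx`.
  obtain ⟨e, he, heb⟩ := hrep x 0 hf
  have hx0 := vnorm_nonneg x
  have heF : ∀ k < N, ‖e k‖ ≤ F := fun k hk => (heb k hk).trans
    (mul_le_mul_of_nonneg_left ((hpen x).trans
      (mul_le_mul_of_nonneg_left (hx.trans (le_abs_self r)) hC)) hH)
  refine (h.value_le hku hkx hN x e).trans ?_
  have h1 : ∀ k ∈ Finset.range N,
      e k ⬝ᵥ S.weight *ᵥ e k + S.penalty ku kx x e k ≤ CW * F * F := by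
    intro k hk
    rw [Finset.mem_range] at hk
    have hz := he k hk
    rw [zero_add] at hz
    rw [penalty_eq_zero_of_one hz, add_zero]
    refine (le_abs_self _).trans ((hW _ _).trans ?_)
    have := heF k hk
    gcongr
  have h2 := Finset.sum_le_sum h1
  rw [Finset.sum_const, Finset.card_range, nsmul_eq_mul] at h2
  have h3 : x ⬝ᵥ S.P *ᵥ x ≤ CP * r ^ 2 := by
    refine (hP x).trans ?_
    rw [← vnorm_sq]
    gcongr
  rw [cost]
  linarith

/-- Exactness of the penalties on bounded sets. -/
theorem exists_exact_penalty (N : ℕ) (hN : 1 ≤ N) (r : ℝ) : ∃ κ : ℝ, 0 < κ ∧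
    ∀ ku kx : ℝ, κ ≤ ku → κ ≤ kx → ∀ x : Fin n → ℝ, vnorm x ≤ r → S.HardFeasible N x →
      ∀ k < N, S.penalty 1 1 x (S.opt ku kx N x) k = 0 := by
  obtain ⟨H, hH, hrep⟩ := h.exists_repair N
  obtain ⟨B, hB, hval⟩ := h.exists_value_bound N hN r
  obtain ⟨CW, hCW, hW⟩ := exists_abs_dotProduct_mulVec_le S.weight
  obtain ⟨c, hc, hcW⟩ := h.weight_posDef.exists_le_quad
  set F := Real.sqrt (B / c)
  have hF : 0 ≤ F := Real.sqrt_nonneg _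
  -- If the repair satisfies `‖e k‖ ≤ H τ ≤ H B`, each quadratic term grows by at most `CW (2 F + H
  -- B) H τ`, in total by `G τ`.
  set G := N * (CW * (2 * F + H * B) * H) with hG
  have hG0 : 0 ≤ G := by positivity
  refine ⟨1 + G, by positivity, fun ku kx hku hkx x hx hf => ?_⟩
  have hku0 : 0 < ku := by linarith
  have hkx0 : 0 < kx := by linarith
  set v := S.opt ku kx N x
  have hVB : S.cost ku kx N x v ≤ B := by
    rw [← h.value_eq hku0 hkx0 hN]; exact hval ku kx hku0 hkx0 x hx hf
  set τ := ∑ k ∈ Finset.range N, S.penalty 1 1 x v k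
  have hp0 : ∀ k ∈ Finset.range N, 0 ≤ S.penalty 1 1 x v k := fun k _ =>
    penalty_nonneg zero_le_one zero_le_one x v k
  have hτ0 : 0 ≤ τ := Finset.sum_nonneg hp0
  have hW0 : ∀ k ∈ Finset.range N, 0 ≤ v k ⬝ᵥ S.weight *ᵥ v k := fun k _ =>
    h.weight_posSemidef.quad_nonneg _
  have hcost : x ⬝ᵥ S.P *ᵥ x + ∑ k ∈ Finset.range N, v k ⬝ᵥ S.weight *ᵥ v k + (1 + G) * τ
      ≤ S.cost ku kx N x v := by
    rw [cost, Finset.sum_add_distrib, Finset.mul_sum]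
    have := Finset.sum_le_sum fun k (_ : k ∈ Finset.range N) =>
      mul_penalty_one_le (S := S) hku hkx x v k
    linarith
  have hPx := h.hP.quad_nonneg x
  have hWs := Finset.sum_nonneg hW0
  have hτB : τ ≤ B := by nlinarith
  have hvF : ∀ k < N, ‖v k‖ ≤ F := by
    intro k hk
    refine (pi_norm_le_iff_of_nonneg hF).2 fun i => Real.abs_le_sqrt ?_
    rw [le_div_iff₀ hc, mul_comm]
    have h1 := (mul_le_mul_of_nonneg_left (sq_le_dotProduct_self (v k) i) hc.le).trans (hcW _)
    have h2 := Finset.single_le_sum hW0 (Finset.mem_range.2 hk)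
    have h3 : 0 ≤ (1 + G) * τ := by positivity
    linarith
  obtain ⟨e, he, heb⟩ := hrep x v hf
  have hterm : ∀ k ∈ Finset.range N,
      (v + e) k ⬝ᵥ S.weight *ᵥ (v + e) k + S.penalty ku kx x (v + e) k
        ≤ v k ⬝ᵥ S.weight *ᵥ v k + CW * (2 * F + H * B) * H * τ := by
    intro k hk
    rw [Finset.mem_range] at hk
    rw [penalty_eq_zero_of_one (he k hk), add_zero, Pi.add_apply,
      quad_add h.weight_posSemidef.transpose_eq]
    have h1 := (le_abs_self _).trans (hW (v k) (e k))
    have h2 := (le_abs_self _).trans (hW (e k) (e k))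
    have h3 : ‖e k‖ ≤ H * τ := heb k hk
    have h4 : ‖e k‖ ≤ H * B := h3.trans (by gcongr)
    have h5 : CW * ‖v k‖ * ‖e k‖ ≤ CW * F * (H * τ) := by
      have := hvF k hk
      gcongr
    have h6 : CW * ‖e k‖ * ‖e k‖ ≤ CW * (H * B) * (H * τ) := by gcongr
    linarith
  have hsum := Finset.sum_le_sum hterm
  simp only [Finset.sum_add_distrib, Finset.sum_const, Finset.card_range, nsmul_eq_mul] at hsum
  have hGτ : (N : ℝ) * (CW * (2 * F + H * B) * H * τ) = G * τ := by rw [hG]; ring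
  rw [hGτ] at hsum
  have hopt := h.isOpt_opt hku0 hkx0 hN x (v + e)
  have hve : S.cost ku kx N x (v + e) = x ⬝ᵥ S.P *ᵥ x + ∑ k ∈ Finset.range N,
      ((v + e) k ⬝ᵥ S.weight *ᵥ (v + e) k + S.penalty ku kx x (v + e) k) := rfl
  rw [Finset.sum_add_distrib] at hve
  -- Optimality against the repaired sequence gives `(1 + G) τ ≤ G τ`.
  have hτz : τ = 0 := le_antisymm (by linarith) hτ0
  exact fun k hk => (Finset.sum_eq_zero_iff_of_nonneg hp0).1 hτz k (Finset.mem_range.2 hk)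

/-- The value is bounded at the start uniformly in the penalties and does not increase, so the
trajectory stays in a ball of known radius; `κ` is the exactness threshold for that ball. Zero
slacks pass on to the shifted sequence. -/
theorem hard_constraints (hT : S.IsTerminalLevel d α) (N : ℕ) (hN : 1 ≤ N) (r : ℝ) :
    ∃ κ : ℝ, 0 < κ ∧ ∀ ku kx : ℝ, κ ≤ ku → κ ≤ kx →
      ∀ x₀ : Fin n → ℝ, vnorm x₀ ≤ r → S.HardFeasible N x₀ →
      (∀ t, S.closedLoop ku kx N x₀ 0 t ∈ S.Gam ku kx d α N) → ∀ t,
        (S.solution ku kx N (S.closedLoop ku kx N x₀ 0 t)).r = 0 ∧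
        (S.solution ku kx N (S.closedLoop ku kx N x₀ 0 t)).s = 0 ∧
        InBox S.ulo S.uhi 0 (S.control ku kx N (S.closedLoop ku kx N x₀ 0 t)) ∧
        InBox S.xlo S.xhi 0 (S.closedLoop ku kx N x₀ 0 (t + 1)) := by
  obtain ⟨B, hB, hval⟩ := h.exists_value_bound N hN r
  obtain ⟨c, hc, hcQ⟩ := h.hQ.exists_le_quad
  obtain ⟨κ, hκ, hexact⟩ := h.exists_exact_penalty N hN (Real.sqrt (B / c))
  refine ⟨κ, hκ, fun ku kx hku hkx x₀ hr hf hinv t => ?_⟩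
  have hku0 : 0 < ku := by linarith
  have hkx0 : 0 < kx := by linarith
  have hbound : ∀ x : Fin n → ℝ, S.value ku kx N x ≤ B → vnorm x ≤ Real.sqrt (B / c) := by
    intro x hx
    refine Real.le_sqrt_of_sq_le ?_
    rw [vnorm_sq, le_div_iff₀ hc, mul_comm]
    exact (hcQ x).trans ((h.quadQ_le_quadP x).trans ((h.quadP_le_value hku0 hkx0 hN x).trans hx))
  have hstep : ∀ x : Fin n → ℝ, S.step ku kx N x 0 = S.predState x (S.opt ku kx N x) 1 :=
    fun x => by rw [step_eq, sub_zero]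
  have key : ∀ t, S.HardFeasible N (S.closedLoop ku kx N x₀ 0 t) ∧
      S.value ku kx N (S.closedLoop ku kx N x₀ 0 t) ≤ B := by
    intro t
    induction t with
    | zero => exact ⟨hf, hval ku kx hku0 hkx0 x₀ hr hf⟩
    | succ t ih =>
      set x := S.closedLoop ku kx N x₀ 0 t with hx
      obtain ⟨-, h2, h3⟩ := h.Gam_successor hT hku0 hkx0 hN (hinv t)
      rw [← hx] at h2 h3
      have hz := hexact ku kx hku hkx x (hbound x ih.2) ih.1
      rw [closedLoop, Pi.zero_apply, ← hx, hstep]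
      constructor
      · rw [h.hardFeasible_iff]
        refine ⟨shift (S.opt ku kx N x), fun k hk => ?_⟩
        rw [← penalty_succ]
        rcases Nat.lt_or_ge (k + 1) N with hk' | hk'
        · exact hz _ hk'
        -- The appended last stage starts in the terminal region, where `v = 0` violates nothing.
        · obtain rfl : N = k + 1 := by omega
          exact h.penalty_eq_zero hT h3 (opt_of_le x le_rfl)
      · refine (h.value_le hku0 hkx0 hN _ _).trans (h2.trans ?_)
        linarith [h.stageCost_nonneg x (S.control ku kx N x), ih.2]
  obtain ⟨h1, h2⟩ := key t
  set x := S.closedLoop ku kx N x₀ 0 t with hx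
  have hz := hexact ku kx hku hkx x (hbound x h2) h1
  have hzu : ∀ k < N, violVec S.ulo S.uhi (S.predInput x (S.opt ku kx N x) k) = 0 :=
    fun k hk => (violSum_eq_zero_iff _).1 (penalty_one_eq_zero_iff.1 (hz k hk)).1
  have hzx : ∀ k < N, violVec S.xlo S.xhi (S.predState x (S.opt ku kx N x) (k + 1)) = 0 :=
    fun k hk => (violSum_eq_zero_iff _).1 (penalty_one_eq_zero_iff.1 (hz k hk)).2
  rw [h.solution_eq_opt hku0 hkx0 hN]
  refine ⟨funext fun k => hzu k k.2, funext fun k => hzx k k.2, ?_, ?_⟩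
  · rw [inBox_iff h.hu le_rfl, control_eq, hzu 0 (by omega)]
  · rw [inBox_iff h.hx le_rfl, closedLoop, Pi.zero_apply, ← hx, hstep]
    exact (hzx 0 (by omega)).le

end Admissible

end MPCData

/-! ### Matrix norms induced by the sup norm. -/

section MatrixNorms

variable {κ κ₁ κ₂ ι ι₁ ι₂ : Type*} [Fintype κ] [Fintype κ₁] [Fintype κ₂] [Fintype ι] [Fintype ι₁]
  [Fintype ι₂]

theorem linfty_opNorm_le {M : Matrix κ ι ℝ} {C : ℝ} (hC : 0 ≤ C)
    (hM : ∀ i, ∑ j, |M i j| ≤ C) : ‖M‖ ≤ C := by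
  rw [linfty_opNorm_def]
  have : (Finset.univ.sup fun i => ∑ j, ‖M i j‖₊) ≤ (⟨C, hC⟩ : NNReal) := by
    refine Finset.sup_le fun i _ => ?_
    exact NNReal.coe_le_coe.1 (by rw [NNReal.coe_sum]; exact hM i)
  exact_mod_cast this

theorem row_sum_le_linfty_opNorm (M : Matrix κ ι ℝ) (i : κ) : ∑ j, |M i j| ≤ ‖M‖ := by
  rw [linfty_opNorm_def]
  have : ∑ j, ‖M i j‖₊ ≤ Finset.univ.sup fun i => ∑ j, ‖M i j‖₊ :=
    Finset.le_sup (f := fun i => ∑ j, ‖M i j‖₊) (Finset.mem_univ i)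
  rw [← NNReal.coe_le_coe] at this
  push_cast at this
  exact this

theorem linfty_opNorm_fromRows_le (M : Matrix κ₁ ι ℝ) (N : Matrix κ₂ ι ℝ) :
    ‖fromRows M N‖ ≤ ‖M‖ + ‖N‖ := by
  refine linfty_opNorm_le (by positivity) ?_
  rintro (i | i)
  · exact (row_sum_le_linfty_opNorm M i).trans (le_add_of_nonneg_right (norm_nonneg _))
  · exact (row_sum_le_linfty_opNorm N i).trans (le_add_of_nonneg_left (norm_nonneg _))

theorem linfty_opNorm_fromCols_le (M : Matrix κ ι₁ ℝ) (N : Matrix κ ι₂ ℝ) :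
    ‖fromCols M N‖ ≤ ‖M‖ + ‖N‖ := by
  refine linfty_opNorm_le (by positivity) fun i => ?_
  rw [Fintype.sum_sum_type]
  exact add_le_add (row_sum_le_linfty_opNorm M i) (row_sum_le_linfty_opNorm N i)

theorem linfty_opNorm_one_le [DecidableEq ι] : ‖(1 : Matrix ι ι ℝ)‖ ≤ 1 := by
  refine linfty_opNorm_le zero_le_one fun i => ?_
  rw [Finset.sum_eq_single i (fun j _ hj => by rw [one_apply_ne' hj, abs_zero]) (by simp)]
  simp

theorem linfty_opNorm_mul_le_of_le {M : Matrix κ ι ℝ} {N : Matrix ι ι₁ ℝ} {a b : ℝ}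
    (hM : ‖M‖ ≤ a) (hN : ‖N‖ ≤ b) : ‖M * N‖ ≤ a * b :=
  (linfty_opNorm_mul M N).trans
    (mul_le_mul hM hN (norm_nonneg _) ((norm_nonneg _).trans hM))

/-- A block matrix whose blocks in each row sum up to a bounded matrix is bounded. -/
theorem linfty_opNorm_le_of_blocks {p q : ℕ} {I J : Type*} [Fintype I] [Fintype J]
    {M : Matrix (I × Fin p) (J × Fin q) ℝ} {C : ℝ} (hC : 0 ≤ C) (b : I → J → ℝ)
    (hb : ∀ i j k l, |M (i, k) (j, l)| ≤ b i j) (hs : ∀ i, ∑ j, b i j ≤ C) :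
    ‖M‖ ≤ q * C := by
  refine linfty_opNorm_le (by positivity) fun ⟨i, k⟩ => ?_
  rw [Fintype.sum_prod_type]
  calc ∑ j, ∑ l, |M (i, k) (j, l)| ≤ ∑ j, ∑ _l : Fin q, b i j :=
        Finset.sum_le_sum fun j _ => Finset.sum_le_sum fun l _ => hb i j k l
    _ = q * ∑ j, b i j := by
        simp only [Finset.sum_const, Finset.card_univ, Fintype.card_fin, nsmul_eq_mul,
          Finset.mul_sum]
    _ ≤ q * C := by gcongr; exact hs i

theorem exists_abs_entry_le {p q : ℕ} (M : Matrix (Fin p) (Fin q) ℝ) :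
    ∃ C : ℝ, 0 ≤ C ∧ ∀ i j, |M i j| ≤ C :=
  ⟨‖M‖, norm_nonneg _, fun i j => (Finset.single_le_sum (f := fun j => |M i j|)
    (fun _ _ => abs_nonneg _) (Finset.mem_univ j)).trans (row_sum_le_linfty_opNorm M i)⟩

end MatrixNorms

/-- A convolution kernel supported on `j < i` with geometric decay has bounded row sums. -/
theorem sum_geometric_toeplitz_le {ρ : ℝ} (h0 : 0 ≤ ρ) (h1 : ρ < 1) (N i : ℕ) :
    ∑ j : Fin N, (if (j : ℕ) < i then ρ ^ (i - 1 - (j : ℕ)) else 0) ≤ (1 - ρ)⁻¹ := by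
  rw [Fin.sum_univ_eq_sum_range (fun j => if j < i then ρ ^ (i - 1 - j) else 0) N,
    ← Finset.sum_filter]
  refine le_trans ?_ (sum_geometric_le h0 h1 i)
  rw [← Finset.sum_range_reflect]
  refine Finset.sum_le_sum_of_subset_of_nonneg (fun j hj => ?_) fun _ _ _ => pow_nonneg h0 _
  rw [Finset.mem_filter] at hj
  exact Finset.mem_range.2 hj.2

/-- The column sums of the same kernel; they control the transposed matrices. -/
theorem sum_geometric_toeplitz_le' {ρ : ℝ} (h0 : 0 ≤ ρ) (h1 : ρ < 1) (N j : ℕ) :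
    ∑ i : Fin N, (if j < (i : ℕ) then ρ ^ ((i : ℕ) - 1 - j) else 0) ≤ (1 - ρ)⁻¹ := by
  rw [Fin.sum_univ_eq_sum_range (fun i => if j < i then ρ ^ (i - 1 - j) else 0) N,
    ← Finset.sum_filter]
  refine le_trans (le_of_eq ?_) (sum_geometric_le h0 h1 (N - (j + 1)))
  have : (Finset.range N).filter (fun i => j < i) = Finset.Ico (j + 1) N := by
    ext i; simp only [Finset.mem_filter, Finset.mem_range, Finset.mem_Ico]; omega
  rw [this, Finset.sum_Ico_eq_sum_range]
  refine Finset.sum_congr rfl fun k _ => ?_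
  congr 1
  omega

/-! ### Bounds on the quadratic program, uniform in the horizon. -/

namespace MPCData

variable {n m : ℕ} {S : MPCData n m} {ku kx : ℝ}

theorem predState_zero_eq (x : Fin n → ℝ) (k : ℕ) : S.predState x 0 k = (S.AK ^ k) *ᵥ x := by
  induction k with
  | zero => simp [predState]
  | succ k ih => rw [predState, ih, Pi.zero_apply, mulVec_zero, add_zero, mulVec_mulVec, pow_succ']

namespace Admissible

variable (h : S.Admissible)
include h

theorem exists_abs_pow_le : ∃ D ρ : ℝ, 0 ≤ D ∧ 0 ≤ ρ ∧ ρ < 1 ∧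
    ∀ (k : ℕ) (i j : Fin n), |(S.AK ^ k) i j| ≤ D * ρ ^ k := by
  obtain ⟨D, ρ, hD, hρ, hρ1, hdec⟩ := h.exists_vnorm_predState_le
  refine ⟨D, ρ, hD, hρ, hρ1, fun k i j => ?_⟩
  have h1 := (abs_apply_le_vnorm _ i).trans (hdec (Pi.single j 1) k)
  rw [predState_zero_eq, mulVec_single_one] at h1
  have h2 : vnorm (Pi.single j 1 : Fin n → ℝ) = 1 := by
    rw [← sq_eq_sq₀ (vnorm_nonneg _) zero_le_one, vnorm_sq]
    simp
  rw [h2, mul_one] at h1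
  exact h1

/-- Pre-stabilisation makes the block at `(i, j)` decay like `ρ ^ (i - 1 - j)`, so row and column
sums are bounded by geometric series of any length. -/
theorem exists_norm_PsiHat_le : ∃ C : ℝ, 0 ≤ C ∧ ∀ N : ℕ,
    ‖S.PsiHat N‖ ≤ C ∧ ‖(S.PsiHat N)ᵀ‖ ≤ C ∧ ‖S.Psi N‖ ≤ C ∧ ‖(S.Psi N)ᵀ‖ ≤ C := by
  obtain ⟨D, ρ, hD, hρ, hρ1, hpow⟩ := h.exists_abs_pow_le
  obtain ⟨b, hb, hB⟩ := exists_abs_entry_le S.B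
  set F := n * (D * b) with hF
  have hF0 : 0 ≤ F := by positivity
  have hent : ∀ (k : ℕ) (i : Fin n) (j : Fin m), |(S.AK ^ k * S.B) i j| ≤ F * ρ ^ k := by
    intro k i j
    rw [mul_apply]
    refine (Finset.abs_sum_le_sum_abs _ _).trans ?_
    have : ∀ l ∈ (Finset.univ : Finset (Fin n)), |(S.AK ^ k) i l * S.B l j| ≤ D * ρ ^ k * b := by
      intro l _
      rw [abs_mul]
      exact mul_le_mul (hpow k i l) (hB l j) (abs_nonneg _) (by positivity)
    refine (Finset.sum_le_sum this).trans_eq ?_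
    rw [Finset.sum_const, Finset.card_univ, Fintype.card_fin, nsmul_eq_mul, hF]
    ring
  have hent' : ∀ (N : ℕ) (i : Fin (N + 1)) (j : Fin N) (k : Fin n) (l : Fin m),
      |S.PsiHat N (i, k) (j, l)|
        ≤ F * if (j : ℕ) < (i : ℕ) then ρ ^ ((i : ℕ) - 1 - (j : ℕ)) else 0 := by
    intro N i j k l
    simp only [PsiHat, of_apply]
    split_ifs
    · exact hent _ _ _
    · simp
  have hinv : 0 ≤ (1 - ρ)⁻¹ := inv_nonneg.2 (by linarith)
  have hG : 0 ≤ F * (1 - ρ)⁻¹ := by positivity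
  have hrow : ∀ (N i : ℕ), ∑ j : Fin N, F * (if (j : ℕ) < i then ρ ^ (i - 1 - (j : ℕ)) else 0)
      ≤ F * (1 - ρ)⁻¹ := by
    intro N i
    rw [← Finset.mul_sum]
    exact mul_le_mul_of_nonneg_left (sum_geometric_toeplitz_le hρ hρ1 N i) hF0
  have hcol : ∀ (N j : ℕ),
      ∑ i : Fin (N + 1), F * (if j < (i : ℕ) then ρ ^ ((i : ℕ) - 1 - j) else 0)
      ≤ F * (1 - ρ)⁻¹ := by
    intro N j
    rw [← Finset.mul_sum]
    exact mul_le_mul_of_nonneg_left (sum_geometric_toeplitz_le' hρ hρ1 (N + 1) j) hF0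
  have hm : (m : ℝ) * (F * (1 - ρ)⁻¹) ≤ (m + n : ℝ) * (F * (1 - ρ)⁻¹) := by gcongr; simp
  have hn : (n : ℝ) * (F * (1 - ρ)⁻¹) ≤ (m + n : ℝ) * (F * (1 - ρ)⁻¹) := by gcongr; simp
  refine ⟨(m + n) * (F * (1 - ρ)⁻¹), by positivity, fun N => ⟨?_, ?_, ?_, ?_⟩⟩
  · exact (linfty_opNorm_le_of_blocks hG _ (fun i j k l => hent' N i j k l)
      fun i => hrow N i).trans hm
  · exact (linfty_opNorm_le_of_blocks hG _ (fun i j k l => hent' N j i l k)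
      fun i => hcol N i).trans hn
  · exact (linfty_opNorm_le_of_blocks hG _ (fun i j k l => hent' N i.succ j k l)
      fun i => hrow N i.succ).trans hm
  · refine (linfty_opNorm_le_of_blocks hG _ (fun i j k l => hent' N j.succ i l k)
      fun i => le_trans ?_ (hcol N i)).trans hn
    -- A column sum without the first block row is at most the full one.
    rw [Fin.sum_univ_succ]
    exact le_add_of_nonneg_left (mul_nonneg hF0 (by split_ifs <;> positivity))

omit h in
theorem exists_norm_blockDiag_le : ∃ C : ℝ, 0 ≤ C ∧ ∀ N : ℕ,
    ‖S.bigK N‖ ≤ C ∧ ‖(S.bigK N)ᵀ‖ ≤ C ∧ ‖S.bigR N‖ ≤ C ∧ ‖(S.bigR N)ᵀ‖ ≤ C ∧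
      ‖S.bigQHat N‖ ≤ C ∧ ‖(S.bigQHat N)ᵀ‖ ≤ C := by
  obtain ⟨cK, hcK, hK⟩ := exists_abs_entry_le S.K
  obtain ⟨cR, hcR, hR⟩ := exists_abs_entry_le S.R
  obtain ⟨cQ, hcQ, hQ⟩ := exists_abs_entry_le S.Q
  obtain ⟨cP, hcP, hP⟩ := exists_abs_entry_le S.P
  set c := cK + cR + cQ + cP with hc
  have hc0 : 0 ≤ c := by positivity
  have hn : (n : ℝ) * c ≤ (n + m : ℝ) * c := by gcongr; simp
  have hm : (m : ℝ) * c ≤ (n + m : ℝ) * c := by gcongr; simp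
  have hentK : ∀ (N : ℕ) (i : Fin N) (j : Fin (N + 1)) k l,
      |S.bigK N (i, k) (j, l)| ≤ if i.castSucc = j then c else 0 := by
    intro N i j k l
    simp only [bigK, of_apply]
    split_ifs
    · linarith [hK k l]
    · simp
  have hentR : ∀ (N : ℕ) (i j : Fin N) k l,
      |S.bigR N (i, k) (j, l)| ≤ if i = j then c else 0 := by
    intro N i j k l
    simp only [bigR, of_apply]
    split_ifs
    · linarith [hR k l]
    · simp
  have hentQ : ∀ (N : ℕ) (i j : Fin (N + 1)) k l,
      |S.bigQHat N (i, k) (j, l)| ≤ if i = j then c else 0 := by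
    intro N i j k l
    simp only [bigQHat, of_apply]
    split_ifs
    · simpa using hc0
    · linarith [hP k l]
    · linarith [hQ k l]
    · simp
  refine ⟨(n + m) * c, by positivity, fun N => ⟨?_, ?_, ?_, ?_, ?_, ?_⟩⟩
  · refine (linfty_opNorm_le_of_blocks hc0 _ (fun i j k l => hentK N i j k l) fun i => ?_).trans hn
    simp
  · refine (linfty_opNorm_le_of_blocks hc0 _ (fun i j k l => hentK N j i l k) fun i => ?_).trans hm
    -- The last block column of `bigK` is zero, so a row of the transpose meets at most one block
    -- instead of exactly one.
    rw [← Finset.sum_filter, Finset.sum_const, nsmul_eq_mul]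
    refine mul_le_of_le_one_left hc0 ?_
    have : (Finset.univ.filter fun j : Fin N => j.castSucc = i).card ≤ 1 :=
      Finset.card_le_one.2 fun a ha b hb => by
        rw [Finset.mem_filter] at ha hb
        exact Fin.castSucc_injective N (ha.2.trans hb.2.symm)
    exact_mod_cast this
  · refine (linfty_opNorm_le_of_blocks hc0 _ (fun i j k l => hentR N i j k l) fun i => ?_).trans hm
    simp
  · refine (linfty_opNorm_le_of_blocks hc0 _ (fun i j k l => hentR N j i l k) fun i => ?_).trans hm
    simp
  · refine (linfty_opNorm_le_of_blocks hc0 _ (fun i j k l => hentQ N i j k l) fun i => ?_).trans hn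
    simp
  · refine (linfty_opNorm_le_of_blocks hc0 _ (fun i j k l => hentQ N j i l k) fun i => ?_).trans hn
    simp

theorem exists_norm_PhiHat_le : ∃ C : ℝ, 0 ≤ C ∧ ∀ N : ℕ, ‖S.PhiHat N‖ ≤ C := by
  obtain ⟨D, ρ, hD, hρ, hρ1, hpow⟩ := h.exists_abs_pow_le
  refine ⟨n * D, by positivity, fun N => linfty_opNorm_le (by positivity) fun ⟨i, k⟩ => ?_⟩
  have : ∀ j ∈ (Finset.univ : Finset (Fin n)), |S.PhiHat N (i, k) j| ≤ D := fun j _ =>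
    (hpow i k j).trans (mul_le_of_le_one_right hD (pow_le_one₀ hρ hρ1.le))
  simpa using Finset.sum_le_sum this

theorem quadratic_program_bounds (ku kx : ℝ) : ∃ C : ℝ, ∀ N : ℕ,
    ‖S.qpH N‖ ≤ C ∧ ‖S.qpM N‖ ≤ C ∧ ‖(S.qpM N)ᵀ‖ ≤ C ∧
      ∀ x : Fin n → ℝ, ‖S.qpq ku kx N x‖ ≤ C * (1 + vnorm x) := by
  obtain ⟨p, hp, hPsi⟩ := h.exists_norm_PsiHat_le
  obtain ⟨b, hb, hblock⟩ := exists_norm_blockDiag_le (S := S)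
  obtain ⟨f, hf, hPhi⟩ := h.exists_norm_PhiHat_le
  set g := b * p + 1 with hg
  have hg0 : 0 ≤ g := by positivity
  set H := g * b * g + p * b * p with hH
  have hH0 : 0 ≤ H := by positivity
  -- The zeros mirror the nesting of `fromRows` and `fromCols`, so that the block estimates assemble
  -- by unification, also for the transpose.
  set M := (g + (1 + 0)) + ((g + (1 + 0)) + (0 + (1 + 0))) + ((p + (0 + 1)) + ((p + (0 + 1))
    + (0 + (0 + 1)))) with hM
  have hM0 : 0 ≤ M := by positivity
  set q := (g * (b * b) + p * b) * f with hq
  have hq0 : 0 ≤ q := by positivity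
  refine ⟨H + M + q + |ku| + |kx|, fun N => ?_⟩
  obtain ⟨p1, p2, p3, p4⟩ := hPsi N
  obtain ⟨b1, b2, b3, b4, b5, b6⟩ := hblock N
  have hku := abs_nonneg ku
  have hkx := abs_nonneg kx
  have i1 : ‖S.inputMap N‖ ≤ g :=
    (norm_add_le _ _).trans (add_le_add (linfty_opNorm_mul_le_of_le b1 p1) linfty_opNorm_one_le)
  have i2 : ‖(S.inputMap N)ᵀ‖ ≤ g := by
    rw [inputMap, transpose_add, transpose_mul, transpose_one, hg, mul_comm b]
    exact (norm_add_le _ _).trans (add_le_add (linfty_opNorm_mul_le_of_le p2 b2) linfty_opNorm_one_le)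
  have hR : ∀ {I J₁ J₂ : Type} [Fintype I] [Fintype J₁] [Fintype J₂] {X : Matrix J₁ I ℝ}
      {Y : Matrix J₂ I ℝ} {x y : ℝ}, ‖X‖ ≤ x → ‖Y‖ ≤ y → ‖fromRows X Y‖ ≤ x + y :=
    fun hX hY => (linfty_opNorm_fromRows_le _ _).trans (add_le_add hX hY)
  have hC : ∀ {I J₁ J₂ : Type} [Fintype I] [Fintype J₁] [Fintype J₂] {X : Matrix I J₁ ℝ}
      {Y : Matrix I J₂ ℝ} {x y : ℝ}, ‖X‖ ≤ x → ‖Y‖ ≤ y → ‖fromCols X Y‖ ≤ x + y :=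
    fun hX hY => (linfty_opNorm_fromCols_le _ _).trans (add_le_add hX hY)
  have hone : ∀ {I : Type} [Fintype I] [DecidableEq I], ‖(1 : Matrix I I ℝ)‖ ≤ 1 :=
    linfty_opNorm_one_le
  have hneg : ∀ {I : Type} [Fintype I] [DecidableEq I], ‖(-1 : Matrix I I ℝ)‖ ≤ 1 :=
    (norm_neg _).trans_le linfty_opNorm_one_le
  have hzero : ∀ {I J : Type} [Fintype I] [Fintype J], ‖(0 : Matrix I J ℝ)‖ ≤ 0 :=
    norm_zero.le
  refine ⟨?_, ?_, ?_, fun x => ?_⟩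
  · have h1 : ‖S.qpH N‖ ≤ (H + 0) + (0 + 0) := by
      rw [qpH, ← fromRows_fromCols_eq_fromBlocks]
      refine hR (hC ?_ hzero) (hC hzero hzero)
      exact (norm_add_le _ _).trans (add_le_add
        (linfty_opNorm_mul_le_of_le (linfty_opNorm_mul_le_of_le i2 b3) i1)
        (linfty_opNorm_mul_le_of_le (linfty_opNorm_mul_le_of_le p2 b5) p1))
    linarith
  · have h1 : ‖S.qpM N‖ ≤ M := by
      rw [qpM]
      exact hR (hR (hC i1 (hC hone hzero)) (hR (hC i1 (hC hneg hzero)) (hC hzero (hC hone hzero))))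
        (hR (hC p3 (hC hzero hone)) (hR (hC p3 (hC hzero hneg)) (hC hzero (hC hzero hone))))
    linarith
  · have h1 : ‖(S.qpM N)ᵀ‖ ≤ M := by
      rw [qpM]
      simp only [transpose_fromRows, transpose_fromCols, transpose_zero, transpose_one,
        transpose_neg]
      exact hC (hC (hR i2 (hR hone hzero)) (hC (hR i2 (hR hneg hzero)) (hR hzero (hR hone hzero))))
        (hC (hR p4 (hR hzero hone)) (hC (hR p4 (hR hzero hneg)) (hR hzero (hR hzero hone))))
    linarith
  · have hx := vnorm_nonneg x
    have hxn : ‖x‖ ≤ vnorm x := (pi_norm_le_iff_of_nonneg hx).2 (abs_apply_le_vnorm x)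
    have h1 : ‖((S.bigK N)ᵀ * S.bigR N * S.inputMap N + S.bigQHat N * S.PsiHat N)ᵀ‖
        ≤ g * (b * b) + p * b := by
      rw [transpose_add, transpose_mul, transpose_mul, transpose_mul, transpose_transpose]
      exact (norm_add_le _ _).trans (add_le_add (linfty_opNorm_mul_le_of_le i2 (linfty_opNorm_mul_le_of_le b4 b1))
        (linfty_opNorm_mul_le_of_le p2 b6))
    have h2 : ‖((S.bigK N)ᵀ * S.bigR N * S.inputMap N + S.bigQHat N * S.PsiHat N)ᵀ
        *ᵥ (S.PhiHat N *ᵥ x)‖ ≤ q * vnorm x := by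
      refine (linfty_opNorm_mulVec _ _).trans ?_
      have h3 : ‖S.PhiHat N *ᵥ x‖ ≤ f * vnorm x :=
        (linfty_opNorm_mulVec _ _).trans
          (mul_le_mul (hPhi N) hxn (norm_nonneg _) hf)
      rw [hq, mul_assoc]
      exact mul_le_mul h1 h3 (norm_nonneg _) (by positivity)
    have h4 : 0 ≤ (H + M + q + |ku| + |kx|) * vnorm x := by positivity
    have h5 : q * vnorm x ≤ (H + M + q + |ku| + |kx|) * vnorm x := by
      gcongr; linarith
    refine (pi_norm_le_iff_of_nonneg (by positivity)).2 ?_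
    rintro (i | i | i)
    · refine (norm_le_pi_norm _ i).trans (h2.trans ?_)
      linarith
    · rw [qpq, Sum.elim_inr, Sum.elim_inl, Real.norm_eq_abs]
      linarith
    · rw [qpq, Sum.elim_inr, Sum.elim_inr, Real.norm_eq_abs]
      linarith

end Admissible

end MPCData

theorem proposition1 (n m : ℕ) (S : MPCData n m)
    (hQ : S.Q.PosDef) (hR : S.R.PosSemidef) (hP : S.P.PosSemidef)
    (hinv : IsUnit (S.R + S.Bᵀ * S.P * S.B))
    (hDARE : S.P = S.Aᵀ * S.P * S.A
      - S.Aᵀ * S.P * S.B * (S.R + S.Bᵀ * S.P * S.B)⁻¹ * S.Bᵀ * S.P * S.A + S.Q)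
    (hK : S.K = -((S.R + S.Bᵀ * S.P * S.B)⁻¹ * S.Bᵀ * S.P * S.A))
    (hx : ∀ i, S.xlo i < 0 ∧ 0 < S.xhi i) (hu : ∀ i, S.ulo i < 0 ∧ 0 < S.uhi i) :
    -- at every state the problem is feasible, with exactly one solution
    (∀ ku kx : ℝ, 0 < ku → 0 < kx → ∀ N : ℕ, 1 ≤ N → ∀ x : Fin n → ℝ,
      ∃! z : MPCDecision n m N, S.IsSolution ku kx N x z) ∧
    -- 1. infinite-horizon optimality
    (∀ ku kx : ℝ, 0 < ku → 0 < kx → ∃ Om : ℕ → Set (Fin n → ℝ),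
      (∀ C : Set (Fin n → ℝ), IsCompact C → ∃ Nbar : ℕ, 1 ≤ Nbar ∧ C ⊆ Om Nbar) ∧
      ∀ Nbar : ℕ, 1 ≤ Nbar → IsCompact (Om Nbar) ∧ Om Nbar ∈ 𝓝 0 ∧
        ∀ x₀ ∈ Om Nbar, ∃ (v r : ℕ → Fin m → ℝ) (s : ℕ → Fin n → ℝ),
          S.InfOptimal ku kx x₀ v r s ∧
          ∀ N : ℕ, Nbar ≤ N →
            (∀ k : Fin N, (S.solution ku kx N x₀).du k = v k ∧
              (S.solution ku kx N x₀).r k = r k ∧ (S.solution ku kx N x₀).s k = s k) ∧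
            (∀ t : ℕ, S.closedLoop ku kx N x₀ 0 t = S.predState x₀ v t ∧
              S.control ku kx N (S.closedLoop ku kx N x₀ 0 t) = S.predInput x₀ v t) ∧
            ENNReal.ofReal (S.value ku kx N x₀) = S.infCost ku kx x₀ v r s) ∧
    -- 2. and 3. concern the same sets `Γ_N`
    (∃ d α : ℝ, 0 < d ∧ 0 < α ∧
      -- 2. nominal asymptotic stability on `Γ_N`
      (∀ ku kx : ℝ, 0 < ku → 0 < kx → ∀ N : ℕ, 1 ≤ N →
        S.Gam ku kx d α N ∈ 𝓝 0 ∧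
        (∀ ε : ℝ, 0 < ε → ∃ δ : ℝ, 0 < δ ∧ ∀ x₀ : Fin n → ℝ, vnorm x₀ < δ →
          ∀ t, vnorm (S.closedLoop ku kx N x₀ 0 t) < ε) ∧
        ∀ x₀ ∈ S.Gam ku kx d α N,
          (∀ t, S.closedLoop ku kx N x₀ 0 t ∈ S.Gam ku kx d α N) ∧
          Tendsto (S.closedLoop ku kx N x₀ 0) atTop (𝓝 0)) ∧
      -- 2. hard constraint satisfaction for all times, for sufficiently high penalties
      (∀ N : ℕ, 1 ≤ N → ∀ ρ : ℝ, ∃ κ : ℝ, 0 < κ ∧ ∀ ku kx : ℝ, κ ≤ ku → κ ≤ kx →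
        ∀ x₀ ∈ S.Gam ku kx d α N, vnorm x₀ ≤ ρ → S.HardFeasible N x₀ → ∀ t,
          (S.solution ku kx N (S.closedLoop ku kx N x₀ 0 t)).r = 0 ∧
          (S.solution ku kx N (S.closedLoop ku kx N x₀ 0 t)).s = 0 ∧
          InBox S.ulo S.uhi 0 (S.control ku kx N (S.closedLoop ku kx N x₀ 0 t)) ∧
          InBox S.xlo S.xhi 0 (S.closedLoop ku kx N x₀ 0 (t + 1))) ∧
      -- 3. robustness to model errors
      (∀ ku kx : ℝ, 0 < ku → 0 < kx → ∃ μ : ℝ, 0 < μ ∧ ∀ N : ℕ, 1 ≤ N →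
        -- invariance of `Γ_N` and the decrease inequality
        (∃ σ : ℝ → ℝ, ClassK σ ∧ (∃ b : ℝ, ∀ a : ℝ, 0 ≤ a → σ a ≤ b) ∧
          ∀ x ∈ S.Gam ku kx d α N, ∀ w : Fin n → ℝ, vnorm w ≤ μ →
            S.step ku kx N x w ∈ S.Gam ku kx d α N ∧
            S.value ku kx N (S.step ku kx N x w)
              ≤ S.value ku kx N x - S.stageCost x (S.control ku kx N x) + σ (vnorm w)) ∧
        -- input-to-state stability
        (∃ (β : ℝ → ℕ → ℝ) (γ : ℝ → ℝ), ClassKL β ∧ ClassK γ ∧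
          ∀ x₀ ∈ S.Gam ku kx d α N, ∀ w : ℕ → Fin n → ℝ, (∀ t, vnorm (w t) ≤ μ) →
            ∀ (t : ℕ) (c : ℝ), 0 ≤ c → (∀ τ < t, vnorm (w τ) ≤ c) →
              vnorm (S.closedLoop ku kx N x₀ w t) ≤ β (vnorm x₀) t + γ c) ∧
        -- robust satisfaction of the hard constraints
        (∃ T : ℕ, ∀ x₀ ∈ S.Gam ku kx d α N, ∀ w : ℕ → Fin n → ℝ, (∀ t, vnorm (w t) ≤ μ) →
          ∀ t : ℕ, (T ≤ t ∨ x₀ ⬝ᵥ S.P *ᵥ x₀ ≤ α) →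
            (S.solution ku kx N (S.closedLoop ku kx N x₀ w t)).r = 0 ∧
            (S.solution ku kx N (S.closedLoop ku kx N x₀ w t)).s = 0 ∧
            InBox S.ulo S.uhi 0 (S.control ku kx N (S.closedLoop ku kx N x₀ w t)) ∧
            InBox S.xlo S.xhi 0 (S.closedLoop ku kx N x₀ w t)))) ∧
    -- 4. bounds on the data of the quadratic program, uniform in the horizon
    (∀ ku kx : ℝ, 0 < ku → 0 < kx → ∃ C : ℝ, ∀ N : ℕ, 1 ≤ N →
      ‖S.qpH N‖ ≤ C ∧ ‖S.qpM N‖ ≤ C ∧ ‖(S.qpM N)ᵀ‖ ≤ C ∧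
      ∀ x : Fin n → ℝ, ‖S.qpq ku kx N x‖ ≤ C * (1 + vnorm x)) := by
  have h : S.Admissible := ⟨hQ, hR, hP, hinv, hDARE, hK, hx, hu⟩
  -- Both constants come from the data alone, before the penalties and the horizon are chosen.
  obtain ⟨d, α, hT⟩ := h.exists_isTerminalLevel
  refine ⟨fun ku kx hku hkx N hN x => h.existsUnique_isSolution hku hkx hN x,
    fun ku kx hku hkx => h.infinite_horizon_optimality hT hku hkx,
    ⟨d, α, hT.d_pos, hT.α_pos, fun ku kx hku hkx N hN => ?_, fun N hN ρ => ?_,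
      fun ku kx hku hkx => ?_⟩, fun ku kx _ _ => ?_⟩
  · obtain ⟨l, E, μ, hC⟩ := h.exists_contraction hT hku hkx
    exact h.nominal_stability hT hC hku hkx hN
  · obtain ⟨κ, hκ, hhard⟩ := h.hard_constraints hT N hN ρ
    -- The threshold is fixed before the penalties; invariance of `Γ_N`, which depends on them, is
    -- supplied afterwards for each pair.
    refine ⟨κ, hκ, fun ku kx hku hkx x₀ hx₀ hr hf => hhard ku kx hku hkx x₀ hr hf ?_⟩
    have hku0 := hκ.trans_le hku
    have hkx0 := hκ.trans_le hkx
    obtain ⟨l, E, μ, hC⟩ := h.exists_contraction hT hku0 hkx0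
    exact ((h.nominal_stability hT hC hku0 hkx0 hN).2.2 x₀ hx₀).1
  · obtain ⟨l, E, μ, hC⟩ := h.exists_contraction hT hku hkx
    refine ⟨μ, hC.μ_pos, fun N hN => ⟨?_, h.input_to_state_stability hC hku hkx hN,
      h.robust_constraints hT hC hku hkx hN⟩⟩
    obtain ⟨σ, hσ, hb, hdec⟩ := h.exists_decrease hT hku hkx hN
    exact ⟨σ, hσ, hb, fun x hx w hw =>
      ⟨(hC.step N hN x hx w hw).1, hdec x hx w (hw.trans hC.μ_le)⟩⟩
  · obtain ⟨C, hC⟩ := h.quadratic_program_bounds ku kx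
    exact ⟨C, fun N _ => hC N⟩
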